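/- Let $n\ge 2$ and $T>0$. Write $\mathcal S^n_0$ for the symmetric trace-free real $n\times n$ matrices, and for $(v,u)\in\mathbb R^n\times\mathcal S^n_0$ put $e(v,u)=\frac n2\lambda_{\max}(v\otimes v-u)$, where $\lambda_{\max}$ is the largest eigenvalue. Let $C([0,T];L^2_w)$ be the space of $v:[0,T]\to L^2(\mathbb R^n;\mathbb R^n)$ that are continuous for the weak topology of $L^2$, with the topology of uniform convergence on $[0,T]$ (that is, $v_k\to v$ iff $\int v_k(x,t)\cdot\varphi(x)\,dx\to\int v(x,t)\cdot\varphi(x)\,dx$ uniformly in $t\in[0,T]$ for each $\varphi\in L^2$). The notation $\subset\subset$ means "is a compact subset of". Let $\Omega\subset\mathbb R^n$ be open and $\bar e\in C(\overline\Omega\times(0,T))\cap C([0,T];L^1(\Omega))$. Let $v_0:\mathbb R^n\times(0,T)\to\mathbb R^n$, $u_0:\mathbb R^n\times(0,T)\to\mathcal S^n_0$, $q_0:\mathbb R^n\times(0,T)\to\mathbb R$ be smooth with $$\partial_tv_0+\operatorname{div}u_0+\nabla q_0=0,\qquad \operatorname{div}v_0=0\qquad\text{in }\mathbb R^n\times(0,T),$$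 such that $v_0\in C([0,T];L^2_w)$, $\operatorname{supp}v_0(\cdot,t),\ \operatorname{supp}u_0(\cdot,t)\subset\subset\Omega$ for all $t\in(0,T)$, and $e(v_0,u_0)<\bar e$ on $\Omega\times(0,T)$. Let $X_0$ be the set of all $v\in C^\infty(\mathbb R^n\times(0,T);\mathbb R^n)\cap C([0,T];L^2_w)$ such that $\operatorname{div}v=0$ in $\mathbb R^n\times(0,T)$, $v(\cdot,0)=v_0(\cdot,0)$ and $v(\cdot,T)=v_0(\cdot,T)$ almost everywhere, $\operatorname{supp}v(\cdot,t)\subset\subset\Omega$ for all $t\in(0,T)$, and for which there is a smooth $u:\mathbb R^n\times(0,T)\to\mathcal S^n_0$ with $e(v,u)<\bar e$ on $\Omega\times(0,T)$, $\operatorname{supp}u(\cdot,t)\subset\subset\Omega$ for all $t\in(0,T)$, and $\partial_tv+\operatorname{div}u+\nabla q_0=0$ in $\mathbb R^n\times(0,T)$. For $\varepsilon>0$ and a bounded open set $\Omega_0\subset\Omega$ let $$I_{\varepsilon,\Omega_0}(v)=\inf_{t\in[\varepsilon,T-\varepsilon]}\int_{\Omega_0}\Bigl[\tfrac12|v(x,t)|^2-\bar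 e(x,t)\Bigr]dx$$ (with $\inf\emptyset=+\infty$). Proposition (the perturbation property). (a) Let a bounded open set $\Omega_0\subset\Omega$ and $\varepsilon>0$ be given. For every $\alpha>0$ there exists $\beta>0$ such that whenever $v\in X_0$ satisfies $I_{\varepsilon,\Omega_0}(v)<-\alpha$, there is a sequence $v_k\in X_0$ with $v_k\to v$ in $C([0,T];L^2_w)$ and $$\liminf_{k\to\infty}I_{\varepsilon,\Omega_0}(v_k)\ge I_{\varepsilon,\Omega_0}(v)+\beta.$$ (b) If moreover $\Omega$ is bounded and $\bar e$ is bounded, then in (a) one can take $\beta=\min\{\alpha/2,\,C\alpha^2\}$ with a constant $C>0$ depending only on $n$ and on upper bounds for $|\Omega|$ and $\|\bar e\|_\infty$ (in particular $C$ does not depend on $T$, $(v_0,u_0,q_0)$, $\Omega_0$, $\varepsilon$, $\alpha$ or $v$). -/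

import Mathlib

open Set Filter Topology MeasureTheory
open scoped ContDiff

noncomputable section

namespace EulerSub

/-- Euclidean space `ℝⁿ`. -/
abbrev Sp (n : ℕ) : Type := EuclideanSpace ℝ (Fin n)

/-- Time-dependent vector fields; `v t x` is the value at time `t` and point `x`.
Only times in `[0, T]` (or in `]0, T[`) are ever used. -/
abbrev VField (n : ℕ) : Type := ℝ → Sp n → Sp n

/-- Time-dependent matrix fields. -/
abbrev MField (n : ℕ) : Type := ℝ → Sp n → Matrix (Fin n) (Fin n) ℝ

/-- Time-dependent scalar fields. -/
abbrev SField (n : ℕ) : Type := ℝ → Sp n → ℝ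

/-- The tensor product `v ⊗ v`. -/
def tensorSq {n : ℕ} (v : Sp n) : Matrix (Fin n) (Fin n) ℝ :=
  Matrix.of fun i j => v i * v j

/-- The largest (real) eigenvalue of a matrix. It is applied to symmetric matrices of positive
size only, whose set of eigenvalues is finite and nonempty. -/
def lambdaMax {n : ℕ} (w : Matrix (Fin n) (Fin n) ℝ) : ℝ :=
  sSup (spectrum ℝ w)

/-- The generalized energy density `e(v, u) = (n / 2) λ_max(v ⊗ v - u)`. -/
def genEnergy {n : ℕ} (v : Sp n) (u : Matrix (Fin n) (Fin n) ℝ) : ℝ :=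
  (n : ℝ) / 2 * lambdaMax (tensorSq v - u)

/-- The space `S₀ⁿ` of symmetric traceless matrices. -/
def symTraceless (n : ℕ) : Set (Matrix (Fin n) (Fin n) ℝ) :=
  {w | w.IsSymm ∧ w.trace = 0}

/-- The `i`-th partial derivative of a scalar function on `ℝⁿ`. -/
def pderiv {n : ℕ} (i : Fin n) (f : Sp n → ℝ) (x : Sp n) : ℝ :=
  fderiv ℝ f x (EuclideanSpace.single i 1)

/-- `v` is smooth on `ℝⁿ × ]0, T[`. -/
def SmoothVec {n : ℕ} (T : ℝ) (v : VField n) : Prop :=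
  ContDiffOn ℝ ∞ (fun p : ℝ × Sp n => v p.1 p.2) (Ioo 0 T ×ˢ univ)

/-- `u` is a smooth field of symmetric traceless matrices on `ℝⁿ × ]0, T[`. -/
def SmoothMat {n : ℕ} (T : ℝ) (u : MField n) : Prop :=
  (∀ i j, ContDiffOn ℝ ∞ (fun p : ℝ × Sp n => u p.1 p.2 i j) (Ioo 0 T ×ˢ univ)) ∧
    ∀ t ∈ Ioo 0 T, ∀ x, u t x ∈ symTraceless n

/-- `q` is smooth on `ℝⁿ × ]0, T[`. -/
def SmoothScal {n : ℕ} (T : ℝ) (q : SField n) : Prop :=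
  ContDiffOn ℝ ∞ (fun p : ℝ × Sp n => q p.1 p.2) (Ioo 0 T ×ˢ univ)

/-- `div v = 0` on `ℝⁿ × ]0, T[`. -/
def DivFree {n : ℕ} (T : ℝ) (v : VField n) : Prop :=
  ∀ t ∈ Ioo 0 T, ∀ x, ∑ i, pderiv i (fun y => v t y i) x = 0

/-- `∂ₜ v + div u + ∇ q = 0` on `ℝⁿ × ]0, T[`. -/
def MomentumEq {n : ℕ} (T : ℝ) (v : VField n) (u : MField n) (q : SField n) : Prop :=
  ∀ t ∈ Ioo 0 T, ∀ x, ∀ i,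
    deriv (fun s => v s x i) t + ∑ j, pderiv j (fun y => u t y i j) x + pderiv i (q t) x = 0

/-- `v ∈ C([0, T]; L²_w(ℝⁿ))`: every `v(·, t)` is in `L²`, and `t ↦ ∫ v(x, t) · φ(x) dx` is
continuous on `[0, T]` for every `φ ∈ L²(ℝⁿ; ℝⁿ)`. -/
def MemCL2w {n : ℕ} (T : ℝ) (v : VField n) : Prop :=
  (∀ t ∈ Icc 0 T, MemLp (v t) 2 volume) ∧
    ∀ φ : Sp n → Sp n, MemLp φ 2 volume →
      ContinuousOn (fun t => ∫ x, inner ℝ (v t x) (φ x)) (Icc 0 T)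

/-- Convergence in `C([0, T]; L²_w(ℝⁿ))`: weak convergence in `L²`, uniformly in `t ∈ [0, T]`. -/
def TendstoCL2w {n : ℕ} (T : ℝ) (w : ℕ → VField n) (v : VField n) : Prop :=
  ∀ φ : Sp n → Sp n, MemLp φ 2 volume →
    TendstoUniformlyOn (fun k t => ∫ x, inner ℝ (w k t x) (φ x))
      (fun t => ∫ x, inner ℝ (v t x) (φ x)) atTop (Icc 0 T)

/-- `f ∈ C([0, T]; L¹(Ω))`. -/
def MemCL1 {n : ℕ} (T : ℝ) (Ω : Set (Sp n)) (f : SField n) : Prop :=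
  (∀ t ∈ Icc 0 T, IntegrableOn (f t) Ω volume) ∧
    ∀ t₀ ∈ Icc 0 T, Tendsto (fun t => ∫ x in Ω, |f t x - f t₀ x|) (𝓝[Icc 0 T] t₀) (𝓝 0)

/-- The support of `f` is a compact subset of `Ω`. -/
def SuppIn {n : ℕ} {F : Type*} [Zero F] (f : Sp n → F) (Ω : Set (Sp n)) : Prop :=
  HasCompactSupport f ∧ tsupport f ⊆ Ω

/-- The standing assumptions on the open set `Ω`, the energy profile `ebar` and the
reference subsolution `(v₀, u₀, q₀)`. -/
structure IsDatum {n : ℕ} (T : ℝ) (Ω : Set (Sp n)) (ebar : SField n)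
    (v₀ : VField n) (u₀ : MField n) (q₀ : SField n) : Prop where
  isOpen : IsOpen Ω
  ebar_cont : ContinuousOn (fun p : ℝ × Sp n => ebar p.1 p.2) (Ioo 0 T ×ˢ closure Ω)
  ebar_L1 : MemCL1 T Ω ebar
  smooth_v : SmoothVec T v₀
  smooth_u : SmoothMat T u₀
  smooth_q : SmoothScal T q₀
  div_free : DivFree T v₀
  momentum : MomentumEq T v₀ u₀ q₀
  v_L2w : MemCL2w T v₀
  supp_v : ∀ t ∈ Ioo 0 T, SuppIn (v₀ t) Ω
  supp_u : ∀ t ∈ Ioo 0 T, SuppIn (u₀ t) Ω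
  energy_lt : ∀ t ∈ Ioo 0 T, ∀ x ∈ Ω, genEnergy (v₀ t x) (u₀ t x) < ebar t x

/-- `v` is a subsolution with the boundary values of `v₀` and the modified pressure `q₀`. -/
structure IsSubsolution {n : ℕ} (T : ℝ) (Ω : Set (Sp n)) (ebar : SField n)
    (v₀ : VField n) (q₀ : SField n) (v : VField n) : Prop where
  smooth : SmoothVec T v
  L2w : MemCL2w T v
  div_free : DivFree T v
  initial : v 0 =ᵐ[volume] v₀ 0
  terminal : v T =ᵐ[volume] v₀ T
  supp : ∀ t ∈ Ioo 0 T, SuppIn (v t) Ω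
  exists_matrix : ∃ u : MField n, SmoothMat T u ∧
    (∀ t ∈ Ioo 0 T, ∀ x ∈ Ω, genEnergy (v t x) (u t x) < ebar t x) ∧
    (∀ t ∈ Ioo 0 T, SuppIn (u t) Ω) ∧
    MomentumEq T v u q₀

/-- The set `X₀` of subsolutions. -/
def X0 {n : ℕ} (T : ℝ) (Ω : Set (Sp n)) (ebar : SField n)
    (v₀ : VField n) (q₀ : SField n) : Set (VField n) :=
  {v | IsSubsolution T Ω ebar v₀ q₀ v}

/-- The functional
`I_{ε,Ω₀}(v) = inf_{t ∈ [ε, T - ε]} ∫_{Ω₀} (|v(x, t)|² / 2 - ebar(x, t)) dx`, as an extended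
real number (the infimum over the empty set is `+∞`). -/
def functI {n : ℕ} (T : ℝ) (ebar : SField n) (ε : ℝ) (Ω₀ : Set (Sp n)) (v : VField n) : EReal :=
  ⨅ t ∈ Icc ε (T - ε), ((∫ x in Ω₀, ((1 / 2) * ‖v t x‖ ^ 2 - ebar t x) : ℝ) : EReal)

end EulerSub

end

/-! Write $\bar e$ for `ebar` and $R = \frac{2\bar e}{n}\,\mathrm{Id} + u - v\otimes v$. The
inequality $e(v,u)<\bar e$ says that $R$ is positive definite, and $\operatorname{tr} R = 2\bar
e-|v|^2$ is twice the missing energy density. Energy can therefore be added by fast oscillations as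
long as $R$ stays positive.

Pointwise, let $m\ge \operatorname{tr}R/n$ be the largest eigenvalue of $R$, $f$ a unit eigenvector
for it, and $v=(v\cdot f)f+c\,\xi$ with $\xi\perp f$ a unit vector. The shear wave $\cos(K(\xi\cdot
x-ct))\,(f,\;c(f\otimes\xi+\xi\otimes f))$ solves the linear system without pressure. Moving $(v,u)$
in its direction changes $R$ only by a multiple of $f\otimes f$, which $R$ can afford up to $m$.
This yields a segment of half-length $\gamma$ with $\gamma^2\ge(\bar e-\frac12|v|^2)^2/(8n^2\bar e)$
(`exists_shear_segment`).

The waves are localized through a third-order potential, at the cost of an error $O(1/K)$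
(`isPerturbation_pot`, `exists_localized_wave`), so the pressure $q_0$ never changes. A compact part
of space-time is covered by small bumps whose overlap is bounded in terms of $n$ alone
(`exists_bump_family`), and the segment is frozen on each bump. Since admissible states form a
convex set (`admissible_convex`), the sum of the suitably scaled waves keeps the state admissible.
The waves have different frequencies, so by Riemann–Lebesgue, uniformly in time, the perturbation
tends weakly to zero, while all cross terms average out and the energy rises by $\frac14\int S$.
Here $S$ is the sum of the squared amplitudes, and it dominates a multiple of $(\bar
e-\frac12|v|^2)^2$ (`wave_energy_negligible`, `exists_perturbation_sequence`).

At a time when the deficit is at least $\alpha/2$, Cauchy–Schwarz turns this into a gain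
$C\alpha^2$; at any other time the integral already exceeds the infimum by $\alpha/2$. Uniformity in
time lets both cases pass to the infimum, whence $\beta=\min\{\alpha/2,C\alpha^2\}$. The constant
involves only $n$, a bound for $|\Omega_0|$ and an upper bound for $\bar e$ on
$[\varepsilon,T-\varepsilon]\times\Omega_0$. In (a) these come from compactness, in (b) from the
assumed bounds. -/

namespace EulerSub

/-! ### Positivity of the Reynolds stress and long admissible shear segments. -/

section ShearSegments

open scoped Matrix

variable {n : ℕ}

/-- The matrix `(2 E / n) Id + u - v ⊗ v`, whose positivity expresses `e(v, u) < E`. -/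
noncomputable def reynolds (v : Sp n) (u : Matrix (Fin n) (Fin n) ℝ) (E : ℝ) :
    Matrix (Fin n) (Fin n) ℝ :=
  (2 * E / n) • (1 : Matrix (Fin n) (Fin n) ℝ) + u - tensorSq v

/-- The quadratic form of `reynolds v u E`. -/
noncomputable def reynoldsForm (v : Sp n) (u : Matrix (Fin n) (Fin n) ℝ) (E : ℝ) (x : Sp n) : ℝ :=
  2 * E / n * ‖x‖ ^ 2 + x.ofLp ⬝ᵥ (u *ᵥ x.ofLp) - inner ℝ v x ^ 2

/-- Positivity of the Reynolds stress. -/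
def Admissible (v : Sp n) (u : Matrix (Fin n) (Fin n) ℝ) (E : ℝ) : Prop :=
  ∀ x : Sp n, x ≠ 0 → 0 < reynoldsForm v u E x

theorem inner_eq_dotProduct (x y : Sp n) : inner ℝ x y = x.ofLp ⬝ᵥ y.ofLp := by
  rw [EuclideanSpace.inner_eq_star_dotProduct, dotProduct_comm]
  simp

theorem tensorSq_eq (v : Sp n) : tensorSq v = Matrix.vecMulVec v.ofLp v.ofLp := by
  ext i j
  simp [tensorSq, Matrix.vecMulVec_apply]

theorem reynolds_isHermitian (v : Sp n) {u : Matrix (Fin n) (Fin n) ℝ} (hu : u.IsSymm) (E : ℝ) :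
    (reynolds v u E).IsHermitian := by
  ext i j
  have h := hu.apply i j
  simp [reynolds, tensorSq, Matrix.one_apply, h, eq_comm, mul_comm]

theorem dotProduct_reynolds_mulVec (v : Sp n) (u : Matrix (Fin n) (Fin n) ℝ) (E : ℝ) (x : Sp n) :
    x.ofLp ⬝ᵥ (reynolds v u E *ᵥ x.ofLp) = reynoldsForm v u E x := by
  have h1 : ‖x‖ ^ 2 = x.ofLp ⬝ᵥ x.ofLp := by
    rw [← inner_eq_dotProduct, real_inner_self_eq_norm_sq]
  rw [reynolds, reynoldsForm, tensorSq_eq, h1, inner_eq_dotProduct]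
  simp only [Matrix.sub_mulVec, Matrix.add_mulVec, Matrix.smul_mulVec, Matrix.one_mulVec,
    dotProduct_sub, dotProduct_add, dotProduct_smul, Matrix.vecMulVec_mulVec]
  simp [dotProduct_comm]
  ring

theorem admissible_iff_posDef {v : Sp n} {u : Matrix (Fin n) (Fin n) ℝ} (hu : u.IsSymm) (E : ℝ) :
    Admissible v u E ↔ (reynolds v u E).PosDef := by
  rw [Matrix.posDef_iff_dotProduct_mulVec]
  constructor
  · intro h
    refine ⟨reynolds_isHermitian v hu E, fun x hx => ?_⟩
    have := h (WithLp.toLp 2 x) (by simpa using hx)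
    rw [← dotProduct_reynolds_mulVec] at this
    simpa using this
  · intro h x hx
    rw [← dotProduct_reynolds_mulVec]
    have := h.2 (x := x.ofLp) (by simpa using hx)
    simpa using this

/-- The Reynolds matrix is the scalar $2E/n$ minus $v\otimes v-u$, so its spectrum is the reflected
and shifted spectrum. The supremum in `lambdaMax` is over a finite nonempty set (this needs $n>0$),
so it lies below $2E/n$ iff every eigenvalue does. -/
theorem genEnergy_lt_iff (hn : 0 < n) {v : Sp n} {u : Matrix (Fin n) (Fin n) ℝ} (hu : u.IsSymm)
    (E : ℝ) : genEnergy v u < E ↔ Admissible v u E := by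
  have hn' : (0 : ℝ) < n := by exact_mod_cast hn
  have : Nonempty (Fin n) := ⟨⟨0, hn⟩⟩
  have hR := reynolds_isHermitian v hu E
  have hA : (tensorSq v - u).IsHermitian := by
    ext i j
    have h := hu.apply i j
    simp [tensorSq, h, mul_comm]
  have hfin : (spectrum ℝ (tensorSq v - u)).Finite := by
    rw [hA.spectrum_real_eq_range_eigenvalues]
    exact Set.finite_range _
  have hne : (spectrum ℝ (tensorSq v - u)).Nonempty := by
    rw [hA.spectrum_real_eq_range_eigenvalues]
    exact Set.range_nonempty _
  have hRA : reynolds v u E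
      = algebraMap ℝ (Matrix (Fin n) (Fin n) ℝ) (2 * E / n) - (tensorSq v - u) := by
    rw [reynolds, Algebra.algebraMap_eq_smul_one]
    abel
  rw [admissible_iff_posDef hu, hR.posDef_iff_eigenvalues_pos]
  have h1 : genEnergy v u < E ↔ lambdaMax (tensorSq v - u) < 2 * E / n := by
    rw [genEnergy, lt_div_iff₀ hn']
    constructor <;> intro h <;> linarith
  rw [h1, lambdaMax, hfin.csSup_lt_iff hne]
  have h2 : (∀ i, 0 < hR.eigenvalues i) ↔ ∀ a ∈ spectrum ℝ (reynolds v u E), 0 < a := by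
    rw [hR.spectrum_real_eq_range_eigenvalues]
    simp
  rw [h2, hRA, ← spectrum.singleton_sub_eq]
  simp [Set.singleton_sub]

/-- The largest eigenvalue is at least the mean of all of them. This converts the missing energy,
which is a trace, into room in one direction. -/
theorem exists_eigenvector_trace_le (hn : 0 < n) {W : Matrix (Fin n) (Fin n) ℝ}
    (hW : W.IsHermitian) :
    ∃ (f : Sp n) (m : ℝ), ‖f‖ = 1 ∧ W *ᵥ f.ofLp = m • f.ofLp ∧ W.trace ≤ n * m := by
  have : Nonempty (Fin n) := ⟨⟨0, hn⟩⟩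
  obtain ⟨i, hi⟩ := Finite.exists_max hW.eigenvalues
  refine ⟨hW.eigenvectorBasis i, hW.eigenvalues i, hW.eigenvectorBasis.norm_eq_one i,
    hW.mulVec_eigenvectorBasis i, ?_⟩
  rw [hW.trace_eq_sum_eigenvalues]
  calc ∑ j, ((hW.eigenvalues j : ℝ) : ℝ) ≤ ∑ _j : Fin n, hW.eigenvalues i :=
        Finset.sum_le_sum fun j _ => hi j
    _ = n * hW.eigenvalues i := by simp

theorem trace_reynolds (hn : 0 < n) (v : Sp n) {u : Matrix (Fin n) (Fin n) ℝ} (hu : u.trace = 0)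
    (E : ℝ) : (reynolds v u E).trace = 2 * E - ‖v‖ ^ 2 := by
  have hn' : (n : ℝ) ≠ 0 := by exact_mod_cast hn.ne'
  have h1 : (tensorSq v).trace = ‖v‖ ^ 2 := by
    rw [EuclideanSpace.real_norm_sq_eq]
    simp [Matrix.trace, tensorSq, sq]
  rw [reynolds, Matrix.trace_sub, Matrix.trace_add, hu, h1, Matrix.trace_smul, Matrix.trace_one]
  simp
  field_simp

theorem exists_unit_orthogonal (hn : 2 ≤ n) (f : Sp n) :
    ∃ ξ : Sp n, ‖ξ‖ = 1 ∧ inner ℝ f ξ = 0 := by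
  have h1 : (ℝ ∙ f) ≠ ⊤ := by
    intro h
    have h2 := finrank_span_le_card (R := ℝ) ({f} : Set (Sp n))
    rw [h, finrank_top, finrank_euclideanSpace_fin] at h2
    simp at h2
    omega
  have h2 : (ℝ ∙ f)ᗮ ≠ ⊥ := by
    rwa [Ne, Submodule.orthogonal_eq_bot_iff]
  obtain ⟨y, hy, hy0⟩ := Submodule.exists_mem_ne_zero_of_ne_bot h2
  refine ⟨(‖y‖⁻¹ : ℝ) • y, ?_, ?_⟩
  · rw [norm_smul, norm_inv, norm_norm, inv_mul_cancel₀ (norm_ne_zero_iff.2 hy0)]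
  · rw [inner_smul_right, Submodule.mem_orthogonal_singleton_iff_inner_right.1 hy, mul_zero]

/-- The component of `v` orthogonal to the unit vector `f`, in polar form. -/
theorem exists_polar_orthogonal (hn : 2 ≤ n) {f : Sp n} (hf : ‖f‖ = 1) (v : Sp n) :
    ∃ (ξ : Sp n) (c : ℝ), ‖ξ‖ = 1 ∧ inner ℝ f ξ = 0 ∧ v = inner ℝ v f • f + c • ξ := by
  set g : Sp n := v - inner ℝ v f • f with hg
  by_cases h0 : g = 0
  · obtain ⟨ξ, h1, h2⟩ := exists_unit_orthogonal hn f
    refine ⟨ξ, 0, h1, h2, ?_⟩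
    rw [zero_smul, add_zero]
    exact sub_eq_zero.1 h0
  · have hg0 : ‖g‖ ≠ 0 := norm_ne_zero_iff.2 h0
    refine ⟨(‖g‖⁻¹ : ℝ) • g, ‖g‖, ?_, ?_, ?_⟩
    · rw [norm_smul, norm_inv, norm_norm, inv_mul_cancel₀ hg0]
    · rw [inner_smul_right, hg, inner_sub_right, inner_smul_right, real_inner_self_eq_norm_sq, hf,
        real_inner_comm]
      ring
    · rw [smul_smul, mul_inv_cancel₀ hg0, one_smul, hg]
      abel

/-- The symmetric product `f ⊗ ξ + ξ ⊗ f`. -/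
def symProd (f ξ : Sp n) : Matrix (Fin n) (Fin n) ℝ :=
  Matrix.of fun i j => f i * ξ j + ξ i * f j

theorem dotProduct_symProd_mulVec (f ξ x : Sp n) :
    x.ofLp ⬝ᵥ (symProd f ξ *ᵥ x.ofLp) = 2 * (inner ℝ f x * inner ℝ ξ x) := by
  have h : symProd f ξ = Matrix.vecMulVec f.ofLp ξ.ofLp + Matrix.vecMulVec ξ.ofLp f.ofLp := by
    ext i j
    simp [symProd, Matrix.vecMulVec_apply]
  rw [h, inner_eq_dotProduct, inner_eq_dotProduct]
  simp [Matrix.add_mulVec, Matrix.vecMulVec_mulVec, dotProduct_comm]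
  ring

/-- Through every admissible state passes a long segment of admissible states in the direction of
a shear flow. -/
theorem exists_shear_segment (hn : 2 ≤ n) {v : Sp n} {u : Matrix (Fin n) (Fin n) ℝ} {E : ℝ}
    (hu : u ∈ symTraceless n) (hadm : Admissible v u E) :
    0 < E - (1 / 2) * ‖v‖ ^ 2 ∧ ∃ (f ξ : Sp n) (c γ : ℝ), ‖f‖ = 1 ∧ ‖ξ‖ = 1 ∧ inner ℝ f ξ = 0 ∧
      (E - (1 / 2) * ‖v‖ ^ 2) ^ 2 ≤ 8 * (n : ℝ) ^ 2 * E * γ ^ 2 ∧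
      ∀ s ∈ Icc (-1 : ℝ) 1,
        Admissible (v + (s * γ) • f) (u + (s * (γ * c)) • symProd f ξ) E := by
  have hn0 : 0 < n := by omega
  have hn' : (0 : ℝ) < n := by exact_mod_cast hn0
  have hH := reynolds_isHermitian v hu.1 E
  obtain ⟨f, m, hf, hfm, htr⟩ := exists_eigenvector_trace_le hn0 hH
  rw [trace_reynolds hn0 v hu.2] at htr
  obtain ⟨ξ, c, hξ, hfξ, hv⟩ := exists_polar_orthogonal hn hf v
  have hf0 : f ≠ 0 := by
    rintro rfl
    simp at hf
  have hQf : reynoldsForm v u E f = m := by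
    rw [← dotProduct_reynolds_mulVec, hfm, dotProduct_smul, ← inner_eq_dotProduct,
      real_inner_self_eq_norm_sq, hf]
    simp
  have hm : 0 < m := hQf ▸ hadm f hf0
  have hpos := (admissible_iff_posDef hu.1 E).1 hadm
  have hD : 0 < 2 * E - ‖v‖ ^ 2 := by
    have : Nonempty (Fin n) := ⟨⟨0, hn0⟩⟩
    rw [← trace_reynolds hn0 v hu.2]
    exact hpos.trace_pos
  have hE : 0 < E := by nlinarith [sq_nonneg ‖v‖]
  refine ⟨by linarith, f, ξ, c, ?_⟩
  -- This is $R\ge m\,f\otimes f$: since $f$ is an eigenvector, the form at the component $y$ of $x$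
  -- orthogonal to $f$ is the form at $x$ minus $m(f\cdot x)^2$.
  have hform : ∀ x : Sp n, m * inner ℝ f x ^ 2 ≤ reynoldsForm v u E x := by
    intro x
    set y : Sp n := x - inner ℝ f x • f with hy
    have hy0 : 0 ≤ reynoldsForm v u E y := by
      by_cases h : y = 0
      · simp [h, reynoldsForm]
      · exact (hadm y h).le
    have hsymm : f.ofLp ⬝ᵥ (reynolds v u E *ᵥ x.ofLp) = m * inner ℝ f x := by
      rw [Matrix.dotProduct_mulVec, ← Matrix.mulVec_transpose]
      have : (reynolds v u E)ᵀ = reynolds v u E := by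
        have := hH.eq
        rwa [Matrix.conjTranspose_eq_transpose_of_trivial] at this
      rw [this, hfm, smul_dotProduct, inner_eq_dotProduct, smul_eq_mul]
    have hff : f.ofLp ⬝ᵥ f.ofLp = 1 := by
      rw [← inner_eq_dotProduct, real_inner_self_eq_norm_sq, hf]; norm_num
    have hxf : x.ofLp ⬝ᵥ f.ofLp = inner ℝ f x := by
      rw [← inner_eq_dotProduct, real_inner_comm]
    have : reynoldsForm v u E y = reynoldsForm v u E x - m * inner ℝ f x ^ 2 := by
      rw [← dotProduct_reynolds_mulVec, ← dotProduct_reynolds_mulVec, hy]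
      simp only [WithLp.ofLp_sub, WithLp.ofLp_smul, Matrix.mulVec_sub, Matrix.mulVec_smul,
        dotProduct_sub, sub_dotProduct, smul_dotProduct, dotProduct_smul, smul_eq_mul, hfm, hsymm,
        hff, hxf]
      ring
    linarith
  -- The speed $\sqrt{2E}$ bounds both $|v|$ and $\sqrt m$, because
  -- $m\le\operatorname{tr}R=2E-|v|^2$.
  set r : ℝ := Real.sqrt (2 * E) with hr
  have hr0 : 0 < r := Real.sqrt_pos.2 (by linarith)
  have hr2 : r ^ 2 = 2 * E := Real.sq_sqrt (by linarith)
  have hvr : ‖v‖ ≤ r := by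
    apply le_of_lt
    apply lt_of_pow_lt_pow_left₀ 2 hr0.le
    linarith
  have hmr : m ≤ r ^ 2 := by
    have h1 : m ≤ (reynolds v u E).trace := by
      obtain ⟨i, hi⟩ : ∃ i, hH.eigenvalues i = m := by
        have : m ∈ spectrum ℝ (reynolds v u E) := by
          rw [← Matrix.spectrum_toLin', ← Module.End.hasEigenvalue_iff_mem_spectrum]
          refine Module.End.hasEigenvalue_of_hasEigenvector (x := f.ofLp) ⟨?_, ?_⟩
          · rw [Module.End.mem_eigenspace_iff, Matrix.toLin'_apply, hfm]
          · simpa using hf0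
        rw [hH.spectrum_real_eq_range_eigenvalues] at this
        exact this
      rw [hH.trace_eq_sum_eigenvalues, ← hi]
      exact Finset.single_le_sum (f := fun j => hH.eigenvalues j)
        (fun j _ => (hpos.eigenvalues_pos j).le) (Finset.mem_univ i)
    rw [trace_reynolds hn0 v hu.2] at h1
    nlinarith [sq_nonneg ‖v‖]
  -- With $\gamma=m/(4r)$ the loss $2s\gamma(v\cdot f)+s^2\gamma^2$ is at most $m/2+m/16<m$, and
  -- $\gamma^2=m^2/(32E)$ together with $2E-|v|^2\le nm$ gives the length bound.
  refine ⟨m / (4 * r), hf, hξ, hfξ, ?_, ?_⟩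
  · have h2 : 8 * (n : ℝ) ^ 2 * E * (m / (4 * r)) ^ 2 = (n * m) ^ 2 / 4 := by
      rw [div_pow, mul_pow 4 r, hr2]
      field_simp
      ring
    rw [h2]
    nlinarith
  · rintro s ⟨hs1, hs2⟩ x hx
    set γ : ℝ := m / (4 * r) with hγ
    have hγ0 : 0 < γ := by positivity
    have hγr : γ * r = m / 4 := by
      rw [hγ]; field_simp
    have hγ2 : γ ^ 2 ≤ m / 16 := by
      rw [hγ, div_pow, div_le_div_iff₀ (by positivity) (by norm_num)]
      nlinarith
    have hvf : |inner ℝ v f| ≤ r := by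
      refine (abs_real_inner_le_norm v f).trans ?_
      rw [hf, mul_one]; exact hvr
    have hvx : inner ℝ v x = inner ℝ v f * inner ℝ f x + c * inner ℝ ξ x := by
      conv_lhs => rw [hv]
      rw [inner_add_left, real_inner_smul_left, real_inner_smul_left]
    -- The component $c\,\xi$ of $v$ produces the cross term $s\gamma c(f\otimes\xi+\xi\otimes f)$
    -- in $v\otimes v$, and the change of $u$ cancels it exactly; only a multiple of $f\otimes f$
    -- survives.
    have hval : reynoldsForm (v + (s * γ) • f) (u + (s * (γ * c)) • symProd f ξ) E x
        = reynoldsForm v u E x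
          - (2 * s * γ * inner ℝ v f + s ^ 2 * γ ^ 2) * inner ℝ f x ^ 2 := by
      simp only [reynoldsForm, Matrix.add_mulVec, Matrix.smul_mulVec, dotProduct_add,
        dotProduct_smul, smul_eq_mul, dotProduct_symProd_mulVec, inner_add_left,
        real_inner_smul_left]
      rw [hvx]
      ring
    have hκ : 2 * s * γ * inner ℝ v f + s ^ 2 * γ ^ 2 < m := by
      have h1 : s * inner ℝ v f ≤ r := by
        refine (le_abs_self _).trans ?_
        rw [abs_mul]
        have : |s| ≤ 1 := abs_le.2 ⟨hs1, hs2⟩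
        nlinarith [abs_nonneg s, abs_nonneg (inner ℝ v f)]
      have h2 : s ^ 2 ≤ 1 := by nlinarith
      have h3 : 2 * (γ * (s * inner ℝ v f)) ≤ 2 * (γ * r) := by gcongr
      have h4 : s ^ 2 * γ ^ 2 ≤ 1 * γ ^ 2 := by gcongr
      have h5 : 2 * s * γ * inner ℝ v f = 2 * (γ * (s * inner ℝ v f)) := by ring
      rw [h5]
      linarith
    rw [hval]
    have h1 := hform x
    by_cases hfx : inner ℝ f x = 0
    · rw [hfx]
      have := hadm x hx
      nlinarith
    · have : 0 < inner ℝ f x ^ 2 := by positivity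
      nlinarith

end ShearSegments

/-! ### Directional derivatives and asymptotics of oscillating potentials. -/

section DirectionalDerivative

variable {X : Type*} [NormedAddCommGroup X] [NormedSpace ℝ X]

/-- The derivative of `F` in the direction `a`. -/
noncomputable def dirD (a : X) (F : X → ℝ) : X → ℝ := fun p => fderiv ℝ F p a

variable {F G : X → ℝ}

theorem contDiff_dirD (hF : ContDiff ℝ ∞ F) (a : X) : ContDiff ℝ ∞ (dirD a F) :=
  (hF.fderiv_right (m := ∞) (by simp)).clm_apply contDiff_const

theorem differentiable_of_smooth (hF : ContDiff ℝ ∞ F) : Differentiable ℝ F :=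
  hF.differentiable (by simp)

theorem dirD_add (hF : ContDiff ℝ ∞ F) (hG : ContDiff ℝ ∞ G) (a : X) :
    dirD a (fun p => F p + G p) = fun p => dirD a F p + dirD a G p := by
  ext p
  simp [dirD, fderiv_fun_add (differentiable_of_smooth hF p) (differentiable_of_smooth hG p)]

theorem dirD_sub (hF : ContDiff ℝ ∞ F) (hG : ContDiff ℝ ∞ G) (a : X) :
    dirD a (fun p => F p - G p) = fun p => dirD a F p - dirD a G p := by
  ext p
  simp [dirD, fderiv_fun_sub (differentiable_of_smooth hF p) (differentiable_of_smooth hG p)]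

theorem dirD_const_mul (hF : ContDiff ℝ ∞ F) (c : ℝ) (a : X) :
    dirD a (fun p => c * F p) = fun p => c * dirD a F p := by
  ext p
  simp [dirD, fderiv_const_mul (differentiable_of_smooth hF p)]

theorem dirD_mul (hF : ContDiff ℝ ∞ F) (hG : ContDiff ℝ ∞ G) (a : X) :
    dirD a (fun p => F p * G p) = fun p => dirD a F p * G p + F p * dirD a G p := by
  ext p
  simp [dirD, fderiv_fun_mul (differentiable_of_smooth hF p) (differentiable_of_smooth hG p)]
  ring

theorem dirD_comm (hF : ContDiff ℝ ∞ F) (a b : X) : dirD a (dirD b F) = dirD b (dirD a F) := by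
  have hd : Differentiable ℝ (fderiv ℝ F) :=
    (hF.fderiv_right (m := ∞) (by simp)).differentiable (by simp)
  have key : ∀ (a b : X) (p : X), dirD a (dirD b F) p = fderiv ℝ (fderiv ℝ F) p a b := by
    intro a b p
    have : dirD b F = fun q => fderiv ℝ F q b := rfl
    rw [this, dirD, fderiv_clm_apply (hd p) (differentiableAt_const b)]
    simp
  ext p
  rw [key, key]
  exact (hF.contDiffAt.isSymmSndFDerivAt (by simpa using ENat.LEInfty.out)) a b

theorem tsupport_dirD_subset (a : X) (F : X → ℝ) : tsupport (dirD a F) ⊆ tsupport F :=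
  tsupport_fderiv_apply_subset ℝ a

theorem dirD_eq_zero {p : X} (hp : p ∉ tsupport F) (a : X) : dirD a F p = 0 := by
  simp [dirD, fderiv_of_notMem_tsupport ℝ hp]

theorem dirD_phase {S S' : ℝ → ℝ} (hS : ∀ s, HasDerivAt S (S' s) s) (θ : X →L[ℝ] ℝ) (K C : ℝ)
    (a : X) : dirD a (fun p => C * S (K * θ p)) = fun p => θ a * (K * C * S' (K * θ p)) := by
  ext p
  have h1 : HasFDerivAt (fun q => K * θ q) (K • (θ : X →L[ℝ] ℝ)) p :=
    (θ.hasFDerivAt).const_mul K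
  have h2 := ((hS (K * θ p)).comp_hasFDerivAt p h1).const_mul C
  have h3 : HasFDerivAt (fun q => C * S (K * θ q)) (C • S' (K * θ p) • K • θ) p := h2
  rw [dirD, h3.fderiv]
  simp
  ring

/-- The potential of a localized plane wave with phase `θ`, frequency `K` and amplitude `φ`. -/
noncomputable def wavePot (φ : X → ℝ) (θ : X →L[ℝ] ℝ) (K : ℝ) : X → ℝ :=
  fun p => φ p * (-(K⁻¹) ^ 3 * Real.sin (K * θ p))

theorem contDiff_phase (S : ℝ → ℝ) (hS : ContDiff ℝ ∞ S) (θ : X →L[ℝ] ℝ) (K C : ℝ) :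
    ContDiff ℝ ∞ (fun p => C * S (K * θ p)) :=
  contDiff_const.mul (hS.comp (contDiff_const.mul θ.contDiff))

theorem contDiff_wavePot {φ : X → ℝ} (hφ : ContDiff ℝ ∞ φ) (θ : X →L[ℝ] ℝ) (K : ℝ) :
    ContDiff ℝ ∞ (wavePot φ θ K) :=
  hφ.mul (contDiff_phase Real.sin Real.contDiff_sin θ K _)

theorem tsupport_wavePot_subset (φ : X → ℝ) (θ : X →L[ℝ] ℝ) (K : ℝ) :
    tsupport (wavePot φ θ K) ⊆ tsupport φ :=
  tsupport_mul_subset_left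

theorem exists_bound_of_compactSupport {φ : X → ℝ} (hφ : ContDiff ℝ ∞ φ)
    (hc : HasCompactSupport φ) : ∃ C, 0 ≤ C ∧ ∀ p, |φ p| ≤ C := by
  obtain ⟨C, hC⟩ := hφ.continuous.bounded_above_of_compact_support hc
  exact ⟨C, (norm_nonneg _).trans (hC 0), hC⟩

theorem hasCompactSupport_dirD {φ : X → ℝ} (hc : HasCompactSupport φ) (a : X) :
    HasCompactSupport (dirD a φ) :=
  hc.of_isClosed_subset (isClosed_tsupport _) (tsupport_dirD_subset a φ)

/-- Leading term of the third derivatives of the potential of a localized plane wave. -/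
theorem dirD_wavePot_asymptotics {φ : X → ℝ} (hφ : ContDiff ℝ ∞ φ) (hc : HasCompactSupport φ)
    (θ : X →L[ℝ] ℝ) (a b c : X) :
    ∃ C, 0 ≤ C ∧ ∀ K : ℝ, 1 ≤ K → ∀ p,
      |dirD a (dirD b (dirD c (wavePot φ θ K))) p
        - θ a * θ b * θ c * (φ p * Real.cos (K * θ p))| ≤ C / K := by
  have sa := contDiff_dirD hφ a
  have sb := contDiff_dirD hφ b
  have sc := contDiff_dirD hφ c
  have sab := contDiff_dirD sb a
  have sac := contDiff_dirD sc a
  have sbc := contDiff_dirD sc b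
  have sabc := contDiff_dirD sbc a
  have ca := hasCompactSupport_dirD hc a
  have cb := hasCompactSupport_dirD hc b
  have cc := hasCompactSupport_dirD hc c
  obtain ⟨Ca, ha0, ha⟩ := exists_bound_of_compactSupport sa ca
  obtain ⟨Cb, hb0, hb⟩ := exists_bound_of_compactSupport sb cb
  obtain ⟨Cc, hc0, hc'⟩ := exists_bound_of_compactSupport sc cc
  obtain ⟨Cab, hab0, hab⟩ := exists_bound_of_compactSupport sab (hasCompactSupport_dirD cb a)
  obtain ⟨Cac, hac0, hac⟩ := exists_bound_of_compactSupport sac (hasCompactSupport_dirD cc a)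
  obtain ⟨Cbc, hbc0, hbc⟩ := exists_bound_of_compactSupport sbc (hasCompactSupport_dirD cc b)
  obtain ⟨Cabc, habc0, habc⟩ := exists_bound_of_compactSupport sabc
    (hasCompactSupport_dirD (hasCompactSupport_dirD cc b) a)
  refine ⟨Cabc + |θ a| * Cbc + |θ b| * Cac + |θ b * θ a| * Cc + |θ c| * Cab + |θ c * θ a| * Cb
    + |θ c * θ b| * Ca, by positivity, fun K hK p => ?_⟩
  have hK0 : K ≠ 0 := by positivity
  -- A chain of successive antiderivatives of the cosine: differentiating `G0`, `G1`, `G2` along $a$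
  -- gives $\theta(a)$ times the next one.
  set G0 : X → ℝ := fun p => -(K⁻¹) ^ 3 * Real.sin (K * θ p) with hG0
  set G1 : X → ℝ := fun p => -(K⁻¹) ^ 2 * Real.cos (K * θ p) with hG1
  set G2 : X → ℝ := fun p => K⁻¹ * Real.sin (K * θ p) with hG2
  set G3 : X → ℝ := fun p => 1 * Real.cos (K * θ p) with hG3
  have s0 : ContDiff ℝ ∞ G0 := contDiff_phase _ Real.contDiff_sin θ K _
  have s1 : ContDiff ℝ ∞ G1 := contDiff_phase _ Real.contDiff_cos θ K _
  have s2 : ContDiff ℝ ∞ G2 := contDiff_phase _ Real.contDiff_sin θ K _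
  have d0 : ∀ a, dirD a G0 = fun p => θ a * G1 p := by
    intro a
    rw [hG0, dirD_phase Real.hasDerivAt_sin]
    ext q
    simp only [hG1]
    field_simp
  have d1 : ∀ a, dirD a G1 = fun p => θ a * G2 p := by
    intro a
    rw [hG1, dirD_phase Real.hasDerivAt_cos]
    ext q
    simp only [hG2]
    field_simp
  have d2 : ∀ a, dirD a G2 = fun p => θ a * G3 p := by
    intro a
    rw [hG2, dirD_phase Real.hasDerivAt_sin]
    ext q
    simp only [hG3]
    field_simp
  have e1 : dirD c (wavePot φ θ K) = fun p => dirD c φ p * G0 p + θ c * (φ p * G1 p) := by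
    have : wavePot φ θ K = fun p => φ p * G0 p := rfl
    rw [this, dirD_mul hφ s0, d0]
    ext q; ring
  have e2 : dirD b (dirD c (wavePot φ θ K)) = fun p =>
      (dirD b (dirD c φ) p * G0 p + θ b * (dirD c φ p * G1 p))
        + (θ c * (dirD b φ p * G1 p) + θ c * θ b * (φ p * G2 p)) := by
    rw [e1, dirD_add (sc.mul s0) (contDiff_const.mul (hφ.mul s1)), dirD_mul sc s0,
      dirD_const_mul (hφ.mul s1), dirD_mul hφ s1, d0, d1]
    ext q; ring
  have e3 : dirD a (dirD b (dirD c (wavePot φ θ K))) p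
      = dirD a (dirD b (dirD c φ)) p * G0 p + θ a * dirD b (dirD c φ) p * G1 p
        + θ b * dirD a (dirD c φ) p * G1 p + θ b * θ a * dirD c φ p * G2 p
        + θ c * dirD a (dirD b φ) p * G1 p + θ c * θ a * dirD b φ p * G2 p
        + θ c * θ b * dirD a φ p * G2 p + θ a * θ b * θ c * (φ p * G3 p) := by
    rw [e2, dirD_add ((sbc.mul s0).add (contDiff_const.mul (sc.mul s1)))
        ((contDiff_const.mul (sb.mul s1)).add (contDiff_const.mul (hφ.mul s2))),
      dirD_add (sbc.mul s0) (contDiff_const.mul (sc.mul s1)),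
      dirD_add (contDiff_const.mul (sb.mul s1)) (contDiff_const.mul (hφ.mul s2)),
      dirD_mul sbc s0, dirD_const_mul (sc.mul s1), dirD_mul sc s1, dirD_const_mul (sb.mul s1),
      dirD_mul sb s1, dirD_const_mul (hφ.mul s2), dirD_mul hφ s2, d0, d1, d2]
    ring
  have hKi : K⁻¹ ≤ 1 := inv_le_one_of_one_le₀ hK
  have hKi0 : 0 ≤ K⁻¹ := by positivity
  have b0 : |G0 p| ≤ K⁻¹ := by
    rw [hG0]
    simp only [neg_mul, abs_neg, abs_mul, abs_pow, abs_of_nonneg hKi0]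
    calc K⁻¹ ^ 3 * |Real.sin (K * θ p)| ≤ K⁻¹ ^ 3 * 1 := by gcongr; exact Real.abs_sin_le_one _
      _ ≤ K⁻¹ := by rw [mul_one]; exact pow_le_of_le_one hKi0 hKi (by norm_num)
  have b1 : |G1 p| ≤ K⁻¹ := by
    rw [hG1]
    simp only [neg_mul, abs_neg, abs_mul, abs_pow, abs_of_nonneg hKi0]
    calc K⁻¹ ^ 2 * |Real.cos (K * θ p)| ≤ K⁻¹ ^ 2 * 1 := by gcongr; exact Real.abs_cos_le_one _
      _ ≤ K⁻¹ := by rw [mul_one]; exact pow_le_of_le_one hKi0 hKi (by norm_num)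
  have b2 : |G2 p| ≤ K⁻¹ := by
    rw [hG2]
    simp only [abs_mul, abs_of_nonneg hKi0]
    calc K⁻¹ * |Real.sin (K * θ p)| ≤ K⁻¹ * 1 := by gcongr; exact Real.abs_sin_le_one _
      _ = K⁻¹ := mul_one _
  -- The term with no derivative on $\varphi$ is the leading one. In every other term at least one
  -- derivative falls on $\varphi$, so a factor $K^{-1}$ or smaller remains.
  have e4 : dirD a (dirD b (dirD c (wavePot φ θ K))) p
        - θ a * θ b * θ c * (φ p * Real.cos (K * θ p))
      = dirD a (dirD b (dirD c φ)) p * G0 p + θ a * dirD b (dirD c φ) p * G1 p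
        + θ b * dirD a (dirD c φ) p * G1 p + θ b * θ a * dirD c φ p * G2 p
        + θ c * dirD a (dirD b φ) p * G1 p + θ c * θ a * dirD b φ p * G2 p
        + θ c * θ b * dirD a φ p * G2 p := by
    rw [e3]
    simp only [hG3]
    ring
  rw [e4, div_eq_mul_inv]
  simp only [add_mul]
  refine (abs_add_le _ _).trans (add_le_add ((abs_add_le _ _).trans (add_le_add
    ((abs_add_le _ _).trans (add_le_add ((abs_add_le _ _).trans (add_le_add
    ((abs_add_le _ _).trans (add_le_add ((abs_add_le _ _).trans (add_le_add ?_ ?_)) ?_)) ?_)) ?_))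
    ?_)) ?_)
  all_goals
    rw [abs_mul]
    try rw [abs_mul (_ * _) _]
    try rw [abs_mul (θ _) _]
  · exact mul_le_mul (habc p) b0 (abs_nonneg _) habc0
  · exact mul_le_mul (mul_le_mul_of_nonneg_left (hbc p) (abs_nonneg _)) b1 (abs_nonneg _)
      (by positivity)
  · exact mul_le_mul (mul_le_mul_of_nonneg_left (hac p) (abs_nonneg _)) b1 (abs_nonneg _)
      (by positivity)
  · rw [← abs_mul]
    exact mul_le_mul (mul_le_mul_of_nonneg_left (hc' p) (abs_nonneg _)) b2 (abs_nonneg _)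
      (by positivity)
  · exact mul_le_mul (mul_le_mul_of_nonneg_left (hab p) (abs_nonneg _)) b1 (abs_nonneg _)
      (by positivity)
  · rw [← abs_mul]
    exact mul_le_mul (mul_le_mul_of_nonneg_left (hb p) (abs_nonneg _)) b2 (abs_nonneg _)
      (by positivity)
  · rw [← abs_mul]
    exact mul_le_mul (mul_le_mul_of_nonneg_left (ha p) (abs_nonneg _)) b2 (abs_nonneg _)
      (by positivity)

end DirectionalDerivative

/-! ### Compactly supported solutions of the linear system, built from a scalar potential. -/

section Perturbations

variable {n : ℕ}

theorem pderiv_slice {F : ℝ × Sp n → ℝ} (hF : Differentiable ℝ F) (j : Fin n) (t : ℝ) (x : Sp n) :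
    pderiv j (fun y => F (t, y)) x = dirD (0, EuclideanSpace.single j 1) F (t, x) := by
  have h : HasFDerivAt (fun y => F (t, y))
      ((fderiv ℝ F (t, x)).comp (ContinuousLinearMap.inr ℝ ℝ (Sp n))) x :=
    (hF (t, x)).hasFDerivAt.comp x (hasFDerivAt_prodMk_right t x)
  rw [pderiv, h.fderiv]
  simp [dirD]

theorem deriv_slice {F : ℝ × Sp n → ℝ} (hF : Differentiable ℝ F) (t : ℝ) (x : Sp n) :
    deriv (fun s => F (s, x)) t = dirD (1, 0) F (t, x) := by
  have h1 : HasDerivAt (fun s : ℝ => (s, x)) (1, 0) t :=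
    (hasDerivAt_id t).prodMk (hasDerivAt_const t x)
  have h := (hF (t, x)).hasFDerivAt.comp_hasDerivAt t h1
  exact h.deriv

theorem sum_mul_dirD (F : ℝ × Sp n → ℝ) (f : Sp n) (p : ℝ × Sp n) :
    ∑ j, f j * dirD (0, EuclideanSpace.single j 1) F p = dirD (0, f) F p := by
  have h : (0, f) = ∑ j, f j • ((0, EuclideanSpace.single j 1) : ℝ × Sp n) := by
    have h1 := (EuclideanSpace.basisFun (Fin n) ℝ).sum_repr f
    ext1
    · simp [Prod.fst_sum]
    · rw [Prod.snd_sum]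
      simpa using h1.symm
  rw [dirD, h, map_sum]
  simp only [map_smul, smul_eq_mul, dirD]

/-- Compactly supported smooth solutions of `∂ₜ w + div U = 0`, `div w = 0`. -/
structure IsPerturbation (K : Set (ℝ × Sp n)) (w : VField n) (U : MField n) : Prop where
  smooth_v : ContDiff ℝ ∞ (fun p : ℝ × Sp n => w p.1 p.2)
  smooth_u : ∀ i j, ContDiff ℝ ∞ (fun p : ℝ × Sp n => U p.1 p.2 i j)
  mem : ∀ t x, U t x ∈ symTraceless n
  div_free : ∀ t x, ∑ i, pderiv i (fun y => w t y i) x = 0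
  momentum : ∀ t x i, deriv (fun s => w s x i) t + ∑ j, pderiv j (fun y => U t y i j) x = 0
  eq_zero : ∀ t x, (t, x) ∉ K → w t x = 0 ∧ U t x = 0

theorem pderiv_add {F G : Sp n → ℝ} {x : Sp n} (hF : DifferentiableAt ℝ F x)
    (hG : DifferentiableAt ℝ G x) (i : Fin n) :
    pderiv i (fun y => F y + G y) x = pderiv i F x + pderiv i G x := by
  simp [pderiv, fderiv_fun_add hF hG]

theorem differentiable_coord {w : VField n} (hw : ContDiff ℝ ∞ (fun p : ℝ × Sp n => w p.1 p.2))
    (i : Fin n) : Differentiable ℝ (fun p : ℝ × Sp n => w p.1 p.2 i) :=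
  ((contDiff_euclidean.1 hw) i).differentiable (by simp)

theorem differentiable_slice_right {F : ℝ × Sp n → ℝ} (hF : Differentiable ℝ F) (t : ℝ) :
    Differentiable ℝ (fun y => F (t, y)) :=
  hF.comp ((differentiable_const t).prodMk differentiable_id)

theorem differentiable_slice_left {F : ℝ × Sp n → ℝ} (hF : Differentiable ℝ F) (x : Sp n) :
    Differentiable ℝ (fun s => F (s, x)) :=
  hF.comp (differentiable_id.prodMk (differentiable_const x))

theorem symTraceless_add {A B : Matrix (Fin n) (Fin n) ℝ} (hA : A ∈ symTraceless n)
    (hB : B ∈ symTraceless n) : A + B ∈ symTraceless n :=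
  ⟨hA.1.add hB.1, by rw [Matrix.trace_add, hA.2, hB.2, add_zero]⟩

theorem IsPerturbation.zero (K : Set (ℝ × Sp n)) : IsPerturbation K (0 : VField n) 0 where
  smooth_v := contDiff_const
  smooth_u _ _ := contDiff_const
  mem _ _ := ⟨Matrix.isSymm_zero, Matrix.trace_zero _ _⟩
  div_free t x := by simp [pderiv]
  momentum t x i := by simp [pderiv]
  eq_zero _ _ _ := ⟨rfl, rfl⟩

theorem IsPerturbation.add {K : Set (ℝ × Sp n)} {w w' : VField n} {U U' : MField n}
    (h : IsPerturbation K w U) (h' : IsPerturbation K w' U') :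
    IsPerturbation K (w + w') (U + U') where
  smooth_v := h.smooth_v.add h'.smooth_v
  smooth_u i j := (h.smooth_u i j).add (h'.smooth_u i j)
  mem t x := symTraceless_add (h.mem t x) (h'.mem t x)
  div_free t x := by
    have key : ∀ i, pderiv i (fun y => (w + w') t y i) x
        = pderiv i (fun y => w t y i) x + pderiv i (fun y => w' t y i) x := fun i =>
      pderiv_add (differentiable_slice_right (differentiable_coord h.smooth_v i) t x)
        (differentiable_slice_right (differentiable_coord h'.smooth_v i) t x) i
    simp only [key, Finset.sum_add_distrib, h.div_free, h'.div_free, add_zero]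
  momentum t x i := by
    have key : ∀ j, pderiv j (fun y => (U + U') t y i j) x
        = pderiv j (fun y => U t y i j) x + pderiv j (fun y => U' t y i j) x := fun j =>
      pderiv_add (differentiable_slice_right (differentiable_of_smooth (h.smooth_u i j)) t x)
        (differentiable_slice_right (differentiable_of_smooth (h'.smooth_u i j)) t x) j
    have key' : deriv (fun s => (w + w') s x i) t
        = deriv (fun s => w s x i) t + deriv (fun s => w' s x i) t :=
      deriv_add (differentiable_slice_left (differentiable_coord h.smooth_v i) x t)
        (differentiable_slice_left (differentiable_coord h'.smooth_v i) x t)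
    simp only [key, key', Finset.sum_add_distrib]
    linarith [h.momentum t x i, h'.momentum t x i]
  eq_zero t x hK := by
    obtain ⟨h1, h2⟩ := h.eq_zero t x hK
    obtain ⟨h3, h4⟩ := h'.eq_zero t x hK
    exact ⟨by simp [h1, h3], by simp [h2, h4]⟩

theorem IsPerturbation.sum {ι : Type*} (s : Finset ι) {K : Set (ℝ × Sp n)} {w : ι → VField n}
    {U : ι → MField n} (h : ∀ i ∈ s, IsPerturbation K (w i) (U i)) :
    IsPerturbation K (∑ i ∈ s, w i) (∑ i ∈ s, U i) := by
  classical
  induction s using Finset.induction_on with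
  | empty => simpa using IsPerturbation.zero K
  | insert a s ha ih =>
    rw [Finset.sum_insert ha, Finset.sum_insert ha]
    exact (h a (Finset.mem_insert_self a s)).add
      (ih fun i hi => h i (Finset.mem_insert_of_mem hi))

theorem IsPerturbation.mono {K K' : Set (ℝ × Sp n)} {w : VField n} {U : MField n}
    (h : IsPerturbation K w U) (hK : K ⊆ K') : IsPerturbation K' w U :=
  { h with eq_zero := fun t x hx => h.eq_zero t x fun h' => hx (hK h') }

/-- The planar Laplacian of `Ψ` in the plane spanned by `f` and `ξ`. -/
noncomputable def planeLaplacian (f ξ : Sp n) (Ψ : ℝ × Sp n → ℝ) : ℝ × Sp n → ℝ := fun p =>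
  dirD (0, ξ) (dirD (0, ξ) Ψ) p + dirD (0, f) (dirD (0, f) Ψ) p

/-- The velocity field with potential `Ψ`. -/
noncomputable def potV (f ξ : Sp n) (Ψ : ℝ × Sp n → ℝ) : VField n := fun t x =>
  dirD (0, ξ) (planeLaplacian f ξ Ψ) (t, x) • f - dirD (0, f) (planeLaplacian f ξ Ψ) (t, x) • ξ

/-- The diagonal coefficient of the stress with potential `Ψ`. -/
noncomputable def potDiag (f ξ : Sp n) (Ψ : ℝ × Sp n → ℝ) : ℝ × Sp n → ℝ := fun p =>
  -2 * dirD (0, f) (dirD (0, ξ) (dirD (1, 0) Ψ)) p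

/-- The off-diagonal coefficient of the stress with potential `Ψ`. -/
noncomputable def potOff (f ξ : Sp n) (Ψ : ℝ × Sp n → ℝ) : ℝ × Sp n → ℝ := fun p =>
  dirD (0, f) (dirD (0, f) (dirD (1, 0) Ψ)) p - dirD (0, ξ) (dirD (0, ξ) (dirD (1, 0) Ψ)) p

/-- The stress with potential `Ψ`. -/
noncomputable def potU (f ξ : Sp n) (Ψ : ℝ × Sp n → ℝ) : MField n := fun t x =>
  Matrix.of fun i j => potDiag f ξ Ψ (t, x) * (f i * f j - ξ i * ξ j)
    + potOff f ξ Ψ (t, x) * (f i * ξ j + ξ i * f j)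

/-- In the $(f,\xi)$-plane the velocity is the rotated gradient of the stream function $\Delta\Psi$
($\Delta$ the planar Laplacian), hence divergence free. The stress is a symmetric trace-free planar
tensor whose two coefficients are chosen so that its divergence is $-\partial_t$ of that velocity.
No pressure is needed, and multiplying $\Psi$ by a cutoff keeps the equations exact. -/
theorem isPerturbation_pot {f ξ : Sp n} (hf : ‖f‖ = 1) (hξ : ‖ξ‖ = 1) (hfξ : inner ℝ f ξ = 0)
    {Ψ : ℝ × Sp n → ℝ} (hΨ : ContDiff ℝ ∞ Ψ) :
    IsPerturbation (tsupport Ψ) (potV f ξ Ψ) (potU f ξ Ψ) := by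
  have sL : ContDiff ℝ ∞ (planeLaplacian f ξ Ψ) :=
    (contDiff_dirD (contDiff_dirD hΨ _) _).add (contDiff_dirD (contDiff_dirD hΨ _) _)
  have sa : ContDiff ℝ ∞ (potDiag f ξ Ψ) :=
    contDiff_const.mul (contDiff_dirD (contDiff_dirD (contDiff_dirD hΨ _) _) _)
  have sb : ContDiff ℝ ∞ (potOff f ξ Ψ) :=
    (contDiff_dirD (contDiff_dirD (contDiff_dirD hΨ _) _) _).sub
      (contDiff_dirD (contDiff_dirD (contDiff_dirD hΨ _) _) _)
  have sP := contDiff_dirD sL (0, ξ)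
  have sQ := contDiff_dirD sL (0, f)
  have hV : ∀ i, (fun p : ℝ × Sp n => potV f ξ Ψ p.1 p.2 i) = fun p =>
      f i * dirD (0, ξ) (planeLaplacian f ξ Ψ) p - ξ i * dirD (0, f) (planeLaplacian f ξ Ψ) p := by
    intro i
    ext p
    simp [potV, mul_comm]
  have hU : ∀ i j, (fun p : ℝ × Sp n => potU f ξ Ψ p.1 p.2 i j) = fun p =>
      (f i * f j - ξ i * ξ j) * potDiag f ξ Ψ p + (f i * ξ j + ξ i * f j) * potOff f ξ Ψ p := by
    intro i j
    ext p
    simp [potU, mul_comm]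
  have cV : ∀ i, ContDiff ℝ ∞ (fun p : ℝ × Sp n => potV f ξ Ψ p.1 p.2 i) := by
    intro i
    rw [hV]
    exact (contDiff_const.mul sP).sub (contDiff_const.mul sQ)
  have cU : ∀ i j, ContDiff ℝ ∞ (fun p : ℝ × Sp n => potU f ξ Ψ p.1 p.2 i j) := by
    intro i j
    rw [hU]
    exact (contDiff_const.mul sa).add (contDiff_const.mul sb)
  have dV : ∀ a i, dirD a (fun p : ℝ × Sp n => potV f ξ Ψ p.1 p.2 i) = fun p =>
      f i * dirD a (dirD (0, ξ) (planeLaplacian f ξ Ψ)) p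
        - ξ i * dirD a (dirD (0, f) (planeLaplacian f ξ Ψ)) p := by
    intro a i
    rw [hV, dirD_sub (contDiff_const.mul sP) (contDiff_const.mul sQ), dirD_const_mul sP,
      dirD_const_mul sQ]
  have dU : ∀ a i j, dirD a (fun p : ℝ × Sp n => potU f ξ Ψ p.1 p.2 i j) = fun p =>
      (f i * f j - ξ i * ξ j) * dirD a (potDiag f ξ Ψ) p
        + (f i * ξ j + ξ i * f j) * dirD a (potOff f ξ Ψ) p := by
    intro a i j
    rw [hU, dirD_add (contDiff_const.mul sa) (contDiff_const.mul sb), dirD_const_mul sa,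
      dirD_const_mul sb]
  refine ⟨contDiff_euclidean.2 cV, cU, fun t x => ⟨?_, ?_⟩, fun t x => ?_, fun t x i => ?_,
    fun t x hp => ?_⟩
  · ext i j
    simp only [Matrix.transpose_apply, potU, Matrix.of_apply]
    ring
  · have h1 : ∑ i, f i * f i = 1 := by
      have := EuclideanSpace.real_norm_sq_eq f
      rw [hf] at this
      simpa [sq] using this.symm
    have h2 : ∑ i, ξ i * ξ i = 1 := by
      have := EuclideanSpace.real_norm_sq_eq ξ
      rw [hξ] at this
      simpa [sq] using this.symm
    have h3 : ∑ i, f i * ξ i = 0 := by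
      rw [inner_eq_dotProduct] at hfξ
      exact hfξ
    have h4 : ∑ i, ξ i * f i = 0 := by
      rw [← h3]
      exact Finset.sum_congr rfl fun i _ => mul_comm _ _
    simp only [Matrix.trace, Matrix.diag_apply, potU, Matrix.of_apply, Finset.sum_add_distrib,
      ← Finset.mul_sum, Finset.sum_sub_distrib, h1, h2, h3, h4]
    ring
  · have key : ∀ i, pderiv i (fun y => potV f ξ Ψ t y i) x
        = f i * dirD (0, EuclideanSpace.single i 1) (dirD (0, ξ) (planeLaplacian f ξ Ψ)) (t, x)
        - ξ i * dirD (0, EuclideanSpace.single i 1)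
          (dirD (0, f) (planeLaplacian f ξ Ψ)) (t, x) := by
      intro i
      rw [pderiv_slice (F := fun p : ℝ × Sp n => potV f ξ Ψ p.1 p.2 i)
        (differentiable_of_smooth (cV i)), dV]
    simp only [key, Finset.sum_sub_distrib, sum_mul_dirD]
    rw [dirD_comm sL (0, f) (0, ξ), sub_self]
  · have key : ∀ j, pderiv j (fun y => potU f ξ Ψ t y i j) x
        = f i * (f j * dirD (0, EuclideanSpace.single j 1) (potDiag f ξ Ψ) (t, x))
        - ξ i * (ξ j * dirD (0, EuclideanSpace.single j 1) (potDiag f ξ Ψ) (t, x))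
        + (f i * (ξ j * dirD (0, EuclideanSpace.single j 1) (potOff f ξ Ψ) (t, x))
        + ξ i * (f j * dirD (0, EuclideanSpace.single j 1) (potOff f ξ Ψ) (t, x))) := by
      intro j
      rw [pderiv_slice (F := fun p : ℝ × Sp n => potU f ξ Ψ p.1 p.2 i j)
        (differentiable_of_smooth (cU i j)), dU]
      ring
    simp only [key, Finset.sum_add_distrib, Finset.sum_sub_distrib, ← Finset.mul_sum,
      sum_mul_dirD]
    rw [deriv_slice (F := fun p : ℝ × Sp n => potV f ξ Ψ p.1 p.2 i)
      (differentiable_of_smooth (cV i)), dV]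
    have s1 : ∀ a, ContDiff ℝ ∞ (dirD a Ψ) := fun a => contDiff_dirD hΨ a
    have s2 : ∀ a b, ContDiff ℝ ∞ (dirD a (dirD b Ψ)) := fun a b => contDiff_dirD (s1 b) a
    have s3 : ∀ a b c, ContDiff ℝ ∞ (dirD a (dirD b (dirD c Ψ))) :=
      fun a b c => contDiff_dirD (s2 b c) a
    -- All fourth derivatives are brought to a form with the time derivative innermost; with `c1`
    -- and `c2` the coefficients of $f$ and of $\xi$ then cancel separately.
    have expL : ∀ a b, dirD a (dirD b (planeLaplacian f ξ Ψ)) = fun p =>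
        dirD b (dirD (0, ξ) (dirD (0, ξ) (dirD a Ψ))) p
          + dirD b (dirD (0, f) (dirD (0, f) (dirD a Ψ))) p := by
      intro a b
      have : planeLaplacian f ξ Ψ = fun p =>
        dirD (0, ξ) (dirD (0, ξ) Ψ) p + dirD (0, f) (dirD (0, f) Ψ) p := rfl
      rw [this, dirD_add (s2 _ _) (s2 _ _), dirD_add (s3 _ _ _) (s3 _ _ _),
        dirD_comm (s2 _ _) a b, dirD_comm (s1 _) a (0, ξ), dirD_comm hΨ a (0, ξ),
        dirD_comm (s2 _ _) a b, dirD_comm (s1 _) a (0, f), dirD_comm hΨ a (0, f)]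
    have expA : ∀ a, dirD a (potDiag f ξ Ψ) = fun p =>
        -2 * dirD a (dirD (0, f) (dirD (0, ξ) (dirD (1, 0) Ψ))) p := fun a =>
      dirD_const_mul (s3 _ _ _) _ _
    have expB : ∀ a, dirD a (potOff f ξ Ψ) = fun p =>
        dirD a (dirD (0, f) (dirD (0, f) (dirD (1, 0) Ψ))) p
          - dirD a (dirD (0, ξ) (dirD (0, ξ) (dirD (1, 0) Ψ))) p := fun a =>
      dirD_sub (s3 _ _ _) (s3 _ _ _) _
    have sτ : ContDiff ℝ ∞ (dirD (1, 0) Ψ) := s1 _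
    have c1 : dirD (0, ξ) (dirD (0, f) (dirD (0, f) (dirD (1, 0) Ψ)))
        = dirD (0, f) (dirD (0, f) (dirD (0, ξ) (dirD (1, 0) Ψ))) := by
      rw [dirD_comm (s2 _ _) (0, ξ) (0, f), dirD_comm sτ (0, ξ) (0, f)]
    have c2 : dirD (0, f) (dirD (0, ξ) (dirD (0, ξ) (dirD (1, 0) Ψ)))
        = dirD (0, ξ) (dirD (0, f) (dirD (0, ξ) (dirD (1, 0) Ψ))) := by
      rw [dirD_comm (s2 _ _) (0, f) (0, ξ)]
    rw [expL, expL, expA, expA, expB, expB, c1, c2]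
    simp only
    ring
  · have z : ∀ a b c, dirD a (dirD b (dirD c Ψ)) (t, x) = 0 := fun a b c =>
      dirD_eq_zero (fun h => hp (((tsupport_dirD_subset b _).trans
        (tsupport_dirD_subset c Ψ)) h)) a
    have s2 : ∀ a b, ContDiff ℝ ∞ (dirD a (dirD b Ψ)) :=
      fun a b => contDiff_dirD (contDiff_dirD hΨ b) a
    have zL : ∀ a, dirD a (planeLaplacian f ξ Ψ) (t, x) = 0 := by
      intro a
      have : planeLaplacian f ξ Ψ = fun p =>
        dirD (0, ξ) (dirD (0, ξ) Ψ) p + dirD (0, f) (dirD (0, f) Ψ) p := rfl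
      rw [this, dirD_add (s2 _ _) (s2 _ _)]
      simp [z]
    constructor
    · simp [potV, zL]
    · ext i j
      simp [potU, potDiag, potOff, z]

/-- The phase `(t, x) ↦ ξ · x - c t` of a plane wave. -/
noncomputable def phase (ξ : Sp n) (c : ℝ) : ℝ × Sp n →L[ℝ] ℝ :=
  (innerSL ℝ ξ).comp (ContinuousLinearMap.snd ℝ ℝ (Sp n)) - c • ContinuousLinearMap.fst ℝ ℝ (Sp n)

@[simp] theorem phase_apply (ξ : Sp n) (c : ℝ) (p : ℝ × Sp n) :
    phase ξ c p = inner ℝ ξ p.2 - c * p.1 := by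
  simp [phase]

theorem abs_coord_le {f : Sp n} (hf : ‖f‖ = 1) (i : Fin n) : |f i| ≤ 1 := by
  have := PiLp.norm_apply_le f i
  rwa [hf, Real.norm_eq_abs] at this

/-- Localized shear waves of high frequency. -/
theorem exists_localized_wave {f ξ : Sp n} (hf : ‖f‖ = 1) (hξ : ‖ξ‖ = 1) (hfξ : inner ℝ f ξ = 0)
    (c : ℝ) {φ : ℝ × Sp n → ℝ} (hφ : ContDiff ℝ ∞ φ) (hc : HasCompactSupport φ) :
    ∃ (w : ℝ → VField n) (U : ℝ → MField n) (C : ℝ), 0 ≤ C ∧ ∀ K, 1 ≤ K →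
      IsPerturbation (tsupport φ) (w K) (U K) ∧ ∀ t x,
        ‖w K t x - (φ (t, x) * Real.cos (K * phase ξ c (t, x))) • f‖ ≤ C / K ∧
        ∀ i j, |U K t x i j - φ (t, x) * Real.cos (K * phase ξ c (t, x)) * (c * symProd f ξ i j)|
          ≤ C / K := by
  set θ := phase ξ c with hθ
  -- These values decide which third derivatives survive at leading order: only $\partial_\xi^3$ in
  -- the velocity and $\partial_\xi^2\partial_t$ in the stress. Each other triple contains $f$, on
  -- which the phase is constant.
  have tξ : θ (0, ξ) = 1 := by simp [hθ, hξ]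
  have tf : θ (0, f) = 0 := by simp [hθ, real_inner_comm, hfξ]
  have tt : θ (1, 0) = -c := by simp [hθ]
  obtain ⟨C1, h10, h1⟩ := dirD_wavePot_asymptotics hφ hc θ (0, ξ) (0, ξ) (0, ξ)
  obtain ⟨C2, h20, h2⟩ := dirD_wavePot_asymptotics hφ hc θ (0, ξ) (0, f) (0, f)
  obtain ⟨C3, h30, h3⟩ := dirD_wavePot_asymptotics hφ hc θ (0, f) (0, ξ) (0, ξ)
  obtain ⟨C4, h40, h4⟩ := dirD_wavePot_asymptotics hφ hc θ (0, f) (0, f) (0, f)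
  obtain ⟨C5, h50, h5⟩ := dirD_wavePot_asymptotics hφ hc θ (0, f) (0, ξ) (1, 0)
  obtain ⟨C6, h60, h6⟩ := dirD_wavePot_asymptotics hφ hc θ (0, f) (0, f) (1, 0)
  obtain ⟨C7, h70, h7⟩ := dirD_wavePot_asymptotics hφ hc θ (0, ξ) (0, ξ) (1, 0)
  simp only [tξ, tf, tt, zero_mul, mul_zero, one_mul, sub_zero] at h1 h2 h3 h4 h5 h6 h7
  refine ⟨fun K => potV f ξ (wavePot φ θ K), fun K => potU f ξ (wavePot φ θ K),
    C1 + C2 + C3 + C4 + 2 * (2 * C5 + (C6 + C7)), by positivity, fun K hK => ⟨?_, fun t x => ?_⟩⟩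
  · exact (isPerturbation_pot hf hξ hfξ (contDiff_wavePot hφ θ K)).mono
      (tsupport_wavePot_subset φ θ K)
  have hK0 : 0 < K := by positivity
  have sΨ := contDiff_wavePot hφ θ K
  have s2 : ∀ a b, ContDiff ℝ ∞ (dirD a (dirD b (wavePot φ θ K))) :=
    fun a b => contDiff_dirD (contDiff_dirD sΨ b) a
  have expL : ∀ a, dirD a (planeLaplacian f ξ (wavePot φ θ K)) (t, x)
      = dirD a (dirD (0, ξ) (dirD (0, ξ) (wavePot φ θ K))) (t, x)
        + dirD a (dirD (0, f) (dirD (0, f) (wavePot φ θ K))) (t, x) := by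
    intro a
    have : planeLaplacian f ξ (wavePot φ θ K) = fun p =>
      dirD (0, ξ) (dirD (0, ξ) (wavePot φ θ K)) p
        + dirD (0, f) (dirD (0, f) (wavePot φ θ K)) p := rfl
    rw [this, dirD_add (s2 _ _) (s2 _ _)]
  specialize h1 K hK (t, x)
  specialize h2 K hK (t, x)
  specialize h3 K hK (t, x)
  specialize h4 K hK (t, x)
  specialize h5 K hK (t, x)
  specialize h6 K hK (t, x)
  specialize h7 K hK (t, x)
  set A1 := dirD (0, ξ) (dirD (0, ξ) (dirD (0, ξ) (wavePot φ θ K))) (t, x)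
  set A2 := dirD (0, ξ) (dirD (0, f) (dirD (0, f) (wavePot φ θ K))) (t, x)
  set A3 := dirD (0, f) (dirD (0, ξ) (dirD (0, ξ) (wavePot φ θ K))) (t, x)
  set A4 := dirD (0, f) (dirD (0, f) (dirD (0, f) (wavePot φ θ K))) (t, x)
  set A5 := dirD (0, f) (dirD (0, ξ) (dirD (1, 0) (wavePot φ θ K))) (t, x) with hA5
  set A6 := dirD (0, f) (dirD (0, f) (dirD (1, 0) (wavePot φ θ K))) (t, x) with hA6
  set A7 := dirD (0, ξ) (dirD (0, ξ) (dirD (1, 0) (wavePot φ θ K))) (t, x) with hA7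
  set m := φ (t, x) * Real.cos (K * θ (t, x)) with hm
  have q0 : ∀ {D : ℝ}, 0 ≤ D → 0 ≤ D / K := fun h => div_nonneg h hK0.le
  constructor
  · have e : potV f ξ (wavePot φ θ K) t x - m • f = (A1 - m + A2) • f - (A3 + A4) • ξ := by
      rw [potV, expL, expL]
      module
    rw [e]
    refine (norm_sub_le _ _).trans ?_
    rw [norm_smul, norm_smul, hf, hξ, mul_one, mul_one, Real.norm_eq_abs, Real.norm_eq_abs]
    have := abs_add_le (A1 - m) A2
    have := abs_add_le A3 A4
    simp only [add_div]
    have := q0 (show 0 ≤ 2 * (2 * C5 + (C6 + C7)) by positivity)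
    linarith
  · intro i j
    have e : potU f ξ (wavePot φ θ K) t x i j - m * (c * symProd f ξ i j)
        = (-2 * A5) * (f i * f j - ξ i * ξ j)
          + (A6 - (A7 - -c * m)) * (f i * ξ j + ξ i * f j) := by
      simp only [potU, symProd, potDiag, potOff, Matrix.of_apply, ← hA5, ← hA6, ← hA7]
      ring
    have m1 : ∀ a b : Sp n, ‖a‖ = 1 → ‖b‖ = 1 → ∀ i j, |a i * b j| ≤ 1 := by
      intro a b ha hb i j
      rw [abs_mul]
      exact mul_le_one₀ (abs_coord_le ha i) (abs_nonneg _) (abs_coord_le hb j)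
    have b1 : |f i * f j - ξ i * ξ j| ≤ 2 := by
      refine (abs_sub _ _).trans ?_
      linarith [m1 f f hf hf i j, m1 ξ ξ hξ hξ i j]
    have b2 : |f i * ξ j + ξ i * f j| ≤ 2 := by
      refine (abs_add_le _ _).trans ?_
      linarith [m1 f ξ hf hξ i j, m1 ξ f hξ hf i j]
    have b3 : |A6 - (A7 - -c * m)| ≤ C6 / K + C7 / K :=
      (abs_sub _ _).trans (add_le_add h6 h7)
    have b4 : |-2 * A5| ≤ 2 * (C5 / K) := by
      rw [abs_mul, abs_neg, abs_two]
      linarith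
    rw [e]
    refine (abs_add_le _ _).trans ?_
    rw [abs_mul (-2 * A5), abs_mul (A6 - (A7 - -c * m))]
    have b5 := mul_le_mul b4 b1 (abs_nonneg _) (by have := q0 h50; positivity)
    have b6 := mul_le_mul b3 b2 (abs_nonneg _) (add_nonneg (q0 h60) (q0 h70))
    have e2 : (C1 + C2 + C3 + C4 + 2 * (2 * C5 + (C6 + C7))) / K
        = C1 / K + C2 / K + C3 / K + C4 / K + (2 * (C5 / K) * 2 + (C6 / K + C7 / K) * 2) := by
      ring
    rw [e2]
    linarith [q0 h10, q0 h20, q0 h30, q0 h40]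

end Perturbations

/-! ### Riemann–Lebesgue and weak convergence, uniformly in time. -/

section Oscillation

variable {n : ℕ}

theorem integrable_of_continuous_of_eq_zero {G : Type*} [NormedAddCommGroup G] {F : Sp n → G}
    (hF : Continuous F) {R : ℝ} (hR : ∀ x, R < ‖x‖ → F x = 0) : Integrable F :=
  hF.integrable_of_hasCompactSupport <|
    HasCompactSupport.intro (isCompact_closedBall (0 : Sp n) R) fun x hx => hR x (by
      simpa using hx)

theorem abs_integral_le_of_eq_zero {F : Sp n → ℝ} {R η : ℝ} (hR : ∀ x, R < ‖x‖ → F x = 0)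
    (hη : ∀ x, |F x| ≤ η) :
    |∫ x, F x| ≤ η * volume.real (Metric.closedBall (0 : Sp n) R) := by
  have h : ∫ x in Metric.closedBall (0 : Sp n) R, F x = ∫ x, F x :=
    setIntegral_eq_integral_of_forall_compl_eq_zero fun x hx => hR x (by simpa using hx)
  rw [← h, ← Real.norm_eq_abs]
  exact norm_setIntegral_le_of_norm_le_const measure_closedBall_lt_top fun x _ => hη x

theorem exists_radius {K : Set (ℝ × Sp n)} (hK : IsCompact K) :
    ∃ R, 0 ≤ R ∧ ∀ t x, R < ‖x‖ → (t, x) ∉ K := by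
  obtain ⟨R, hR⟩ := hK.isBounded.exists_norm_le
  refine ⟨max R 0, le_max_right _ _, fun t x hx h => ?_⟩
  have h1 := hR _ h
  have h2 : ‖x‖ ≤ ‖((t, x) : ℝ × Sp n)‖ := norm_snd_le (t, x)
  have := le_max_left R 0
  linarith

/-- A sequence of integrands, depending on time, whose integrals tend to zero uniformly in
time. -/
def NegligibleIntegrand (F : ℕ → ℝ → Sp n → ℝ) : Prop :=
  (∀ k t, Integrable (F k t)) ∧ ∀ ε > 0, ∀ᶠ k in atTop, ∀ t, |∫ x, F k t x| ≤ ε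

theorem NegligibleIntegrand.zero : NegligibleIntegrand (fun _ _ (_ : Sp n) => (0 : ℝ)) :=
  ⟨fun _ _ => integrable_zero _ _ _, fun ε hε => Eventually.of_forall fun k t => by
    simpa using hε.le⟩

theorem NegligibleIntegrand.add {F G : ℕ → ℝ → Sp n → ℝ} (hF : NegligibleIntegrand F)
    (hG : NegligibleIntegrand G) : NegligibleIntegrand (fun k t x => F k t x + G k t x) := by
  refine ⟨fun k t => (hF.1 k t).add (hG.1 k t), fun ε hε => ?_⟩
  filter_upwards [hF.2 (ε / 2) (half_pos hε), hG.2 (ε / 2) (half_pos hε)] with k h1 h2 t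
  rw [integral_add (hF.1 k t) (hG.1 k t)]
  linarith [abs_add_le (∫ x, F k t x) (∫ x, G k t x), h1 t, h2 t]

theorem NegligibleIntegrand.const_mul {F : ℕ → ℝ → Sp n → ℝ} (hF : NegligibleIntegrand F)
    (c : ℝ) : NegligibleIntegrand (fun k t x => c * F k t x) := by
  refine ⟨fun k t => (hF.1 k t).const_mul c, fun ε hε => ?_⟩
  filter_upwards [hF.2 (ε / (|c| + 1)) (by positivity)] with k h t
  rw [integral_const_mul, abs_mul]
  calc |c| * |∫ x, F k t x| ≤ (|c| + 1) * (ε / (|c| + 1)) := by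
        gcongr
        · linarith
        · exact h t
    _ = ε := by field_simp

theorem NegligibleIntegrand.sum {ι : Type*} (s : Finset ι) {F : ι → ℕ → ℝ → Sp n → ℝ}
    (hF : ∀ i ∈ s, NegligibleIntegrand (F i)) :
    NegligibleIntegrand (fun k t x => ∑ i ∈ s, F i k t x) := by
  classical
  induction s using Finset.induction_on with
  | empty => simpa using NegligibleIntegrand.zero
  | insert a s ha ih =>
    simp only [Finset.sum_insert ha]
    exact (hF a (Finset.mem_insert_self a s)).add
      (ih fun i hi => hF i (Finset.mem_insert_of_mem hi))

theorem NegligibleIntegrand.of_decay {F : ℕ → ℝ → Sp n → ℝ} {R C : ℝ}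
    (hc : ∀ k t, Continuous (F k t)) (hR : ∀ k t x, R < ‖x‖ → F k t x = 0)
    (hC : ∀ k t x, |F k t x| ≤ C / ((k : ℝ) + 1)) : NegligibleIntegrand F := by
  refine ⟨fun k t => integrable_of_continuous_of_eq_zero (hc k t) (hR k t), fun ε hε => ?_⟩
  have h : Tendsto (fun k : ℕ => C / ((k : ℝ) + 1) * volume.real (Metric.closedBall (0 : Sp n) R))
      atTop (𝓝 0) := by
    have h1 := tendsto_one_div_add_atTop_nhds_zero_nat (𝕜 := ℝ)
    have h2 := h1.const_mul (C * volume.real (Metric.closedBall (0 : Sp n) R))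
    rw [mul_zero] at h2
    refine h2.congr fun k => ?_
    ring
  filter_upwards [h.eventually (ge_mem_nhds hε)] with k hk t
  exact (abs_integral_le_of_eq_zero (hR k t) (hC k t)).trans hk

/-- Riemann–Lebesgue lemma, uniformly in time. -/
theorem NegligibleIntegrand.oscillation {G : ℝ × Sp n → ℝ} (hG : Continuous G)
    (hc : HasCompactSupport G) {ζ : Sp n} (hζ : ζ ≠ 0) (b : ℝ) :
    NegligibleIntegrand
      (fun k t x => G (t, x) * Real.cos (((k : ℝ) + 1) * (inner ℝ ζ x - b * t))) := by
  obtain ⟨R, hR0, hR⟩ := exists_radius hc.isCompact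
  have hGR : ∀ t x, R < ‖x‖ → G (t, x) = 0 := fun t x hx =>
    image_eq_zero_of_notMem_tsupport (hR t x hx)
  have cs : ∀ t, Continuous (fun x => G (t, x)) := fun t => hG.comp (by fun_prop)
  have co : ∀ (k : ℕ) (t : ℝ),
      Continuous (fun x : Sp n => Real.cos (((k : ℝ) + 1) * (inner ℝ ζ x - b * t))) := by
    intro k t
    fun_prop
  have hint : ∀ (k : ℕ) (t : ℝ), Integrable
      (fun x => G (t, x) * Real.cos (((k : ℝ) + 1) * (inner ℝ ζ x - b * t))) := fun k t =>
    integrable_of_continuous_of_eq_zero ((cs t).mul (co k t)) fun x hx => by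
      rw [hGR t x hx, zero_mul]
  refine ⟨hint, fun ε hε => ?_⟩
  -- The radius is $R+1$ because the difference of $G$ and its translate by a vector of length less
  -- than $1$ is supported there.
  set A : ℝ := volume.real (Metric.closedBall (0 : Sp n) (R + 1)) with hA
  have hA0 : 0 ≤ A := measureReal_nonneg
  obtain ⟨δ, hδ, huc⟩ := Metric.uniformContinuous_iff.1
    (hc.uniformContinuous_of_continuous hG) (ε / (A + 1)) (by positivity)
  have hζ2 : 0 < ‖ζ‖ ^ 2 := by positivity
  have hlim : Tendsto (fun k : ℕ => 1 / ((k : ℝ) + 1) * (Real.pi / ‖ζ‖)) atTop (𝓝 0) := by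
    simpa using (tendsto_one_div_add_atTop_nhds_zero_nat (𝕜 := ℝ)).mul_const (Real.pi / ‖ζ‖)
  filter_upwards [hlim.eventually (gt_mem_nhds (lt_min hδ one_pos))] with k hk t
  have hk0 : (0 : ℝ) < (k : ℝ) + 1 := by positivity
  -- Translation by half a wavelength reverses the sign of the cosine. Averaging the integral with
  -- its translate leaves $2I=\int(G(x)-G(x+h))\cos$, which is small by uniform continuity of $G$ in
  -- space-time, uniformly in $t$.
  set h : Sp n := (Real.pi / (((k : ℝ) + 1) * ‖ζ‖ ^ 2)) • ζ with hh
  have hnh : ‖h‖ = 1 / ((k : ℝ) + 1) * (Real.pi / ‖ζ‖) := by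
    rw [hh, norm_smul, Real.norm_of_nonneg (by positivity)]
    have : ‖ζ‖ ≠ 0 := norm_ne_zero_iff.2 hζ
    field_simp
  have hh1 : ‖h‖ < δ := hnh ▸ hk.trans_le (min_le_left _ _)
  have hh2 : ‖h‖ < 1 := hnh ▸ hk.trans_le (min_le_right _ _)
  have hcos : ∀ x : Sp n, Real.cos (((k : ℝ) + 1) * (inner ℝ ζ (x + h) - b * t))
      = -Real.cos (((k : ℝ) + 1) * (inner ℝ ζ x - b * t)) := by
    intro x
    rw [← Real.cos_add_pi]
    congr 1
    rw [inner_add_right, hh, inner_smul_right, real_inner_self_eq_norm_sq]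
    field_simp
    ring
  set I := ∫ x, G (t, x) * Real.cos (((k : ℝ) + 1) * (inner ℝ ζ x - b * t)) with hI
  have hsh : ∫ x, G (t, x + h) * Real.cos (((k : ℝ) + 1) * (inner ℝ ζ x - b * t)) = -I := by
    have hinv := integral_add_right_eq_self (μ := volume)
      (fun x => G (t, x) * Real.cos (((k : ℝ) + 1) * (inner ℝ ζ x - b * t))) h
    rw [hI, ← hinv, ← integral_neg]
    congr 1
    ext x
    rw [hcos]
    ring
  have hint2 : Integrable
      (fun x => G (t, x + h) * Real.cos (((k : ℝ) + 1) * (inner ℝ ζ x - b * t))) := by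
    have := ((hint k t).comp_add_right h).neg
    refine this.congr (Eventually.of_forall fun x => ?_)
    simp only [Pi.neg_apply]
    rw [hcos]
    ring
  have h2I : 2 * I = ∫ x, (G (t, x) - G (t, x + h)) *
      Real.cos (((k : ℝ) + 1) * (inner ℝ ζ x - b * t)) := by
    have : ∀ x, (G (t, x) - G (t, x + h)) * Real.cos (((k : ℝ) + 1) * (inner ℝ ζ x - b * t))
        = G (t, x) * Real.cos (((k : ℝ) + 1) * (inner ℝ ζ x - b * t))
          - G (t, x + h) * Real.cos (((k : ℝ) + 1) * (inner ℝ ζ x - b * t)) := fun x => by ring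
    simp only [this]
    rw [integral_sub (hint k t) hint2, hsh]
    ring
  have hb := abs_integral_le_of_eq_zero (F := fun x => (G (t, x) - G (t, x + h)) *
      Real.cos (((k : ℝ) + 1) * (inner ℝ ζ x - b * t))) (R := R + 1) (η := ε / (A + 1)) ?_ ?_
  · rw [← h2I, abs_mul, abs_two, ← hA] at hb
    have : ε / (A + 1) * A ≤ ε := by
      rw [div_mul_eq_mul_div, div_le_iff₀ (by positivity)]
      nlinarith
    linarith [abs_nonneg I]
  · intro x hx
    have h1 : R < ‖x + h‖ := by
      have := norm_sub_norm_le x (-h)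
      rw [sub_neg_eq_add, norm_neg] at this
      linarith
    rw [hGR t x (by linarith), hGR t _ h1, sub_zero, zero_mul]
  · intro x
    rw [abs_mul]
    have h1 : |G (t, x) - G (t, x + h)| ≤ ε / (A + 1) := by
      rw [← Real.dist_eq]
      refine (huc ?_).le
      rw [Prod.dist_eq]
      simpa [dist_eq_norm, hδ] using hh1
    calc _ ≤ ε / (A + 1) * 1 := by
          gcongr
          exact Real.abs_cos_le_one _
      _ = _ := mul_one _

/-- Bounded fields with uniformly bounded supports that converge weakly to zero against
continuous functions, uniformly in time, also do so against locally integrable functions. -/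
theorem tendsto_weakly_of_continuous {w : ℕ → VField n} {R B : ℝ}
    (hw : ∀ k t, Continuous (w k t)) (hR : ∀ k t x, R < ‖x‖ → w k t x = 0)
    (hB : ∀ k t x, ‖w k t x‖ ≤ B)
    (hg : ∀ g : Sp n → Sp n, Continuous g → HasCompactSupport g →
      NegligibleIntegrand (fun k t x => inner ℝ (w k t x) (g x)))
    {φ : Sp n → Sp n} (hφ : LocallyIntegrable φ) {ε : ℝ} (hε : 0 < ε) :
    ∀ᶠ k in atTop, ∀ t, |∫ x, inner ℝ (w k t x) (φ x)| ≤ ε := by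
  have hB0 : 0 ≤ B := (norm_nonneg _).trans (hB 0 0 0)
  set b := Metric.closedBall (0 : Sp n) R with hb
  have hφb : Integrable (b.indicator φ) :=
    (hφ.integrableOn_isCompact (isCompact_closedBall _ _)).integrable_indicator
      measurableSet_closedBall
  -- Approximation in $L^1$ on the common ball is enough, since the fields are uniformly bounded and
  -- vanish outside it.
  obtain ⟨g, hgc, hge, hgcont, hgi⟩ := hφb.exists_hasCompactSupport_integral_sub_le
    (show 0 < ε / 2 / (B + 1) by positivity)
  filter_upwards [(hg g hgcont hgc).2 (ε / 2) (half_pos hε)] with k hk t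
  have hI1 : Integrable (fun x => (inner ℝ (w k t x) (g x) : ℝ)) := (hg g hgcont hgc).1 k t
  have hd : Integrable (fun x => ‖b.indicator φ x - g x‖) := (hφb.sub hgi).norm
  have hbound : ∀ x, ‖(inner ℝ (w k t x) (b.indicator φ x - g x) : ℝ)‖
      ≤ B * ‖b.indicator φ x - g x‖ := fun x =>
    (norm_inner_le_norm _ _).trans (mul_le_mul_of_nonneg_right (hB k t x) (norm_nonneg _))
  have hI2 : Integrable (fun x => (inner ℝ (w k t x) (b.indicator φ x - g x) : ℝ)) := by
    refine Integrable.mono' (hd.const_mul B) ?_ (Eventually.of_forall hbound)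
    exact (hw k t).aestronglyMeasurable.inner (hφb.sub hgi).aestronglyMeasurable
  have hsplit : ∫ x, inner ℝ (w k t x) (φ x)
      = (∫ x, inner ℝ (w k t x) (g x)) + ∫ x, inner ℝ (w k t x) (b.indicator φ x - g x) := by
    rw [← integral_add hI1 hI2]
    congr 1
    ext x
    by_cases hx : x ∈ b
    · rw [indicator_of_mem hx, inner_sub_right]
      ring
    · have : w k t x = 0 := hR k t x (by simpa [hb] using hx)
      simp [this]
  have h2 : |∫ x, inner ℝ (w k t x) (b.indicator φ x - g x)| ≤ ε / 2 := by
    rw [← Real.norm_eq_abs]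
    refine (norm_integral_le_of_norm_le (hd.const_mul B) (Eventually.of_forall hbound)).trans ?_
    rw [integral_const_mul]
    calc B * ∫ x, ‖b.indicator φ x - g x‖ ≤ (B + 1) * (ε / 2 / (B + 1)) := by
          gcongr
          linarith
      _ = ε / 2 := by field_simp
  rw [hsplit]
  refine (abs_add_le _ _).trans ?_
  linarith [hk t]

end Oscillation

/-! ### Superpositions of waves: weak limit and energy. -/

section WaveFamilies

variable {n : ℕ} {ι : Type*} [Fintype ι]

/-- The leading part of a superposition of shear waves. -/
noncomputable def waveSum (φ : ι → ℝ × Sp n → ℝ) (f ζ : ι → Sp n) (b : ι → ℝ) (k : ℕ) : VField n :=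
  fun t x => ∑ i, (φ i (t, x) * Real.cos (((k : ℝ) + 1) * (inner ℝ (ζ i) x - b i * t))) • f i

/-- Superpositions of localized shear waves with pairwise different frequencies. -/
theorem exists_wave_family {f ξ : ι → Sp n} (hf : ∀ i, ‖f i‖ = 1) (hξ : ∀ i, ‖ξ i‖ = 1)
    (hfξ : ∀ i, inner ℝ (f i) (ξ i) = 0) (c : ι → ℝ) {φ : ι → ℝ × Sp n → ℝ}
    (hφ : ∀ i, ContDiff ℝ ∞ (φ i)) (hc : ∀ i, HasCompactSupport (φ i)) {K : Set (ℝ × Sp n)}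
    (hK : ∀ i, tsupport (φ i) ⊆ K) :
    ∃ (w : ℕ → VField n) (U : ℕ → MField n) (ζ : ι → Sp n) (b : ι → ℝ) (C : ℝ),
      (∀ i j, ζ i + ζ j ≠ 0) ∧ (∀ i j, i ≠ j → ζ i - ζ j ≠ 0) ∧ 0 ≤ C ∧
      ∀ k, IsPerturbation K (w k) (U k) ∧ ∀ t x,
        ‖w k t x - waveSum φ f ζ b k t x‖ ≤ C / ((k : ℝ) + 1) ∧
        ∀ l m, |U k t x l m - ∑ i, φ i (t, x) *
          Real.cos (((k : ℝ) + 1) * (inner ℝ (ζ i) x - b i * t)) *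
            (c i * symProd (f i) (ξ i) l m)| ≤ C / ((k : ℝ) + 1) := by
  choose w U C hC h using fun i => exists_localized_wave (hf i) (hξ i) (hfξ i) (c i) (hφ i) (hc i)
  -- Distinct integers from $1$ on, used as relative frequencies. The wave vectors $N_i\xi_i$ then
  -- have pairwise distinct nonzero norms, so no sum of two of them vanishes (a repeated index
  -- included), nor does a difference with distinct indices.
  set N : ι → ℝ := fun i => ((Fintype.equivFin ι i : ℕ) : ℝ) + 1 with hN
  have hN1 : ∀ i, 1 ≤ N i := fun i => by simp [hN]
  have hNinj : ∀ i j, N i = N j → i = j := by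
    intro i j hij
    simp only [hN, add_left_inj, Nat.cast_inj] at hij
    exact (Fintype.equivFin ι).injective (Fin.ext hij)
  have hnorm : ∀ i, ‖N i • ξ i‖ = N i := fun i => by
    rw [norm_smul, hξ, mul_one, Real.norm_of_nonneg (by linarith [hN1 i])]
  have hKk : ∀ (k : ℕ) i, (1 : ℝ) ≤ ((k : ℝ) + 1) * N i := fun k i => by
    have : (1 : ℝ) ≤ (k : ℝ) + 1 := by simp
    nlinarith [hN1 i]
  have hCk : ∀ (k : ℕ) i, C i / (((k : ℝ) + 1) * N i) ≤ C i / ((k : ℝ) + 1) := fun k i => by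
    apply div_le_div_of_nonneg_left (hC i) (by positivity)
    have : (0 : ℝ) < (k : ℝ) + 1 := by positivity
    nlinarith [hN1 i]
  have hph : ∀ (k : ℕ) i t (x : Sp n), ((k : ℝ) + 1) * N i * phase (ξ i) (c i) (t, x)
      = ((k : ℝ) + 1) * (inner ℝ (N i • ξ i) x - N i * c i * t) := by
    intro k i t x
    rw [phase_apply, real_inner_smul_left]
    ring
  refine ⟨fun k => ∑ i, w i (((k : ℝ) + 1) * N i), fun k => ∑ i, U i (((k : ℝ) + 1) * N i),
    fun i => N i • ξ i, fun i => N i * c i, ∑ i, C i, ?_, ?_, Finset.sum_nonneg fun i _ => hC i,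
    fun k => ⟨IsPerturbation.sum _ fun i _ => ((h i _ (hKk k i)).1).mono (hK i), fun t x => ?_⟩⟩
  · intro i j hij
    have h1 : N i • ξ i = -(N j • ξ j) := eq_neg_of_add_eq_zero_left hij
    have h2 : N i = N j := by rw [← hnorm i, h1, norm_neg, hnorm]
    have h3 := hNinj i j h2
    subst h3
    have h4 : (2 * N i) • ξ i = 0 := by rw [← hij]; module
    have h5 : ‖(2 * N i) • ξ i‖ = 2 * N i := by
      rw [norm_smul, hξ, mul_one, Real.norm_of_nonneg (by linarith [hN1 i])]
    rw [h4, norm_zero] at h5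
    linarith [hN1 i]
  · intro i j hne hij
    apply hne
    apply hNinj
    have h1 : N i • ξ i = N j • ξ j := sub_eq_zero.1 hij
    rw [← hnorm i, h1, hnorm]
  · constructor
    · have e : (∑ i, w i (((k : ℝ) + 1) * N i)) t x
          - waveSum φ f (fun i => N i • ξ i) (fun i => N i * c i) k t x
          = ∑ i, (w i (((k : ℝ) + 1) * N i) t x - (φ i (t, x) *
            Real.cos (((k : ℝ) + 1) * N i * phase (ξ i) (c i) (t, x))) • f i) := by
        simp only [waveSum, Finset.sum_apply, Finset.sum_sub_distrib, hph]
      rw [e, Finset.sum_div]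
      exact (norm_sum_le _ _).trans (Finset.sum_le_sum fun i _ =>
        (((h i _ (hKk k i)).2 t x).1).trans (hCk k i))
    · intro l m
      have e : (∑ i, U i (((k : ℝ) + 1) * N i)) t x l m - ∑ i, φ i (t, x) *
          Real.cos (((k : ℝ) + 1) * (inner ℝ (N i • ξ i) x - N i * c i * t)) *
            (c i * symProd (f i) (ξ i) l m)
          = ∑ i, (U i (((k : ℝ) + 1) * N i) t x l m - φ i (t, x) *
            Real.cos (((k : ℝ) + 1) * N i * phase (ξ i) (c i) (t, x)) *
            (c i * symProd (f i) (ξ i) l m)) := by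
        simp only [Finset.sum_apply, Finset.sum_sub_distrib, hph, Matrix.sum_apply]
      rw [e, Finset.sum_div]
      exact (Finset.abs_sum_le_sum_abs _ _).trans (Finset.sum_le_sum fun i _ =>
        (((h i _ (hKk k i)).2 t x).2 l m).trans (hCk k i))

theorem norm_waveSum_le {f : ι → Sp n} (hf : ∀ i, ‖f i‖ = 1) (φ : ι → ℝ × Sp n → ℝ)
    (ζ : ι → Sp n) (b : ι → ℝ) (k : ℕ) (t : ℝ) (x : Sp n) :
    ‖waveSum φ f ζ b k t x‖ ≤ ∑ i, |φ i (t, x)| := by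
  refine (norm_sum_le _ _).trans (Finset.sum_le_sum fun i _ => ?_)
  rw [norm_smul, hf, mul_one, Real.norm_eq_abs, abs_mul]
  exact mul_le_of_le_one_right (abs_nonneg _) (Real.abs_cos_le_one _)

theorem exists_norm_waveSum_le {f : ι → Sp n} (hf : ∀ i, ‖f i‖ = 1) {φ : ι → ℝ × Sp n → ℝ}
    (hφ : ∀ i, Continuous (φ i)) (hc : ∀ i, HasCompactSupport (φ i)) (ζ : ι → Sp n) (b : ι → ℝ) :
    ∃ B, 0 ≤ B ∧ ∀ k t x, ‖waveSum φ f ζ b k t x‖ ≤ B := by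
  choose B hB using fun i => (hφ i).bounded_above_of_compact_support (hc i)
  refine ⟨∑ i, B i, Finset.sum_nonneg fun i _ => (norm_nonneg _).trans (hB i 0), fun k t x => ?_⟩
  exact (norm_waveSum_le hf φ ζ b k t x).trans (Finset.sum_le_sum fun i _ => hB i (t, x))

theorem continuous_waveSum {φ : ι → ℝ × Sp n → ℝ} (hφ : ∀ i, Continuous (φ i)) (f ζ : ι → Sp n)
    (b : ι → ℝ) (k : ℕ) : Continuous (fun p : ℝ × Sp n => waveSum φ f ζ b k p.1 p.2) := by
  unfold waveSum
  refine continuous_finsetSum _ fun i _ => ?_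
  have := hφ i
  fun_prop

/-- Weak convergence to zero of superpositions of waves. -/
theorem wave_tendsto_weakly {f ζ : ι → Sp n} (hf : ∀ i, ‖f i‖ = 1) {b : ι → ℝ}
    {φ : ι → ℝ × Sp n → ℝ} (hφ : ∀ i, Continuous (φ i)) (hc : ∀ i, HasCompactSupport (φ i))
    (hζ : ∀ i, ζ i ≠ 0) {w : ℕ → VField n} {C R : ℝ} (hC : 0 ≤ C)
    (hw : ∀ k t, Continuous (w k t)) (hwR : ∀ k t x, R < ‖x‖ → w k t x = 0)
    (hφR : ∀ i t x, R < ‖x‖ → φ i (t, x) = 0)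
    (hdiff : ∀ k t x, ‖w k t x - waveSum φ f ζ b k t x‖ ≤ C / ((k : ℝ) + 1))
    {ψ : Sp n → Sp n} (hψ : LocallyIntegrable ψ) {ε : ℝ} (hε : 0 < ε) :
    ∀ᶠ k in atTop, ∀ t, |∫ x, inner ℝ (w k t x) (ψ x)| ≤ ε := by
  obtain ⟨B, hB0, hB⟩ := exists_norm_waveSum_le hf hφ hc ζ b
  refine tendsto_weakly_of_continuous (B := B + C) hw hwR (fun k t x => ?_) ?_ hψ hε
  · have h1 := hdiff k t x
    have h2 : C / ((k : ℝ) + 1) ≤ C := div_le_self hC (by simp)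
    have h3 := norm_le_norm_add_norm_sub (waveSum φ f ζ b k t x) (w k t x)
    rw [norm_sub_rev] at h3
    linarith [hB k t x]
  · intro g hg hgc
    obtain ⟨M, hM⟩ := hg.bounded_above_of_compact_support hgc
    have hsum : NegligibleIntegrand (fun k t x => ∑ i, φ i (t, x) * inner ℝ (f i) (g x) *
        Real.cos (((k : ℝ) + 1) * (inner ℝ (ζ i) x - b i * t))) := by
      refine NegligibleIntegrand.sum _ fun i _ => ?_
      refine NegligibleIntegrand.oscillation
        (G := fun p : ℝ × Sp n => φ i p * inner ℝ (f i) (g p.2)) ?_ ?_ (hζ i) (b i)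
      · have := hφ i
        fun_prop
      · exact (hc i).mul_right
    have hrem : NegligibleIntegrand (fun k t x =>
        inner ℝ (w k t x - waveSum φ f ζ b k t x) (g x)) := by
      refine NegligibleIntegrand.of_decay (R := R) (C := C * M) (fun k t => ?_) (fun k t x hx => ?_)
        fun k t x => ?_
      · refine ((hw k t).sub ?_).inner hg
        exact (continuous_waveSum hφ f ζ b k).comp (Continuous.prodMk_right t)
      · simp [hwR k t x hx, waveSum, hφR _ t x hx]
      · refine (abs_real_inner_le_norm _ _).trans ?_
        rw [mul_div_right_comm]
        exact mul_le_mul (hdiff k t x) (hM x) (norm_nonneg _) (by positivity)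
    convert hsum.add hrem using 4 with k t x
    have e : ∑ i, φ i (t, x) * inner ℝ (f i) (g x) *
        Real.cos (((k : ℝ) + 1) * (inner ℝ (ζ i) x - b i * t))
        = inner ℝ (waveSum φ f ζ b k t x) (g x) := by
      rw [waveSum, sum_inner]
      refine Finset.sum_congr rfl fun i _ => ?_
      rw [real_inner_smul_left]
      ring
    rw [e, inner_sub_left]
    ring

/-- The energy of superpositions of waves. -/
theorem wave_energy_negligible {f ζ : ι → Sp n} (hf : ∀ i, ‖f i‖ = 1) {b : ι → ℝ}
    {φ : ι → ℝ × Sp n → ℝ} (hφ : ∀ i, Continuous (φ i)) (hc : ∀ i, HasCompactSupport (φ i))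
    (hζ : ∀ i j, ζ i + ζ j ≠ 0) (hζ' : ∀ i j, i ≠ j → ζ i - ζ j ≠ 0)
    {w : ℕ → VField n} {C R : ℝ} (hC : 0 ≤ C)
    (hw : ∀ k t, Continuous (w k t)) (hwR : ∀ k t x, R < ‖x‖ → w k t x = 0)
    (hφR : ∀ i t x, R < ‖x‖ → φ i (t, x) = 0)
    (hdiff : ∀ k t x, ‖w k t x - waveSum φ f ζ b k t x‖ ≤ C / ((k : ℝ) + 1))
    {V : ℝ × Sp n → Sp n} (hV : Continuous V) {D : ℝ} (hD : ∀ p, ‖V p‖ ≤ D) :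
    NegligibleIntegrand (fun k t x => inner ℝ (V (t, x)) (w k t x) + (1 / 2) * ‖w k t x‖ ^ 2
      - (1 / 4) * ∑ i, φ i (t, x) ^ 2) := by
  classical
  obtain ⟨B, hB0, hB⟩ := exists_norm_waveSum_le hf hφ hc ζ b
  have hζ0 : ∀ i, ζ i ≠ 0 := fun i h => hζ i i (by simp [h])
  have hlin : NegligibleIntegrand (fun k t x => ∑ i, φ i (t, x) * inner ℝ (V (t, x)) (f i) *
      Real.cos (((k : ℝ) + 1) * (inner ℝ (ζ i) x - b i * t))) := by
    refine NegligibleIntegrand.sum _ fun i _ => ?_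
    refine NegligibleIntegrand.oscillation
      (G := fun p : ℝ × Sp n => φ i p * inner ℝ (V p) (f i)) ?_ ?_ (hζ0 i) (b i)
    · have := hφ i
      fun_prop
    · exact (hc i).mul_right
  have hcc : ∀ i j, Continuous (fun p : ℝ × Sp n => φ i p * φ j p * inner ℝ (f i) (f j)) := by
    intro i j
    have := hφ i
    have := hφ j
    fun_prop
  have hcs : ∀ i j, HasCompactSupport
      (fun p : ℝ × Sp n => φ i p * φ j p * inner ℝ (f i) (f j)) := fun i j =>
    ((hc i).mul_right).mul_right
  have hplus : NegligibleIntegrand (fun k t x => ∑ i, ∑ j,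
      (φ i (t, x) * φ j (t, x) * inner ℝ (f i) (f j)) *
        Real.cos (((k : ℝ) + 1) * (inner ℝ (ζ i + ζ j) x - (b i + b j) * t))) :=
    NegligibleIntegrand.sum _ fun i _ => NegligibleIntegrand.sum _ fun j _ =>
      NegligibleIntegrand.oscillation (hcc i j) (hcs i j) (hζ i j) _
  have hminus : NegligibleIntegrand (fun k t x => ∑ i, ∑ j, if i = j then 0 else
      (φ i (t, x) * φ j (t, x) * inner ℝ (f i) (f j)) *
        Real.cos (((k : ℝ) + 1) * (inner ℝ (ζ i - ζ j) x - (b i - b j) * t))) := by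
    refine NegligibleIntegrand.sum _ fun i _ => NegligibleIntegrand.sum _ fun j _ => ?_
    by_cases h : i = j
    · simpa [h] using NegligibleIntegrand.zero
    · simpa only [h, if_false] using
        NegligibleIntegrand.oscillation (hcc i j) (hcs i j) (hζ' i j h) (b i - b j)
  have hrem : NegligibleIntegrand (fun k t x =>
      inner ℝ (V (t, x) + waveSum φ f ζ b k t x) (w k t x - waveSum φ f ζ b k t x)
        + (1 / 2) * ‖w k t x - waveSum φ f ζ b k t x‖ ^ 2) := by
    have cw : ∀ k t, Continuous (waveSum φ f ζ b k t) := fun k t =>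
      (continuous_waveSum hφ f ζ b k).comp (Continuous.prodMk_right t)
    have cV : ∀ t, Continuous (fun x => V (t, x)) := fun t => hV.comp (Continuous.prodMk_right t)
    refine NegligibleIntegrand.of_decay (R := R) (C := (D + B) * C + (1 / 2) * (C * C))
      (fun k t => ?_) (fun k t x hx => ?_) fun k t x => ?_
    · exact (((cV t).add (cw k t)).inner ((hw k t).sub (cw k t))).add
        (continuous_const.mul (((hw k t).sub (cw k t)).norm.pow 2))
    · simp [hwR k t x hx, waveSum, hφR _ t x hx]
    · set r := w k t x - waveSum φ f ζ b k t x with hr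
      have hr1 : ‖r‖ ≤ C / ((k : ℝ) + 1) := hdiff k t x
      have hr2 : ‖r‖ ≤ C := hr1.trans (div_le_self hC (by simp))
      have h1 : |inner ℝ (V (t, x) + waveSum φ f ζ b k t x) r| ≤ (D + B) * (C / ((k : ℝ) + 1)) := by
        refine (abs_real_inner_le_norm _ _).trans ?_
        refine mul_le_mul ((norm_add_le _ _).trans (add_le_add (hD _) (hB k t x))) hr1
          (norm_nonneg _) ?_
        exact add_nonneg ((norm_nonneg _).trans (hD 0)) hB0
      have h2 : |(1 / 2) * ‖r‖ ^ 2| ≤ (1 / 2) * (C * (C / ((k : ℝ) + 1))) := by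
        rw [abs_of_nonneg (by positivity), sq]
        gcongr
      calc _ ≤ _ := abs_add_le _ _
        _ ≤ _ := add_le_add h1 h2
        _ = _ := by ring
  -- By $\cos\alpha\cos\beta=\frac12(\cos(\alpha+\beta)+\cos(\alpha-\beta))$, half the square of the
  -- sum of waves consists of oscillating terms and the diagonal difference terms, whose phase is
  -- zero. The latter give $\frac14\sum_i\varphi_i^2$, which is why $i=j$ is left out of `hminus`.
  have key := ((hlin.add (hplus.const_mul (1 / 4))).add (hminus.const_mul (1 / 4))).add hrem
  convert key using 4 with k t x
  set m := waveSum φ f ζ b k t x with hm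
  have e1 : ∑ i, φ i (t, x) * inner ℝ (V (t, x)) (f i) *
      Real.cos (((k : ℝ) + 1) * (inner ℝ (ζ i) x - b i * t)) = inner ℝ (V (t, x)) m := by
    rw [hm, waveSum, inner_sum]
    refine Finset.sum_congr rfl fun i _ => ?_
    rw [real_inner_smul_right]
    ring
  have e2 : (1 / 2) * ‖m‖ ^ 2 = (1 / 4) * ∑ i, φ i (t, x) ^ 2
      + (1 / 4) * (∑ i, ∑ j, (φ i (t, x) * φ j (t, x) * inner ℝ (f i) (f j)) *
        Real.cos (((k : ℝ) + 1) * (inner ℝ (ζ i + ζ j) x - (b i + b j) * t)))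
      + (1 / 4) * ∑ i, ∑ j, (if i = j then 0 else
      (φ i (t, x) * φ j (t, x) * inner ℝ (f i) (f j)) *
        Real.cos (((k : ℝ) + 1) * (inner ℝ (ζ i - ζ j) x - (b i - b j) * t))) := by
    have e3 : ∑ i, φ i (t, x) ^ 2
        = ∑ i, ∑ j, if i = j then φ i (t, x) * φ j (t, x) * inner ℝ (f i) (f j) else 0 := by
      refine Finset.sum_congr rfl fun i _ => ?_
      rw [Finset.sum_ite_eq Finset.univ i, if_pos (Finset.mem_univ i),
        real_inner_self_eq_norm_sq, hf]
      ring
    rw [← real_inner_self_eq_norm_sq, hm, waveSum, sum_inner, e3, Finset.mul_sum, Finset.mul_sum,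
      Finset.mul_sum, Finset.mul_sum, ← Finset.sum_add_distrib, ← Finset.sum_add_distrib]
    refine Finset.sum_congr rfl fun i _ => ?_
    rw [inner_sum, Finset.mul_sum, Finset.mul_sum, Finset.mul_sum, Finset.mul_sum,
      ← Finset.sum_add_distrib, ← Finset.sum_add_distrib]
    refine Finset.sum_congr rfl fun j _ => ?_
    rw [real_inner_smul_left, real_inner_smul_right]
    set α := ((k : ℝ) + 1) * (inner ℝ (ζ i) x - b i * t) with hα
    set β := ((k : ℝ) + 1) * (inner ℝ (ζ j) x - b j * t) with hβ
    have p1 : ((k : ℝ) + 1) * (inner ℝ (ζ i + ζ j) x - (b i + b j) * t) = α + β := by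
      rw [inner_add_left]; ring
    have p2 : ((k : ℝ) + 1) * (inner ℝ (ζ i - ζ j) x - (b i - b j) * t) = α - β := by
      rw [inner_sub_left]; ring
    rw [p1, p2]
    by_cases h : i = j
    · subst h
      simp only [if_true]
      rw [← hα] at hβ
      rw [hβ, Real.cos_add]
      have := Real.sin_sq_add_cos_sq α
      have e : Real.sin α * Real.sin α = 1 - Real.cos α * Real.cos α := by nlinarith
      rw [e]
      ring
    · simp only [h, if_false]
      rw [Real.cos_add, Real.cos_sub]
      ring
  have e3 : ‖w k t x‖ ^ 2 = ‖m‖ ^ 2 + 2 * inner ℝ m (w k t x - m) + ‖w k t x - m‖ ^ 2 := by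
    have := norm_add_sq_real m (w k t x - m)
    rwa [add_sub_cancel] at this
  rw [e1, e3, mul_add, mul_add, e2, inner_add_left, inner_sub_right (V (t, x))]
  ring

end WaveFamilies

/-! ### Openness, uniform stability and convexity of the admissible states. -/

section AdmissibleStates

open scoped Matrix

variable {n : ℕ}

theorem continuous_reynoldsForm : Continuous
    (fun z : (Sp n × (Fin n → Fin n → ℝ) × ℝ) × Sp n =>
      reynoldsForm z.1.1 (Matrix.of z.1.2.1) z.1.2.2 z.2) := by
  unfold reynoldsForm
  simp only [dotProduct, Matrix.mulVec, Matrix.of_apply]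
  fun_prop

theorem reynoldsForm_smul (v : Sp n) (u : Matrix (Fin n) (Fin n) ℝ) (E r : ℝ) (x : Sp n) :
    reynoldsForm v u E (r • x) = r ^ 2 * reynoldsForm v u E x := by
  simp only [reynoldsForm, norm_smul, WithLp.ofLp_smul, Matrix.mulVec_smul, smul_dotProduct,
    dotProduct_smul, smul_eq_mul, real_inner_smul_right, Real.norm_eq_abs, mul_pow, sq_abs]
  ring

theorem admissible_iff_sphere (v : Sp n) (u : Matrix (Fin n) (Fin n) ℝ) (E : ℝ) :
    Admissible v u E ↔ ∀ x ∈ Metric.sphere (0 : Sp n) 1, 0 < reynoldsForm v u E x := by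
  constructor
  · intro h x hx
    refine h x ?_
    rintro rfl
    simp at hx
  · intro h x hx
    have hx0 : 0 < ‖x‖ := norm_pos_iff.2 hx
    have h1 := h (‖x‖⁻¹ • x) (by simp [norm_smul, hx0.ne'])
    rw [reynoldsForm_smul] at h1
    exact pos_of_mul_pos_right h1 (by positivity)

/-- By homogeneity, positivity needs checking only on the unit sphere, and compactness of the sphere
makes it stable under small changes of the state. -/
theorem isOpen_admissible : IsOpen
    {z : Sp n × (Fin n → Fin n → ℝ) × ℝ | Admissible z.1 (Matrix.of z.2.1) z.2.2} := by
  rw [isOpen_iff_mem_nhds]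
  intro z hz
  have hz' := (admissible_iff_sphere _ _ _).1 hz
  have := (isCompact_sphere (0 : Sp n) 1).eventually_forall_of_forall_eventually (x₀ := z)
    (P := fun z x => 0 < reynoldsForm z.1 (Matrix.of z.2.1) z.2.2 x)
    fun x hx => continuous_reynoldsForm.continuousAt.eventually (lt_mem_nhds (hz' x hx))
  filter_upwards [this] with y hy
  exact (admissible_iff_sphere _ _ _).2 hy

/-- One margin for a whole compact set of states absorbs the $O(1/K)$ errors of the localized waves
at all points at once. -/
theorem exists_admissible_perturbation {A : Set (Sp n × (Fin n → Fin n → ℝ) × ℝ)}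
    (hA : IsCompact A) (h : ∀ z ∈ A, Admissible z.1 (Matrix.of z.2.1) z.2.2) :
    ∃ δ > 0, ∀ z ∈ A, ∀ (v : Sp n) (u : Matrix (Fin n) (Fin n) ℝ), ‖v - z.1‖ ≤ δ →
      (∀ i j, |u i j - z.2.1 i j| ≤ δ) → Admissible v u z.2.2 := by
  obtain ⟨δ, hδ, hsub⟩ := hA.exists_thickening_subset_open isOpen_admissible h
  refine ⟨δ / 2, half_pos hδ, fun z hz v u hv hu => ?_⟩
  have hmem : (v, (fun i j => u i j, z.2.2)) ∈ Metric.thickening δ A := by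
    rw [Metric.mem_thickening_iff]
    refine ⟨z, hz, ?_⟩
    rw [Prod.dist_eq, Prod.dist_eq]
    refine max_lt ?_ (max_lt ?_ ?_)
    · rw [dist_eq_norm]
      linarith
    · refine lt_of_le_of_lt ?_ (half_lt_self hδ)
      refine (dist_pi_le_iff (half_pos hδ).le).2 fun i =>
        (dist_pi_le_iff (half_pos hδ).le).2 fun j => ?_
      rw [Real.dist_eq]
      exact hu i j
    · simpa using hδ
  exact hsub hmem

/-- Admissible states form a convex set. -/
theorem admissible_convex {ι : Type*} [Fintype ι] {v : Sp n} {u : Matrix (Fin n) (Fin n) ℝ} {E : ℝ}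
    (h0 : Admissible v u E) {p : ι → Sp n} {q : ι → Matrix (Fin n) (Fin n) ℝ} {a : ι → ℝ}
    (ha : ∀ i, 0 ≤ a i) (ha1 : ∑ i, a i < 1)
    (h : ∀ i, a i ≠ 0 → Admissible (v + p i) (u + q i) E) :
    Admissible (v + ∑ i, a i • p i) (u + ∑ i, a i • q i) E := by
  intro x hx
  set B : ℝ := x.ofLp ⬝ᵥ (u *ᵥ x.ofLp) with hB
  set b : ι → ℝ := fun i => x.ofLp ⬝ᵥ (q i *ᵥ x.ofLp) with hb
  set c : ι → ℝ := fun i => inner ℝ (p i) x with hc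
  obtain ⟨s, hs⟩ : ∃ s : ℝ, s = ∑ i, a i * c i := ⟨_, rfl⟩
  have e0 : reynoldsForm v u E x = 2 * E / n * ‖x‖ ^ 2 + B - inner ℝ v x ^ 2 := rfl
  have ei : ∀ i, reynoldsForm (v + p i) (u + q i) E x
      = 2 * E / n * ‖x‖ ^ 2 + (B + b i) - (inner ℝ v x + c i) ^ 2 := by
    intro i
    rw [reynoldsForm, Matrix.add_mulVec, dotProduct_add, inner_add_left]
  have e1 : reynoldsForm (v + ∑ i, a i • p i) (u + ∑ i, a i • q i) E x
      = 2 * E / n * ‖x‖ ^ 2 + (B + ∑ i, a i * b i) - (inner ℝ v x + s) ^ 2 := by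
    rw [reynoldsForm, Matrix.add_mulVec, dotProduct_add, inner_add_left, sum_inner,
      Matrix.sum_mulVec, dotProduct_sum]
    simp only [Matrix.smul_mulVec, dotProduct_smul, smul_eq_mul, real_inner_smul_left, hs]
    rfl
  have hpos := h0 x hx
  -- Summands of weight zero need not be admissible. In the application the weights are bumps, and a
  -- segment is admissible only on the support of its bump.
  have hterm : ∀ i, 0 ≤ a i * reynoldsForm (v + p i) (u + q i) E x := by
    intro i
    by_cases hi : a i = 0
    · simp [hi]
    · exact mul_nonneg (ha i) (h i hi x hx).le
  have hsum := Finset.sum_nonneg fun i (_ : i ∈ Finset.univ) => hterm i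
  -- Jensen's inequality for weights of total mass below $1$: the form is affine in $u$ and concave
  -- in $v$.
  have hcs : s ^ 2 ≤ ∑ i, a i * c i ^ 2 := by
    have h1 : 0 ≤ ∑ i, a i * (c i - s) ^ 2 :=
      Finset.sum_nonneg fun i _ => mul_nonneg (ha i) (sq_nonneg _)
    have h2 : ∑ i, a i * (c i - s) ^ 2 = ∑ i, a i * c i ^ 2 - 2 * s * (∑ i, a i * c i)
        + s ^ 2 * ∑ i, a i := by
      rw [Finset.mul_sum, Finset.mul_sum, ← Finset.sum_sub_distrib, ← Finset.sum_add_distrib]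
      refine Finset.sum_congr rfl fun i _ => ?_
      ring
    rw [← hs] at h2
    nlinarith [sq_nonneg s]
  have hexp : ∑ i, a i * reynoldsForm (v + p i) (u + q i) E x
      = (∑ i, a i) * reynoldsForm v u E x + ∑ i, a i * b i - 2 * inner ℝ v x * s
        - ∑ i, a i * c i ^ 2 := by
    rw [hs, Finset.sum_mul, Finset.mul_sum, ← Finset.sum_add_distrib, ← Finset.sum_sub_distrib,
      ← Finset.sum_sub_distrib]
    refine Finset.sum_congr rfl fun i _ => ?_
    rw [ei, e0]
    ring
  rw [e1]
  rw [hexp] at hsum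
  -- The unused weight $1-\sum a_i$ stays at the base state and makes the inequality strict.
  have h3 : 0 < (1 - ∑ i, a i) * reynoldsForm v u E x := mul_pos (by linarith) hpos
  rw [e0] at h3 hsum
  nlinarith

end AdmissibleStates

/-! ### Adding a compactly supported perturbation to a subsolution. -/

section Subsolutions

variable {n : ℕ}

theorem integrable_inner_of_memLp {v φ : Sp n → Sp n} (hv : MemLp v 2 volume)
    (hφ : MemLp φ 2 volume) : Integrable (fun x => (inner ℝ (v x) (φ x) : ℝ)) := by
  refine Integrable.mono' (hv.norm.integrable_mul hφ.norm)
    (hv.aestronglyMeasurable.inner hφ.aestronglyMeasurable) (Eventually.of_forall fun x => ?_)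
  simpa using norm_inner_le_norm (𝕜 := ℝ) (v x) (φ x)

theorem memLp_of_continuous_of_eq_zero {F : Sp n → Sp n} (hF : Continuous F) {R : ℝ}
    (hR : ∀ x, R < ‖x‖ → F x = 0) : MemLp F 2 volume :=
  hF.memLp_of_hasCompactSupport <|
    HasCompactSupport.intro (isCompact_closedBall (0 : Sp n) R) fun x hx => hR x (by
      simpa using hx)

theorem SmoothVec.differentiableAt {T : ℝ} {v : VField n} (hv : SmoothVec T v) {t : ℝ}
    (ht : t ∈ Ioo 0 T) (x : Sp n) (i : Fin n) :
    DifferentiableAt ℝ (fun p : ℝ × Sp n => v p.1 p.2 i) (t, x) := by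
  have h1 : ContDiffAt ℝ ∞ (fun p : ℝ × Sp n => v p.1 p.2) (t, x) :=
    hv.contDiffAt ((isOpen_Ioo.prod isOpen_univ).mem_nhds ⟨ht, mem_univ x⟩)
  exact ((contDiffAt_euclidean.1 h1) i).differentiableAt (by simp)

theorem differentiableAt_slice_right {F : ℝ × Sp n → ℝ} {t : ℝ} {x : Sp n}
    (hF : DifferentiableAt ℝ F (t, x)) : DifferentiableAt ℝ (fun y => F (t, y)) x :=
  DifferentiableAt.comp x hF ((differentiableAt_const t).prodMk differentiableAt_id)

theorem differentiableAt_slice_left {F : ℝ × Sp n → ℝ} {t : ℝ} {x : Sp n}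
    (hF : DifferentiableAt ℝ F (t, x)) : DifferentiableAt ℝ (fun s => F (s, x)) t :=
  DifferentiableAt.comp t hF (differentiableAt_id.prodMk (differentiableAt_const x))

theorem SuppIn.add {F : Type*} [AddZeroClass F] {f g : Sp n → F} {Ω : Set (Sp n)}
    (hf : SuppIn f Ω) (hg : SuppIn g Ω) : SuppIn (f + g) Ω := by
  have h : tsupport (f + g) ⊆ tsupport f ∪ tsupport g := by
    rw [tsupport, tsupport, tsupport, ← closure_union]
    exact closure_mono (Function.support_add f g)
  exact ⟨(hf.1.union hg.1).of_isClosed_subset (isClosed_tsupport _) h,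
    h.trans (union_subset hf.2 hg.2)⟩

theorem suppIn_of_eq_zero {F : Type*} [Zero F] {f : Sp n → F} {Ω : Set (Sp n)} {T t : ℝ}
    {K : Set (ℝ × Sp n)} (hK : IsCompact K) (hKΩ : K ⊆ Ioo 0 T ×ˢ Ω)
    (h : ∀ x, (t, x) ∉ K → f x = 0) : SuppIn f Ω := by
  have hc : IsCompact (Prod.snd '' (K ∩ {p | p.1 = t})) :=
    (hK.inter_right (isClosed_eq continuous_fst continuous_const)).image continuous_snd
  have hs : tsupport f ⊆ Prod.snd '' (K ∩ {p | p.1 = t}) := by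
    refine closure_minimal (fun x hx => ?_) hc.isClosed
    refine ⟨(t, x), ⟨?_, rfl⟩, rfl⟩
    by_contra hx'
    exact hx (h x hx')
  refine ⟨hc.of_isClosed_subset (isClosed_tsupport _) hs, hs.trans ?_⟩
  rintro _ ⟨p, hp, rfl⟩
  exact (hKΩ hp.1).2

/-- The pairing of $w$ with a test function is continuous in time by dominated convergence: $w$ is
bounded, vanishes outside a fixed ball, and the test function is integrable on that ball. -/
theorem memCL2w_add_of_compactSupport {T : ℝ} {v w : VField n} (hv : MemCL2w T v)
    {K : Set (ℝ × Sp n)} (hK : IsCompact K) (hw : Continuous (fun p : ℝ × Sp n => w p.1 p.2))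
    (hz : ∀ t x, (t, x) ∉ K → w t x = 0) : MemCL2w T (v + w) := by
  obtain ⟨R, -, hR⟩ := exists_radius hK
  have hwR : ∀ t x, R < ‖x‖ → w t x = 0 := fun t x hx => hz t x (hR t x hx)
  have hwc : ∀ t, Continuous (w t) := fun t => hw.comp (Continuous.prodMk_right t)
  have hwL : ∀ t, MemLp (w t) 2 volume := fun t =>
    memLp_of_continuous_of_eq_zero (hwc t) (hwR t)
  refine ⟨fun t ht => (hv.1 t ht).add (hwL t), fun φ hφ => ?_⟩
  have h1 : Continuous (fun t => ∫ x, inner ℝ (w t x) (φ x)) := by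
    obtain ⟨B, hB⟩ := hw.bounded_above_of_compact_support
      (HasCompactSupport.intro hK fun p hp => hz p.1 p.2 hp)
    have hφb : Integrable ((Metric.closedBall (0 : Sp n) R).indicator φ) := by
      refine IntegrableOn.integrable_indicator ?_ measurableSet_closedBall
      exact (hφ.locallyIntegrable (by norm_num)).integrableOn_isCompact (isCompact_closedBall _ _)
    refine continuous_of_dominated
      (bound := fun x => B * ‖(Metric.closedBall (0 : Sp n) R).indicator φ x‖)
      (fun t => (hwc t).aestronglyMeasurable.inner hφ.aestronglyMeasurable)
      (fun t => Eventually.of_forall fun x => ?_) (hφb.norm.const_mul B)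
      (Eventually.of_forall fun x => ?_)
    · by_cases hx : x ∈ Metric.closedBall (0 : Sp n) R
      · rw [indicator_of_mem hx]
        exact (norm_inner_le_norm _ _).trans
          (mul_le_mul_of_nonneg_right (hB (t, x)) (norm_nonneg _))
      · rw [hwR t x (by simpa using hx), inner_zero_left, norm_zero,
          indicator_of_notMem hx, norm_zero, mul_zero]
    · exact (hw.comp (Continuous.prodMk_left x)).inner continuous_const
  refine ((hv.2 φ hφ).add h1.continuousOn).congr fun t ht => ?_
  simp only [Pi.add_apply, inner_add_left]
  exact integral_add (integrable_inner_of_memLp (hv.1 t ht) hφ)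
    (integrable_inner_of_memLp (hwL t) hφ)

/-- Adding a perturbation that stays admissible gives another subsolution. -/
theorem add_perturbation_mem_X0 (hn : 0 < n) {T : ℝ} {Ω : Set (Sp n)} {ebar : SField n}
    {v₀ : VField n} {q₀ : SField n} {v w : VField n} {u U : MField n}
    (hv : IsSubsolution T Ω ebar v₀ q₀ v) (hu : SmoothMat T u)
    (hen : ∀ t ∈ Ioo 0 T, ∀ x ∈ Ω, genEnergy (v t x) (u t x) < ebar t x)
    (hus : ∀ t ∈ Ioo 0 T, SuppIn (u t) Ω) (hmom : MomentumEq T v u q₀)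
    {K : Set (ℝ × Sp n)} (hK : IsCompact K) (hKΩ : K ⊆ Ioo 0 T ×ˢ Ω) (hw : IsPerturbation K w U)
    (hadm : ∀ p ∈ K, Admissible (v p.1 p.2 + w p.1 p.2) (u p.1 p.2 + U p.1 p.2) (ebar p.1 p.2)) :
    v + w ∈ X0 T Ω ebar v₀ q₀ := by
  -- The support lies strictly inside the time interval, so the values at times $0$ and $T$ are
  -- untouched.
  have hzero : ∀ t ∉ Ioo 0 T, ∀ x, w t x = 0 := fun t ht x =>
    (hw.eq_zero t x fun h => ht (hKΩ h).1).1
  have hT : ∀ t, t ∉ Ioo 0 T → (v + w) t = v t := by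
    intro t ht
    ext1 x
    simp [hzero t ht x]
  refine
    { smooth := hv.smooth.add hw.smooth_v.contDiffOn
      L2w := memCL2w_add_of_compactSupport hv.L2w hK hw.smooth_v.continuous
        fun t x h => (hw.eq_zero t x h).1
      div_free := fun t ht x => ?_
      initial := by rw [hT 0 (by simp)]; exact hv.initial
      terminal := by rw [hT T (by simp)]; exact hv.terminal
      supp := fun t ht => (hv.supp t ht).add
        (suppIn_of_eq_zero hK hKΩ fun x h => (hw.eq_zero t x h).1)
      exists_matrix := ⟨u + U, ⟨fun i j => (hu.1 i j).add (hw.smooth_u i j).contDiffOn,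
        fun t ht x => symTraceless_add (hu.2 t ht x) (hw.mem t x)⟩, fun t ht x hx => ?_,
        fun t ht => (hus t ht).add (suppIn_of_eq_zero hK hKΩ fun x h => (hw.eq_zero t x h).2),
        fun t ht x i => ?_⟩ }
  · have key : ∀ i, pderiv i (fun y => (v + w) t y i) x
        = pderiv i (fun y => v t y i) x + pderiv i (fun y => w t y i) x := fun i =>
      pderiv_add (differentiableAt_slice_right (hv.smooth.differentiableAt ht x i))
        (differentiable_slice_right (differentiable_coord hw.smooth_v i) t x) i
    simp only [key, Finset.sum_add_distrib, hw.div_free, hv.div_free t ht x, add_zero]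
  · have hsym : (u t x + U t x).IsSymm := (hu.2 t ht x).1.add (hw.mem t x).1
    by_cases hKx : (t, x) ∈ K
    · exact (genEnergy_lt_iff hn hsym _).2 (hadm (t, x) hKx)
    · obtain ⟨h1, h2⟩ := hw.eq_zero t x hKx
      simp only [Pi.add_apply, h1, h2, add_zero]
      exact hen t ht x hx
  · have du : ∀ j, DifferentiableAt ℝ (fun p : ℝ × Sp n => u p.1 p.2 i j) (t, x) := fun j =>
      ((hu.1 i j).contDiffAt ((isOpen_Ioo.prod isOpen_univ).mem_nhds
        ⟨ht, mem_univ x⟩)).differentiableAt (by simp)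
    have key : ∀ j, pderiv j (fun y => (u + U) t y i j) x
        = pderiv j (fun y => u t y i j) x + pderiv j (fun y => U t y i j) x := fun j =>
      pderiv_add (differentiableAt_slice_right (du j))
        (differentiable_slice_right (differentiable_of_smooth (hw.smooth_u i j)) t x) j
    have key' : deriv (fun s => (v + w) s x i) t
        = deriv (fun s => v s x i) t + deriv (fun s => w s x i) t :=
      deriv_add (differentiableAt_slice_left (hv.smooth.differentiableAt ht x i))
        (differentiable_slice_left (differentiable_coord hw.smooth_v i) x t)
    simp only [key, key', Finset.sum_add_distrib]
    linarith [hmom t ht x i, hw.momentum t x i]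

end Subsolutions

/-! ### Covers by small bumps with overlap bounded in terms of the dimension. -/

section GridCover

/-- A fixed bump function on the line, equal to `1` on `[-1/2, 1/2]` and supported in
`[-1, 1]`. -/
noncomputable def lineBump : ContDiffBump (0 : ℝ) := ⟨1 / 2, 1, by norm_num, by norm_num⟩

theorem lineBump_eq_zero {s : ℝ} (hs : 1 ≤ |s|) : lineBump s = 0 :=
  lineBump.zero_of_le_dist (by simpa [lineBump] using hs)

theorem lineBump_eq_one {s : ℝ} (hs : |s| ≤ 1 / 2) : lineBump s = 1 :=
  lineBump.one_of_mem_closedBall (by simpa [lineBump] using hs)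

/-- Only the integers $\lfloor s\rfloor$ and $\lfloor s\rfloor+1$ can lie at distance less than $1$
from $s$. -/
theorem sum_lineBump_le (I : Finset ℤ) (s : ℝ) : ∑ m ∈ I, lineBump (s - m) ≤ 2 := by
  have h1 : ∑ m ∈ I, lineBump (s - m) = ∑ m ∈ I ∩ {⌊s⌋, ⌊s⌋ + 1}, lineBump (s - m) := by
    refine (Finset.sum_subset Finset.inter_subset_left fun m hm hm' => ?_).symm
    apply lineBump_eq_zero
    by_contra hlt
    rw [not_le, abs_lt] at hlt
    apply hm'
    rw [Finset.mem_inter]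
    refine ⟨hm, ?_⟩
    have h2 : ⌊s⌋ ≤ m := by
      have : (⌊s⌋ : ℝ) < (m : ℝ) + 1 := by linarith [Int.floor_le s]
      exact_mod_cast Int.lt_add_one_iff.1 (by exact_mod_cast this)
    have h3 : m ≤ ⌊s⌋ + 1 := by
      have : (m : ℝ) < (⌊s⌋ : ℝ) + 1 + 1 := by linarith [Int.lt_floor_add_one s]
      exact_mod_cast Int.lt_add_one_iff.1 (by exact_mod_cast this)
    simp only [Finset.mem_insert, Finset.mem_singleton]
    omega
  rw [h1]
  calc ∑ m ∈ I ∩ {⌊s⌋, ⌊s⌋ + 1}, lineBump (s - m)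
      ≤ ∑ m ∈ I ∩ {⌊s⌋, ⌊s⌋ + 1}, (1 : ℝ) := Finset.sum_le_sum fun m _ => lineBump.le_one
    _ = ((I ∩ {⌊s⌋, ⌊s⌋ + 1}).card : ℝ) := by simp
    _ ≤ 2 := by
      have : (I ∩ {⌊s⌋, ⌊s⌋ + 1}).card ≤ 2 :=
        (Finset.card_le_card Finset.inter_subset_right).trans Finset.card_le_two
      exact_mod_cast this

/-- The integer nearest to $s$ already contributes $1$; the margin in the bound on $|s|$ keeps it in
the index range. -/
theorem one_le_sum_lineBump_sq {R : ℤ} {s : ℝ} (hs : |s| ≤ R - 1) :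
    1 ≤ ∑ m ∈ Finset.Icc (-R) R, lineBump (s - m) ^ 2 := by
  have h1 := abs_sub_round s
  have hmem : round s ∈ Finset.Icc (-R) R := by
    have h2 := abs_le.1 h1
    have h3 := abs_le.1 hs
    rw [Finset.mem_Icc]
    constructor
    · have : (-R : ℝ) ≤ round s := by linarith
      exact_mod_cast this
    · have : (round s : ℝ) ≤ R := by linarith
      exact_mod_cast this
  have h4 : lineBump (s - round s) ^ 2 = 1 := by
    rw [lineBump_eq_one h1, one_pow]
  rw [← h4]
  exact Finset.single_le_sum (f := fun m : ℤ => lineBump (s - m) ^ 2)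
    (fun m _ => sq_nonneg _) hmem

variable {n : ℕ}

/-- The coordinates of a point in space-time. -/
noncomputable def coordST (i : Option (Fin n)) : ℝ × Sp n →L[ℝ] ℝ :=
  match i with
  | none => ContinuousLinearMap.fst ℝ ℝ (Sp n)
  | some j => (EuclideanSpace.proj j).comp (ContinuousLinearMap.snd ℝ ℝ (Sp n))

theorem abs_coordST_le (i : Option (Fin n)) (p : ℝ × Sp n) : |coordST i p| ≤ ‖p‖ := by
  cases i with
  | none => exact norm_fst_le p
  | some j => exact (PiLp.norm_apply_le p.2 j).trans (norm_snd_le p)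

theorem norm_le_of_coordST {p : ℝ × Sp n} {r : ℝ} (hr : ∀ i, |coordST i p| ≤ r) :
    ‖p‖ ≤ ((n : ℝ) + 1) * r := by
  have hr0 : 0 ≤ r := (abs_nonneg _).trans (hr none)
  refine max_le ?_ ?_
  · have := hr none
    have h1 : ‖p.1‖ ≤ r := this
    nlinarith [Nat.cast_nonneg (α := ℝ) n]
  · have h1 := (EuclideanSpace.basisFun (Fin n) ℝ).sum_repr p.2
    rw [← h1]
    refine (norm_sum_le _ _).trans ?_
    have h2 : ∀ j, ‖(EuclideanSpace.basisFun (Fin n) ℝ).repr p.2 j •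
        (EuclideanSpace.basisFun (Fin n) ℝ) j‖ ≤ r := by
      intro j
      rw [norm_smul, (EuclideanSpace.basisFun (Fin n) ℝ).norm_eq_one, mul_one]
      exact hr (some j)
    refine (Finset.sum_le_sum fun j _ => h2 j).trans ?_
    simp
    nlinarith

/-- The bump function of the cell with index `g` in the grid of mesh size `h`. -/
noncomputable def gridBump (h : ℝ) (g : Option (Fin n) → ℤ) : ℝ × Sp n → ℝ := fun p =>
  ∏ i, lineBump (coordST i p / h - g i)

theorem contDiff_gridBump (h : ℝ) (g : Option (Fin n) → ℤ) : ContDiff ℝ ∞ (gridBump h g) := by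
  unfold gridBump
  refine contDiff_prod fun i _ => lineBump.contDiff.comp ?_
  exact ((coordST i).contDiff.div_const h).sub contDiff_const

theorem gridBump_nonneg (h : ℝ) (g : Option (Fin n) → ℤ) (p : ℝ × Sp n) : 0 ≤ gridBump h g p :=
  Finset.prod_nonneg fun _ _ => lineBump.nonneg

theorem abs_le_of_mem_tsupport_gridBump {h : ℝ} {g : Option (Fin n) → ℤ} {p : ℝ × Sp n}
    (hp : p ∈ tsupport (gridBump h g)) (i : Option (Fin n)) : |coordST i p / h - g i| ≤ 1 := by
  have hcl : IsClosed {p : ℝ × Sp n | ∀ i, |coordST i p / h - g i| ≤ 1} := by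
    simp only [Set.ofPred_forall]
    exact isClosed_iInter fun i => isClosed_le
      ((((coordST i).continuous.div_const h).sub continuous_const).abs) continuous_const
  refine closure_minimal (fun q hq => ?_) hcl hp i
  intro j
  by_contra hlt
  apply hq
  exact Finset.prod_eq_zero (Finset.mem_univ j) (lineBump_eq_zero (not_le.1 hlt).le)

theorem dist_le_of_mem_tsupport_gridBump {h : ℝ} (hh : 0 < h) {g : Option (Fin n) → ℤ}
    {p q : ℝ × Sp n} (hp : p ∈ tsupport (gridBump h g)) (hq : q ∈ tsupport (gridBump h g)) :
    dist p q ≤ ((n : ℝ) + 1) * (2 * h) := by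
  rw [dist_eq_norm]
  refine norm_le_of_coordST fun i => ?_
  have h1 := abs_le.1 (abs_le_of_mem_tsupport_gridBump hp i)
  have h2 := abs_le.1 (abs_le_of_mem_tsupport_gridBump hq i)
  have h3 : coordST i (p - q) = (coordST i p / h - coordST i q / h) * h := by
    rw [map_sub]
    field_simp
  rw [h3, abs_mul, abs_of_pos hh]
  refine mul_le_mul_of_nonneg_right (abs_le.2 ⟨by linarith, by linarith⟩) hh.le

theorem hasCompactSupport_gridBump {h : ℝ} (hh : 0 < h) (g : Option (Fin n) → ℤ) :
    HasCompactSupport (gridBump h g) := by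
  refine Metric.isCompact_of_isClosed_isBounded (isClosed_tsupport _) ?_
  exact Metric.isBounded_iff.2 ⟨_, fun p hp q hq => dist_le_of_mem_tsupport_gridBump hh hp hq⟩

/-- The sum over the grid factors into $n+1$ one-dimensional sums, each at most $2$. The bound does
not see the mesh size, which keeps the final gain independent of the cover. -/
theorem sum_gridBump_le (h : ℝ) (I : Finset ℤ) (p : ℝ × Sp n) :
    ∑ g ∈ Fintype.piFinset fun _ => I, gridBump h g p ≤ 2 ^ (n + 1) := by
  calc ∑ g ∈ Fintype.piFinset fun _ => I, gridBump h g p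
      = ∏ i : Option (Fin n), ∑ m ∈ I, lineBump (coordST i p / h - m) :=
        (Finset.prod_univ_sum (fun _ => I)
          fun i (m : ℤ) => lineBump (coordST i p / h - (m : ℝ))).symm
    _ ≤ ∏ _i : Option (Fin n), (2 : ℝ) :=
        Finset.prod_le_prod (fun i _ => Finset.sum_nonneg fun _ _ => lineBump.nonneg)
          fun i _ => sum_lineBump_le _ _
    _ = 2 ^ (n + 1) := by simp

theorem one_le_sum_gridBump_sq {h : ℝ} (hh : 0 < h) {R : ℤ} {p : ℝ × Sp n}
    (hp : ‖p‖ / h ≤ R - 1) :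
    1 ≤ ∑ g ∈ Fintype.piFinset fun _ => Finset.Icc (-R) R, gridBump h g p ^ 2 := by
  calc (1 : ℝ) = ∏ _i : Option (Fin n), (1 : ℝ) := by simp
    _ ≤ ∏ i : Option (Fin n), ∑ m ∈ Finset.Icc (-R) R, lineBump (coordST i p / h - m) ^ 2 := by
        refine Finset.prod_le_prod (fun _ _ => zero_le_one) fun i _ => ?_
        apply one_le_sum_lineBump_sq
        rw [abs_div, abs_of_pos hh]
        refine le_trans ?_ hp
        gcongr
        exact abs_coordST_le i p
    _ = ∑ g ∈ Fintype.piFinset fun _ => Finset.Icc (-R) R, gridBump h g p ^ 2 := by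
        rw [Finset.prod_univ_sum (fun _ => Finset.Icc (-R) R)
          fun i (m : ℤ) => lineBump (coordST i p / h - (m : ℝ)) ^ 2]
        refine Finset.sum_congr rfl fun g _ => ?_
        rw [gridBump, Finset.prod_pow]

/-- A compact set in space-time is covered by small bumps with bounded overlap. -/
theorem exists_bump_cover {K : Set (ℝ × Sp n)} (hK : IsCompact K) {δ : ℝ} (hδ : 0 < δ) :
    ∃ (S : Finset (Option (Fin n) → ℤ)) (η : (Option (Fin n) → ℤ) → ℝ × Sp n → ℝ),
      (∀ i, ContDiff ℝ ∞ (η i)) ∧ (∀ i, HasCompactSupport (η i)) ∧ (∀ i p, 0 ≤ η i p) ∧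
      (∀ p, ∑ i ∈ S, η i p ≤ 2 ^ (n + 1)) ∧ (∀ p ∈ K, 1 ≤ ∑ i ∈ S, η i p ^ 2) ∧
      ∀ i ∈ S, ∃ q ∈ K, tsupport (η i) ⊆ Metric.ball q δ := by
  classical
  obtain ⟨B, hB⟩ := hK.isBounded.exists_norm_le
  obtain ⟨h, hh⟩ : ∃ h : ℝ, h = δ / (4 * ((n : ℝ) + 1)) := ⟨_, rfl⟩
  have hh0 : 0 < h := by rw [hh]; positivity
  obtain ⟨R, hR⟩ : ∃ R : ℤ, R = ⌈B / h⌉ + 1 := ⟨_, rfl⟩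
  refine ⟨(Fintype.piFinset fun _ => Finset.Icc (-R) R).filter
    fun g => ∃ p ∈ K, gridBump h g p ≠ 0, gridBump h, contDiff_gridBump h,
    hasCompactSupport_gridBump hh0, gridBump_nonneg h, fun p => ?_, fun p hp => ?_,
    fun g hg => ?_⟩
  · exact (Finset.sum_le_sum_of_subset_of_nonneg (Finset.filter_subset _ _)
      fun g _ _ => gridBump_nonneg h g p).trans (sum_gridBump_le h _ p)
  · rw [Finset.sum_subset (Finset.filter_subset _ _) fun g hg hg' => ?_]
    · refine one_le_sum_gridBump_sq hh0 ?_
      rw [hR]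
      push_cast
      have h1 : ‖p‖ / h ≤ B / h := by
        gcongr
        exact hB p hp
      linarith [Int.le_ceil (B / h)]
    · have : gridBump h g p = 0 := by
        by_contra hne
        exact hg' (Finset.mem_filter.2 ⟨hg, p, hp, hne⟩)
      rw [this, zero_pow two_ne_zero]
  · obtain ⟨q, hq, hne⟩ := (Finset.mem_filter.1 hg).2
    refine ⟨q, hq, fun p hp => ?_⟩
    rw [Metric.mem_ball]
    refine (dist_le_of_mem_tsupport_gridBump hh0 hp (subset_tsupport _ hne)).trans_lt ?_
    have : ((n : ℝ) + 1) * (2 * h) = δ / 2 := by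
      rw [hh]
      field_simp
      norm_num
    linarith

theorem exists_bump_family {K : Set (ℝ × Sp n)} (hK : IsCompact K) {δ : ℝ} (hδ : 0 < δ) :
    ∃ (ι : Type) (_ : Fintype ι) (η : ι → ℝ × Sp n → ℝ),
      (∀ i, ContDiff ℝ ∞ (η i)) ∧ (∀ i, HasCompactSupport (η i)) ∧ (∀ i p, 0 ≤ η i p) ∧
      (∀ p, ∑ i, η i p ≤ 2 ^ (n + 1)) ∧ (∀ p ∈ K, 1 ≤ ∑ i, η i p ^ 2) ∧
      ∀ i, ∃ q ∈ K, tsupport (η i) ⊆ Metric.ball q δ := by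
  obtain ⟨S, η, h1, h2, h3, h4, h5, h6⟩ := exists_bump_cover hK hδ
  refine ⟨S, inferInstance, fun i => η i, fun i => h1 i, fun i => h2 i, fun i => h3 i,
    fun p => ?_, fun p hp => ?_, fun i => h6 i i.2⟩
  · rw [Finset.sum_coe_sort S fun i => η i p]
    exact h4 p
  · rw [Finset.sum_coe_sort S fun i => η i p ^ 2]
    exact h5 p hp

end GridCover

/-! ### Patching local segments into an oscillating sequence with an energy gain. -/

section PerturbationSequence

variable {n : ℕ}

/-- Segments of admissible states in the direction of a fixed shear flow, near a point of
space-time. -/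
theorem exists_local_segment (hn : 2 ≤ n) {v : VField n} {u : MField n} {e : SField n}
    {q : ℝ × Sp n} (hv : ContinuousAt (fun p : ℝ × Sp n => v p.1 p.2) q)
    (hu : ∀ i j, ContinuousAt (fun p : ℝ × Sp n => u p.1 p.2 i j) q)
    (he : ContinuousAt (fun p : ℝ × Sp n => e p.1 p.2) q) (hq : u q.1 q.2 ∈ symTraceless n)
    (hadm : Admissible (v q.1 q.2) (u q.1 q.2) (e q.1 q.2)) {M : ℝ} (heM : e q.1 q.2 ≤ M) :
    ∃ (f ξ : Sp n) (c γ : ℝ), ‖f‖ = 1 ∧ ‖ξ‖ = 1 ∧ inner ℝ f ξ = 0 ∧ ∀ᶠ p in 𝓝 q,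
      (∀ s ∈ Icc (-1 : ℝ) 1, Admissible (v p.1 p.2 + (s * γ) • f)
        (u p.1 p.2 + (s * (γ * c)) • symProd f ξ) (e p.1 p.2)) ∧
      (e p.1 p.2 - (1 / 2) * ‖v p.1 p.2‖ ^ 2) ^ 2 ≤ 16 * (n : ℝ) ^ 2 * M * γ ^ 2 := by
  obtain ⟨hD, f, ξ, c, γ, hf, hξ, hfξ, hγ, hseg⟩ := exists_shear_segment hn hq hadm
  refine ⟨f, ξ, c, γ, hf, hξ, hfξ, Filter.Eventually.and ?_ ?_⟩
  · refine isCompact_Icc.eventually_forall_of_forall_eventually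
      (P := fun (p : ℝ × Sp n) (s : ℝ) => Admissible (v p.1 p.2 + (s * γ) • f)
        (u p.1 p.2 + (s * (γ * c)) • symProd f ξ) (e p.1 p.2)) fun s hs => ?_
    have hc : ContinuousAt (fun z : (ℝ × Sp n) × ℝ => ((v z.1.1 z.1.2 + (z.2 * γ) • f,
        ((fun i j => u z.1.1 z.1.2 i j + (z.2 * (γ * c)) * symProd f ξ i j), e z.1.1 z.1.2)) :
        Sp n × (Fin n → Fin n → ℝ) × ℝ)) (q, s) := by
      have h1 : ContinuousAt (fun z : (ℝ × Sp n) × ℝ => v z.1.1 z.1.2) (q, s) :=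
        ContinuousAt.comp (f := Prod.fst) (x := (q, s)) hv continuousAt_fst
      have h2 : ∀ i j, ContinuousAt (fun z : (ℝ × Sp n) × ℝ => u z.1.1 z.1.2 i j) (q, s) :=
        fun i j => ContinuousAt.comp (f := Prod.fst) (x := (q, s)) (hu i j) continuousAt_fst
      have h3 : ContinuousAt (fun z : (ℝ × Sp n) × ℝ => e z.1.1 z.1.2) (q, s) :=
        ContinuousAt.comp (f := Prod.fst) (x := (q, s)) he continuousAt_fst
      refine ContinuousAt.prodMk (h1.add ?_) (ContinuousAt.prodMk ?_ h3)
      · exact (continuousAt_snd.mul continuousAt_const).smul continuousAt_const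
      · refine continuousAt_pi.2 fun i => continuousAt_pi.2 fun j => (h2 i j).add ?_
        exact (continuousAt_snd.mul continuousAt_const).mul continuousAt_const
    exact hc.eventually (isOpen_admissible.mem_nhds (hseg s hs))
  · have hc : ContinuousAt (fun p : ℝ × Sp n => (e p.1 p.2 - (1 / 2) * ‖v p.1 p.2‖ ^ 2) ^ 2) q :=
      (he.sub (continuousAt_const.mul (hv.norm.pow 2))).pow 2
    have h1 : (e q.1 q.2 - (1 / 2) * ‖v q.1 q.2‖ ^ 2) ^ 2 ≤ 8 * (n : ℝ) ^ 2 * M * γ ^ 2 := by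
      refine hγ.trans ?_
      gcongr
    -- The deficit at $q$ is positive, so doubling the constant from $8$ to $16$ makes the bound
    -- strict, and it persists near $q$ with the same $\gamma$.
    have h2 : 0 < (e q.1 q.2 - (1 / 2) * ‖v q.1 q.2‖ ^ 2) ^ 2 := by positivity
    have h3 : (e q.1 q.2 - (1 / 2) * ‖v q.1 q.2‖ ^ 2) ^ 2 < 16 * (n : ℝ) ^ 2 * M * γ ^ 2 := by
      nlinarith
    exact (hc.eventually (gt_mem_nhds h3)).mono fun p hp => hp.le

theorem NegligibleIntegrand.shift {F : ℕ → ℝ → Sp n → ℝ} (hF : NegligibleIntegrand F) (m : ℕ) :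
    NegligibleIntegrand (fun k => F (k + m)) :=
  ⟨fun k => hF.1 (k + m), fun ε hε => (tendsto_add_atTop_nat m).eventually (hF.2 ε hε)⟩

/-- The subsolution $v$ is known to be continuous only for times inside $(0,T)$, while the
oscillation estimates use a globally continuous and bounded field. A cutoff provides one that agrees
with $v$ on the support of the perturbation. -/
theorem exists_continuous_extension {L O : Set (ℝ × Sp n)} (hL : IsCompact L) (hO : IsOpen O)
    (hLO : L ⊆ O) {V : ℝ × Sp n → Sp n} (hV : ContinuousOn V O) :
    ∃ W : ℝ × Sp n → Sp n, Continuous W ∧ (∃ D, ∀ p, ‖W p‖ ≤ D) ∧ EqOn W V L := by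
  obtain ⟨A, hA, hLA, hAO⟩ := exists_compact_between hL hO hLO
  obtain ⟨χ, hχ1, hχ0, hχc, -⟩ := exists_continuous_one_zero_of_isCompact hL
    isOpen_interior.isClosed_compl (disjoint_compl_right_iff_subset.2 hLA)
  have hsupp : tsupport χ ⊆ A := by
    refine closure_minimal (fun p hp => ?_) hA.isClosed
    by_contra hpA
    exact hp (hχ0 fun h => hpA (interior_subset h))
  have hc : Continuous (fun p => χ p • V p) := by
    refine continuous_of_tsupport fun p hp => ?_
    have hpO : p ∈ O := hAO (hsupp (tsupport_smul_subset_left _ _ hp))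
    exact χ.continuous.continuousAt.smul (hV.continuousAt (hO.mem_nhds hpO))
  refine ⟨_, hc, hc.bounded_above_of_compact_support hχc.smul_right, fun p hp => ?_⟩
  simp [hχ1 hp]

/-- Existence of highly oscillating perturbations of a subsolution with a quantitative gain of
kinetic energy. -/
theorem exists_perturbation_sequence (hn : 2 ≤ n) {T : ℝ} {Ω : Set (Sp n)} {ebar : SField n}
    {v₀ : VField n} {q₀ : SField n}
    (hecont : ContinuousOn (fun p : ℝ × Sp n => ebar p.1 p.2) (Ioo 0 T ×ˢ closure Ω))
    {v : VField n} (hv : v ∈ X0 T Ω ebar v₀ q₀) {Ω₀ : Set (Sp n)} (hΩ₀ : IsOpen Ω₀)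
    (hΩ : Ω₀ ⊆ Ω) {K : Set (ℝ × Sp n)} (hK : IsCompact K) (hKΩ : K ⊆ Ioo 0 T ×ˢ Ω₀) {M : ℝ}
    (hM : ∀ p ∈ K, ebar p.1 p.2 ≤ M) :
    ∃ (w : ℕ → VField n) (S : ℝ × Sp n → ℝ) (L : Set (ℝ × Sp n)),
      IsCompact L ∧ L ⊆ Ioo 0 T ×ˢ Ω₀ ∧ (∀ k t x, (t, x) ∉ L → w k t x = 0) ∧
      Continuous S ∧ HasCompactSupport S ∧ (∀ p, 0 ≤ S p) ∧
      (∀ p ∈ K, (ebar p.1 p.2 - (1 / 2) * ‖v p.1 p.2‖ ^ 2) ^ 2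
        ≤ 16 * (n : ℝ) ^ 2 * M * (2 ^ (n + 1) + 1) ^ 2 * S p) ∧
      (∀ k, v + w k ∈ X0 T Ω ebar v₀ q₀) ∧
      (∀ k, Continuous (fun p : ℝ × Sp n => w k p.1 p.2)) ∧
      (∀ ψ : Sp n → Sp n, LocallyIntegrable ψ → ∀ ε > 0, ∀ᶠ k in atTop, ∀ t,
        |∫ x, inner ℝ (w k t x) (ψ x)| ≤ ε) ∧
      NegligibleIntegrand (fun k t x => inner ℝ (v t x) (w k t x) + (1 / 2) * ‖w k t x‖ ^ 2
        - (1 / 4) * S (t, x)) := by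
  have hsub : IsSubsolution T Ω ebar v₀ q₀ v := hv
  obtain ⟨u, hu, hen, hus, hmom⟩ := hsub.exists_matrix
  have hn0 : 0 < n := by omega
  set O : Set (ℝ × Sp n) := Ioo 0 T ×ˢ Ω₀ with hO
  have hOo : IsOpen O := isOpen_Ioo.prod hΩ₀
  have hvO : ContinuousOn (fun p : ℝ × Sp n => v p.1 p.2) O :=
    hsub.smooth.continuousOn.mono (prod_mono_right (subset_univ _))
  have huO : ∀ i j, ContinuousOn (fun p : ℝ × Sp n => u p.1 p.2 i j) O := fun i j =>
    (hu.1 i j).continuousOn.mono (prod_mono_right (subset_univ _))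
  have heO : ContinuousOn (fun p : ℝ × Sp n => ebar p.1 p.2) O :=
    hecont.mono (prod_mono_right (hΩ.trans subset_closure))
  have hadm : ∀ p ∈ O, Admissible (v p.1 p.2) (u p.1 p.2) (ebar p.1 p.2) := fun p hp =>
    (genEnergy_lt_iff hn0 (hu.2 p.1 hp.1 p.2).1 _).1 (hen p.1 hp.1 p.2 (hΩ hp.2))
  have hloc : ∀ q : K, ∃ (f ξ : Sp n) (c γ : ℝ), ‖f‖ = 1 ∧ ‖ξ‖ = 1 ∧ inner ℝ f ξ = 0 ∧
      ∀ᶠ p in 𝓝 (q : ℝ × Sp n), p ∈ O ∧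
      (∀ s ∈ Icc (-1 : ℝ) 1, Admissible (v p.1 p.2 + (s * γ) • f)
        (u p.1 p.2 + (s * (γ * c)) • symProd f ξ) (ebar p.1 p.2)) ∧
      (ebar p.1 p.2 - (1 / 2) * ‖v p.1 p.2‖ ^ 2) ^ 2 ≤ 16 * (n : ℝ) ^ 2 * M * γ ^ 2 := by
    rintro ⟨q, hq⟩
    have hqO := hKΩ hq
    have hnb := hOo.mem_nhds hqO
    obtain ⟨f, ξ, c, γ, h1, h2, h3, h4⟩ := exists_local_segment hn (hvO.continuousAt hnb)
      (fun i j => (huO i j).continuousAt hnb) (heO.continuousAt hnb) (hu.2 q.1 hqO.1 q.2)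
      (hadm q hqO) (hM q hq)
    exact ⟨f, ξ, c, γ, h1, h2, h3, Filter.Eventually.and hnb h4⟩
  choose f ξ c γ hf hξ hfξ hev using hloc
  -- A Lebesgue number $\delta$ places every bump of the cover inside a single neighbourhood where
  -- one frozen segment is available.
  obtain ⟨δ, hδ, hball⟩ := lebesgue_number_lemma_of_metric (ι := K) hK
    (c := fun q => interior {p | p ∈ O ∧
      (∀ s ∈ Icc (-1 : ℝ) 1, Admissible (v p.1 p.2 + (s * γ q) • f q)
        (u p.1 p.2 + (s * (γ q * c q)) • symProd (f q) (ξ q)) (ebar p.1 p.2)) ∧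
      (ebar p.1 p.2 - (1 / 2) * ‖v p.1 p.2‖ ^ 2) ^ 2 ≤ 16 * (n : ℝ) ^ 2 * M * γ q ^ 2})
    (fun q => isOpen_interior)
    (fun q hq => mem_iUnion.2 ⟨⟨q, hq⟩, mem_interior_iff_mem_nhds.2 (hev ⟨q, hq⟩)⟩)
  obtain ⟨I, hI, η, hηs, hηc, hη0, hηsum, hηsq, hηb⟩ := exists_bump_family hK hδ
  have hcen : ∀ i : I, ∃ q : K, ∀ p ∈ tsupport (η i), p ∈ O ∧
      (∀ s ∈ Icc (-1 : ℝ) 1, Admissible (v p.1 p.2 + (s * γ q) • f q)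
        (u p.1 p.2 + (s * (γ q * c q)) • symProd (f q) (ξ q)) (ebar p.1 p.2)) ∧
      (ebar p.1 p.2 - (1 / 2) * ‖v p.1 p.2‖ ^ 2) ^ 2 ≤ 16 * (n : ℝ) ^ 2 * M * γ q ^ 2 := by
    intro i
    obtain ⟨q', hq', hsupp⟩ := hηb i
    obtain ⟨q, hq⟩ := hball q' hq'
    refine ⟨q, fun p hp => ?_⟩
    have hmem := interior_subset (hq (hsupp hp))
    exact hmem
  choose y hy using hcen
  -- One more than the overlap bound, so that the weights $\eta_i/\Lambda$ sum to strictly less than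
  -- $1$, as convexity requires.
  obtain ⟨Λ, hΛ⟩ : ∃ Λ : ℝ, Λ = 2 ^ (n + 1) + 1 := ⟨_, rfl⟩
  have hΛ0 : 0 < Λ := by rw [hΛ]; positivity
  set φ : I → ℝ × Sp n → ℝ := fun i p => γ (y i) / Λ * η i p with hφ
  have hφs : ∀ i, ContDiff ℝ ∞ (φ i) := fun i => contDiff_const.mul (hηs i)
  have hφc : ∀ i, HasCompactSupport (φ i) := fun i => (hηc i).mul_left
  set L : Set (ℝ × Sp n) := ⋃ i : I, tsupport (η i) with hL
  have hLc : IsCompact L := isCompact_iUnion fun i => hηc i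
  have hLO : L ⊆ O := iUnion_subset fun i p hp => (hy i p hp).1
  have hφL : ∀ i, tsupport (φ i) ⊆ L := fun i =>
    (tsupport_mul_subset_right (f := fun _ => γ (y i) / Λ)).trans
      (subset_iUnion (fun i : I => tsupport (η i)) i)
  obtain ⟨w, U, ζ, b, C, hζ, hζ', hC, hwU⟩ := exists_wave_family
    (fun i : I => hf (y i)) (fun i => hξ (y i)) (fun i => hfξ (y i)) (fun i => c (y i)) hφs hφc hφL
  have hwz : ∀ k t x, (t, x) ∉ L → w k t x = 0 := fun k t x h => ((hwU k).1.eq_zero t x h).1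
  have hwc : ∀ k, Continuous (fun p : ℝ × Sp n => w k p.1 p.2) := fun k =>
    (hwU k).1.smooth_v.continuous
  have hwct : ∀ k t, Continuous (w k t) := fun k t => (hwc k).comp (Continuous.prodMk_right t)
  obtain ⟨R, -, hR⟩ := exists_radius hLc
  have hwR : ∀ k t x, R < ‖x‖ → w k t x = 0 := fun k t x hx => hwz k t x (hR t x hx)
  have hφR : ∀ i t x, R < ‖x‖ → φ i (t, x) = 0 := fun i t x hx =>
    image_eq_zero_of_notMem_tsupport fun h => hR t x hx (hφL i h)
  obtain ⟨V, hVc, ⟨D, hD⟩, hVv⟩ := exists_continuous_extension hLc hOo hLO hvO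
  have hweak : ∀ ψ : Sp n → Sp n, LocallyIntegrable ψ → ∀ ε > 0, ∀ᶠ k in atTop, ∀ t,
      |∫ x, inner ℝ (w k t x) (ψ x)| ≤ ε := fun ψ hψ ε hε =>
    wave_tendsto_weakly (fun i : I => hf (y i)) (fun i => (hφs i).continuous) hφc
      (fun i h => hζ i i (by simp [h])) hC hwct hwR hφR (fun k t x => ((hwU k).2 t x).1) hψ hε
  have henergy : NegligibleIntegrand (fun k t x => inner ℝ (v t x) (w k t x)
      + (1 / 2) * ‖w k t x‖ ^ 2 - (1 / 4) * ∑ i, φ i (t, x) ^ 2) := by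
    convert wave_energy_negligible (fun i : I => hf (y i)) (fun i => (hφs i).continuous) hφc
      hζ hζ' hC hwct hwR hφR (fun k t x => ((hwU k).2 t x).1) hVc hD using 6 with k t x
    by_cases h : (t, x) ∈ L
    · rw [hVv h]
    · rw [hwz k t x h, inner_zero_right, inner_zero_right]
  -- the states attained in the limit form a compact set of admissible states
  set Z : (ℝ × Sp n) × (I → ℝ) → Sp n × (Fin n → Fin n → ℝ) × ℝ := fun z =>
    (v z.1.1 z.1.2 + ∑ i, (η i z.1 / Λ) • ((z.2 i * γ (y i)) • f (y i)),
      (fun l m => u z.1.1 z.1.2 l m + ∑ i, (η i z.1 / Λ) * ((z.2 i * (γ (y i) * c (y i))) *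
        symProd (f (y i)) (ξ (y i)) l m), ebar z.1.1 z.1.2)) with hZ
  -- The values of the cosines are replaced by free parameters in $[-1,1]$. The resulting set of
  -- states does not depend on $k$, so one stability margin serves all large frequencies.
  set Q : Set ((ℝ × Sp n) × (I → ℝ)) := L ×ˢ Set.pi univ (fun _ => Icc (-1 : ℝ) 1) with hQ
  have hQc : IsCompact Q := hLc.prod (isCompact_univ_pi fun _ => isCompact_Icc)
  have hZc : ContinuousOn Z Q := by
    have hm : MapsTo Prod.fst Q O := fun z hz => hLO hz.1
    have h1 : ContinuousOn (fun z : (ℝ × Sp n) × (I → ℝ) => v z.1.1 z.1.2) Q :=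
      hvO.comp continuousOn_fst hm
    have h2 : ∀ l m, ContinuousOn (fun z : (ℝ × Sp n) × (I → ℝ) => u z.1.1 z.1.2 l m) Q :=
      fun l m => (huO l m).comp continuousOn_fst hm
    have h3 : ContinuousOn (fun z : (ℝ × Sp n) × (I → ℝ) => ebar z.1.1 z.1.2) Q :=
      heO.comp continuousOn_fst hm
    have h4 : ∀ i : I, Continuous (fun z : (ℝ × Sp n) × (I → ℝ) => η i z.1) := fun i =>
      (hηs i).continuous.comp continuous_fst
    refine ContinuousOn.prodMk (h1.add (Continuous.continuousOn ?_)) (ContinuousOn.prodMk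
      (continuousOn_pi.2 fun l => continuousOn_pi.2 fun m =>
        (h2 l m).add (Continuous.continuousOn ?_)) h3)
    · refine continuous_finsetSum _ fun i _ => ?_
      have := h4 i
      fun_prop
    · refine continuous_finsetSum _ fun i _ => ?_
      have := h4 i
      fun_prop
  have hZadm : ∀ z ∈ Z '' Q, Admissible z.1 (Matrix.of z.2.1) z.2.2 := by
    rintro _ ⟨⟨p, s⟩, ⟨hp, hs⟩, rfl⟩
    have hcx := admissible_convex (ι := I) (hadm p (hLO hp))
      (p := fun i => (s i * γ (y i)) • f (y i))
      (q := fun i => (s i * (γ (y i) * c (y i))) • symProd (f (y i)) (ξ (y i)))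
      (a := fun i => η i p / Λ) (fun i => div_nonneg (hη0 i p) hΛ0.le) ?_ fun i hi => ?_
    · convert hcx using 1
      ext l m
      simp [hZ, Matrix.sum_apply]
    · rw [← Finset.sum_div, div_lt_one hΛ0, hΛ]
      linarith [hηsum p]
    · have hmem : p ∈ tsupport (η i) := by
        apply subset_tsupport
        intro h0
        exact hi (by simp [h0])
      exact (hy i p hmem).2.1 (s i) (hs i (mem_univ i))
  obtain ⟨ρ, hρ, hstab⟩ := exists_admissible_perturbation (hQc.image_of_continuousOn hZc) hZadm
  obtain ⟨k₀, hk₀⟩ : ∃ k₀ : ℕ, ∀ k, k₀ ≤ k → C / ((k : ℝ) + 1) ≤ ρ := by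
    have h1 : Tendsto (fun k : ℕ => C * (1 / ((k : ℝ) + 1))) atTop (𝓝 0) := by
      simpa using (tendsto_one_div_add_atTop_nhds_zero_nat (𝕜 := ℝ)).const_mul C
    obtain ⟨k₀, h⟩ := eventually_atTop.1 (h1.eventually (ge_mem_nhds hρ))
    exact ⟨k₀, fun k hk => by simpa [div_eq_mul_inv] using h k hk⟩
  have hX : ∀ k, k₀ ≤ k → v + w k ∈ X0 T Ω ebar v₀ q₀ := by
    intro k hk
    refine add_perturbation_mem_X0 hn0 hsub hu hen hus hmom hLc
      (hLO.trans (prod_mono_right hΩ)) (hwU k).1 fun p hp => ?_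
    set s : I → ℝ := fun i => Real.cos (((k : ℝ) + 1) * (inner ℝ (ζ i) p.2 - b i * p.1)) with hs
    have hsQ : (p, s) ∈ Q := ⟨hp, fun i _ => ⟨Real.neg_one_le_cos _, Real.cos_le_one _⟩⟩
    refine hstab (Z (p, s)) ⟨_, hsQ, rfl⟩ _ _ ?_ fun l m => ?_
    · have e : v p.1 p.2 + w k p.1 p.2 - (Z (p, s)).1
          = w k p.1 p.2 - waveSum φ (fun i => f (y i)) ζ b k p.1 p.2 := by
        have e1 : waveSum φ (fun i => f (y i)) ζ b k p.1 p.2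
            = ∑ i, (η i p / Λ) • ((s i * γ (y i)) • f (y i)) := by
          rw [waveSum]
          refine Finset.sum_congr rfl fun i _ => ?_
          rw [smul_smul]
          congr 1
          simp only [hφ, hs]
          ring
        rw [e1]
        simp only [hZ]
        abel
      rw [e]
      exact (((hwU k).2 p.1 p.2).1).trans (hk₀ k hk)
    · have e : (u p.1 p.2 + U k p.1 p.2) l m - (Z (p, s)).2.1 l m
          = U k p.1 p.2 l m - ∑ i, φ i (p.1, p.2) *
            Real.cos (((k : ℝ) + 1) * (inner ℝ (ζ i) p.2 - b i * p.1)) *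
              (c (y i) * symProd (f (y i)) (ξ (y i)) l m) := by
        have e1 : ∑ i, φ i (p.1, p.2) *
            Real.cos (((k : ℝ) + 1) * (inner ℝ (ζ i) p.2 - b i * p.1)) *
              (c (y i) * symProd (f (y i)) (ξ (y i)) l m)
            = ∑ i, (η i p / Λ) * ((s i * (γ (y i) * c (y i))) *
              symProd (f (y i)) (ξ (y i)) l m) := by
          refine Finset.sum_congr rfl fun i _ => ?_
          simp only [hφ, hs]
          ring
        rw [e1]
        simp only [hZ, Matrix.add_apply]
        ring
      rw [e]
      exact (((hwU k).2 p.1 p.2).2 l m).trans (hk₀ k hk)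
  -- The first $k_0$ fields, whose errors may exceed the margin, are dropped, so that every term of
  -- the sequence lies in `X0`.
  refine ⟨fun k => w (k + k₀), fun p => ∑ i, φ i p ^ 2, L, hLc, hLO,
    fun k => hwz (k + k₀), continuous_finsetSum _ fun i _ => (hφs i).continuous.pow 2, ?_,
    fun p => Finset.sum_nonneg fun i _ => sq_nonneg _, fun p hp => ?_,
    fun k => hX _ (Nat.le_add_left _ _), fun k => hwc _,
    fun ψ hψ ε hε => (tendsto_add_atTop_nat k₀).eventually (hweak ψ hψ ε hε), henergy.shift k₀⟩
  · refine HasCompactSupport.intro hLc fun p hp => Finset.sum_eq_zero fun i _ => ?_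
    rw [image_eq_zero_of_notMem_tsupport fun h => hp (hφL i h), zero_pow two_ne_zero]
  · rw [← hΛ]
    set d := (ebar p.1 p.2 - (1 / 2) * ‖v p.1 p.2‖ ^ 2) ^ 2 with hd
    -- On the support of $\eta_i$ the deficit squared is at most $16n^2M\gamma_i^2$, and
    -- $\varphi_i=\gamma_i\eta_i/\Lambda$. Summing and using $\sum\eta_i^2\ge1$ on `K` gives the
    -- lower bound for $S$.
    have hterm : ∀ i : I, d * η i p ^ 2 ≤ 16 * (n : ℝ) ^ 2 * M * Λ ^ 2 * φ i p ^ 2 := by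
      intro i
      have e : 16 * (n : ℝ) ^ 2 * M * Λ ^ 2 * φ i p ^ 2
          = 16 * (n : ℝ) ^ 2 * M * γ (y i) ^ 2 * η i p ^ 2 := by
        simp only [hφ]
        field_simp
      rw [e]
      by_cases h0 : η i p = 0
      · simp [h0]
      · exact mul_le_mul_of_nonneg_right ((hy i p (subset_tsupport _ h0)).2.2) (sq_nonneg _)
    calc d = d * 1 := (mul_one d).symm
      _ ≤ d * ∑ i : I, η i p ^ 2 := by
        refine mul_le_mul_of_nonneg_left ?_ (sq_nonneg _)
        exact hηsq p hp
      _ = ∑ i : I, d * η i p ^ 2 := Finset.mul_sum _ _ _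
      _ ≤ ∑ i : I, 16 * (n : ℝ) ^ 2 * M * Λ ^ 2 * φ i p ^ 2 :=
        Finset.sum_le_sum fun i _ => hterm i
      _ = _ := (Finset.mul_sum _ _ _).symm

end PerturbationSequence

/-! ### From the local gain of energy to the functional. -/

section Gain

variable {n : ℕ}

/-- A lower bound for the integral of a function controlling the square of another function whose
integral is bounded from below. -/
theorem le_setIntegral_of_sq_le {A : Set (Sp n)} (hA : MeasurableSet A) {D S : Sp n → ℝ}
    (hD : IntegrableOn D A) (hS : IntegrableOn S A) {V Q a : ℝ} (hV : 0 < V) (hQ : 0 < Q)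
    (hvol : volume A ≤ ENNReal.ofReal V) (ha : 0 ≤ a) (haD : a ≤ ∫ x in A, D x)
    (hDS : ∀ x ∈ A, D x ^ 2 ≤ Q * S x) : a ^ 2 / (V * Q) ≤ ∫ x in A, S x := by
  have hfin : volume A ≠ ⊤ := (hvol.trans_lt ENNReal.ofReal_lt_top).ne
  have hvol' : volume.real A ≤ V := ENNReal.toReal_le_of_le_ofReal hV.le hvol
  have hc : IntegrableOn (fun _ : Sp n => (a / V) ^ 2) A := integrableOn_const hfin
  -- Cauchy–Schwarz through the tangent line $D^2\ge 2(a/V)D-(a/V)^2$, which avoids assuming that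
  -- $D^2$ is integrable.
  have h1 : ∫ x in A, (2 * (a / V) * D x - (a / V) ^ 2) ≤ ∫ x in A, Q * S x := by
    refine setIntegral_mono_on ((hD.const_mul _).sub hc) (hS.const_mul Q) hA fun x hx => ?_
    nlinarith [hDS x hx, sq_nonneg (D x - a / V)]
  rw [integral_sub (hD.const_mul _) hc, integral_const_mul, integral_const_mul, setIntegral_const,
    smul_eq_mul] at h1
  have h2 : 2 * (a / V) * a ≤ 2 * (a / V) * ∫ x in A, D x := by gcongr
  have h3 : volume.real A * (a / V) ^ 2 ≤ V * (a / V) ^ 2 := by gcongr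
  have h4 : a ^ 2 / (V * Q) = (2 * (a / V) * a - V * (a / V) ^ 2) / Q := by
    field_simp
    ring
  rw [h4, div_le_iff₀ hQ]
  linarith

/-- The constant in the gain of energy. -/
noncomputable def gainConst (n : ℕ) (V M : ℝ) : ℝ :=
  1 / (4 * (16 * (V * (16 * (n : ℝ) ^ 2 * M * (2 ^ (n + 1) + 1) ^ 2))))

theorem gainConst_pos (hn : 2 ≤ n) {V M : ℝ} (hV : 0 < V) (hM : 0 < M) : 0 < gainConst n V M := by
  have : (0 : ℝ) < n := by exact_mod_cast (by omega : 0 < n)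
  unfold gainConst
  positivity

/-- A time whose integral exceeds $-\alpha/2$ is already more than $\alpha/2\ge\beta$ above the
infimum, which is below $-\alpha$, and needs only to lose almost nothing. The other times must gain
$\beta$. The errors are uniform in time and so pass to the infimum. -/
theorem functI_gain_le_liminf {T : ℝ} {ebar : SField n} {ε : ℝ} {Ω₀ : Set (Sp n)} {v : VField n}
    {w : ℕ → VField n} {α β : ℝ} (hI : functI T ebar ε Ω₀ v < ((-α : ℝ) : EReal)) (hβ : β ≤ α / 2)
    (h : ∀ δ > 0, ∀ᶠ k in atTop, ∀ t ∈ Icc ε (T - ε),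
      (∫ x in Ω₀, ((1 / 2) * ‖v t x‖ ^ 2 - ebar t x)) - δ
          ≤ ∫ x in Ω₀, ((1 / 2) * ‖w k t x‖ ^ 2 - ebar t x) ∧
      ((∫ x in Ω₀, ((1 / 2) * ‖v t x‖ ^ 2 - ebar t x)) ≤ -(α / 2) →
        (∫ x in Ω₀, ((1 / 2) * ‖v t x‖ ^ 2 - ebar t x)) + β - δ
          ≤ ∫ x in Ω₀, ((1 / 2) * ‖w k t x‖ ^ 2 - ebar t x))) :
    functI T ebar ε Ω₀ v + (β : EReal) ≤ liminf (fun k => functI T ebar ε Ω₀ (w k)) atTop := by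
  have hle : ∀ t ∈ Icc ε (T - ε), functI T ebar ε Ω₀ v
      ≤ ((∫ x in Ω₀, ((1 / 2) * ‖v t x‖ ^ 2 - ebar t x) : ℝ) : EReal) := fun t ht =>
    iInf₂_le t ht
  generalize hJ : functI T ebar ε Ω₀ v = J at *
  induction J with
  | bot => simp
  | top => exact absurd hI (not_lt.2 le_top)
  | coe I =>
    rw [EReal.coe_lt_coe_iff] at hI
    rw [← EReal.coe_add]
    refine le_of_forall_lt_imp_le_of_dense fun c hc => ?_
    obtain ⟨z, hcz, hz⟩ := EReal.lt_iff_exists_real_btwn.1 hc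
    rw [EReal.coe_lt_coe_iff] at hz
    refine hcz.le.trans (le_liminf_of_le (h := ?_))
    filter_upwards [h (I + β - z) (by linarith)] with k hk
    refine le_iInf₂ fun t ht => ?_
    rw [EReal.coe_le_coe_iff]
    have h0 := hle t ht
    rw [EReal.coe_le_coe_iff] at h0
    obtain ⟨h1, h2⟩ := hk t ht
    by_cases hc : (∫ x in Ω₀, ((1 / 2) * ‖v t x‖ ^ 2 - ebar t x)) ≤ -(α / 2)
    · linarith [h2 hc]
    · linarith [not_le.1 hc]

/-- The perturbation property with an explicit gain. -/
theorem exists_perturbations_with_gain (hn : 2 ≤ n) {T : ℝ} {Ω : Set (Sp n)} {ebar : SField n}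
    {v₀ : VField n} {u₀ : MField n} {q₀ : SField n} (hd : IsDatum T Ω ebar v₀ u₀ q₀)
    {Ω₀ : Set (Sp n)} (hΩ₀ : IsOpen Ω₀) (hΩ : Ω₀ ⊆ Ω) {V M : ℝ} (hV : 0 < V) (hM : 0 < M)
    (hvol : volume Ω₀ ≤ ENNReal.ofReal V) {ε : ℝ} (hε : 0 < ε)
    (heM : ∀ t ∈ Icc ε (T - ε), ∀ x ∈ Ω₀, ebar t x ≤ M) {α : ℝ} (hα : 0 < α) {v : VField n}
    (hv : v ∈ X0 T Ω ebar v₀ q₀) (hI : functI T ebar ε Ω₀ v < ((-α : ℝ) : EReal)) :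
    ∃ w : ℕ → VField n, (∀ k, w k ∈ X0 T Ω ebar v₀ q₀) ∧ TendstoCL2w T w v ∧
      functI T ebar ε Ω₀ v + ((min (α / 2) (gainConst n V M * α ^ 2) : ℝ) : EReal) ≤
        liminf (fun k => functI T ebar ε Ω₀ (w k)) atTop := by
  have hn' : (0 : ℝ) < n := by exact_mod_cast (by omega : 0 < n)
  have hsub : IsSubsolution T Ω ebar v₀ q₀ v := hv
  have hfin : volume Ω₀ ≠ ⊤ := (hvol.trans_lt ENNReal.ofReal_lt_top).ne
  have htime : ∀ t ∈ Icc ε (T - ε), t ∈ Ioo 0 T := fun t ht =>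
    ⟨by linarith [ht.1], by linarith [ht.2]⟩
  -- The choice $\alpha/(4M)$ ensures, since $\bar e-\frac12|v|^2\le M$, that at most $\alpha/4$ of
  -- the deficit lies outside $K_0$. The set is fixed before the time, so it serves every
  -- $t\in[\varepsilon,T-\varepsilon]$.
  obtain ⟨K₀, hK₀, hK₀c, hK₀v⟩ := hΩ₀.measurableSet.exists_isCompact_sdiff_lt hfin
    (ε := ENNReal.ofReal (α / (4 * M))) (by simpa using by positivity)
  obtain ⟨w, S, L, hL, hLΩ, hwz, hS, hSc, hS0, hSK, hX, hwc, hweak, hen⟩ :=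
    exists_perturbation_sequence hn hd.ebar_cont hv hΩ₀ hΩ (K := Icc ε (T - ε) ×ˢ K₀)
      (isCompact_Icc.prod hK₀c) (prod_mono (fun t ht => htime t ht) hK₀) (M := M)
      (fun p hp => heM p.1 hp.1 p.2 (hK₀ hp.2))
  obtain ⟨R, -, hR⟩ := exists_radius hL
  have hwL : ∀ k t, MemLp (w k t) 2 volume := fun k t =>
    memLp_of_continuous_of_eq_zero ((hwc k).comp (Continuous.prodMk_right t))
      fun x hx => hwz k t x (hR t x hx)
  refine ⟨fun k => v + w k, hX, fun φ hφ => ?_, functI_gain_le_liminf hI (min_le_left _ _)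
    fun δ hδ => ?_⟩
  · rw [Metric.tendstoUniformlyOn_iff]
    intro δ hδ
    filter_upwards [hweak φ (hφ.locallyIntegrable (by norm_num)) (δ / 2) (half_pos hδ)]
      with k hk t ht
    have e : ∫ x, inner ℝ ((v + w k) t x) (φ x)
        = (∫ x, inner ℝ (v t x) (φ x)) + ∫ x, inner ℝ (w k t x) (φ x) := by
      rw [← integral_add (integrable_inner_of_memLp (hsub.L2w.1 t ht) hφ)
        (integrable_inner_of_memLp (hwL k t) hφ)]
      simp only [Pi.add_apply, inner_add_left]
    rw [e, dist_self_add_right, Real.norm_eq_abs]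
    linarith [hk t]
  · filter_upwards [hen.2 δ hδ] with k hk t ht
    have ht' := htime t ht
    have ht'' : t ∈ Icc 0 T := Ioo_subset_Icc_self ht'
    have hSi : Integrable (fun x => S (t, x)) :=
      (hS.comp (Continuous.prodMk_right t)).integrable_of_hasCompactSupport <| by
        obtain ⟨r, -, hr⟩ := exists_radius hSc.isCompact
        exact HasCompactSupport.intro (isCompact_closedBall (0 : Sp n) r) fun x hx =>
          image_eq_zero_of_notMem_tsupport (f := S) (hr t x (by simpa using hx))
    have hv2 : Integrable (fun x => ‖v t x‖ ^ 2) :=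
      (memLp_two_iff_integrable_sq_norm (hsub.L2w.1 t ht'').aestronglyMeasurable).1
        (hsub.L2w.1 t ht'')
    have hei : IntegrableOn (ebar t) Ω₀ := (hd.ebar_L1.1 t ht'').mono_set hΩ
    have hF : IntegrableOn (fun x => (1 / 2) * ‖v t x‖ ^ 2 - ebar t x) Ω₀ :=
      (hv2.integrableOn.const_mul _).sub hei
    have hG : Integrable (fun x => inner ℝ (v t x) (w k t x) + (1 / 2) * ‖w k t x‖ ^ 2) := by
      refine ((hen.1 k t).add (hSi.const_mul (1 / 4))).congr (Eventually.of_forall fun x => ?_)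
      simp
    have e1 : ∫ x in Ω₀, ((1 / 2) * ‖(v + w k) t x‖ ^ 2 - ebar t x)
        = (∫ x in Ω₀, ((1 / 2) * ‖v t x‖ ^ 2 - ebar t x))
          + ∫ x, (inner ℝ (v t x) (w k t x) + (1 / 2) * ‖w k t x‖ ^ 2) := by
      have e2 : ∫ x in Ω₀, (inner ℝ (v t x) (w k t x) + (1 / 2) * ‖w k t x‖ ^ 2)
          = ∫ x, (inner ℝ (v t x) (w k t x) + (1 / 2) * ‖w k t x‖ ^ 2) := by
        refine setIntegral_eq_integral_of_forall_compl_eq_zero fun x hx => ?_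
        rw [hwz k t x fun h => hx (hLΩ h).2]
        simp
      rw [← e2, ← integral_add hF hG.integrableOn]
      congr 1
      ext x
      simp only [Pi.add_apply]
      rw [norm_add_sq_real]
      ring
    have e3 : ∫ x, (inner ℝ (v t x) (w k t x) + (1 / 2) * ‖w k t x‖ ^ 2)
        = (∫ x, (inner ℝ (v t x) (w k t x) + (1 / 2) * ‖w k t x‖ ^ 2 - (1 / 4) * S (t, x)))
          + (1 / 4) * ∫ x, S (t, x) := by
      rw [integral_sub hG (hSi.const_mul _), integral_const_mul]
      ring
    have hkt := (abs_le.1 (hk t)).1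
    have hSpos : 0 ≤ ∫ x, S (t, x) := integral_nonneg fun x => hS0 _
    rw [e1, e3]
    refine ⟨by linarith, fun hneg => ?_⟩
    suffices hgain : gainConst n V M * α ^ 2 ≤ (1 / 4) * ∫ x, S (t, x) by
      linarith [min_le_right (α / 2) (gainConst n V M * α ^ 2)]
    have hDi : IntegrableOn (fun x => ebar t x - (1 / 2) * ‖v t x‖ ^ 2) Ω₀ :=
      hei.sub (hv2.integrableOn.const_mul _)
    have hDneg : ∫ x in Ω₀, (ebar t x - (1 / 2) * ‖v t x‖ ^ 2)
        = -∫ x in Ω₀, ((1 / 2) * ‖v t x‖ ^ 2 - ebar t x) := by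
      rw [← integral_neg]
      congr 1
      ext x
      ring
    have hsplit := setIntegral_sdiff hK₀c.measurableSet hDi hK₀
    have hrest : ∫ x in Ω₀ \ K₀, (ebar t x - (1 / 2) * ‖v t x‖ ^ 2) ≤ α / 4 := by
      have hfd : volume (Ω₀ \ K₀) ≠ ⊤ := (hK₀v.trans ENNReal.ofReal_lt_top).ne
      have h1 : ∫ x in Ω₀ \ K₀, (ebar t x - (1 / 2) * ‖v t x‖ ^ 2) ≤ ∫ _x in Ω₀ \ K₀, M := by
        refine setIntegral_mono_on (hDi.mono_set sdiff_subset) (integrableOn_const hfd)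
          (hΩ₀.measurableSet.diff hK₀c.measurableSet) fun x hx => ?_
        have := heM t ht x hx.1
        have := sq_nonneg ‖v t x‖
        linarith
      rw [setIntegral_const, smul_eq_mul] at h1
      have h2 : volume.real (Ω₀ \ K₀) ≤ α / (4 * M) :=
        ENNReal.toReal_le_of_le_ofReal (by positivity) hK₀v.le
      have h3 : volume.real (Ω₀ \ K₀) * M ≤ α / (4 * M) * M := by gcongr
      have h4 : α / (4 * M) * M = α / 4 := by field_simp
      linarith
    -- A deficit of at least $\alpha/2$ on $\Omega_0$, less the $\alpha/4$ lost outside $K_0$,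
    -- leaves $\alpha/4$. Its square is the source of the $16$ next to $V$ in `gainConst`; the outer
    -- $4$ comes from the averages of $\frac12\cos^2$.
    have hmain := le_setIntegral_of_sq_le (A := K₀) (S := fun x => S (t, x)) (a := α / 4)
      hK₀c.measurableSet (hDi.mono_set hK₀) hSi.integrableOn hV
      (Q := 16 * (n : ℝ) ^ 2 * M * (2 ^ (n + 1) + 1) ^ 2) (by positivity)
      ((measure_mono hK₀).trans hvol) (by positivity) (by linarith)
      fun x hx => hSK (t, x) ⟨ht, hx⟩
    have hle : ∫ x in K₀, S (t, x) ≤ ∫ x, S (t, x) :=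
      setIntegral_le_integral hSi (Eventually.of_forall fun x => hS0 _)
    have hconst : gainConst n V M * α ^ 2 = (1 / 4) *
        ((α / 4) ^ 2 / (V * (16 * (n : ℝ) ^ 2 * M * (2 ^ (n + 1) + 1) ^ 2))) := by
      rw [gainConst]
      field_simp
      ring
    rw [hconst]
    linarith

end Gain

end EulerSub

/-! ### The perturbation property, with the constants supplied in both cases. -/

theorem mainTheorem5 (n : ℕ) (hn : 2 ≤ n) :
    -- the perturbation property
    (∀ (T : ℝ) (_ : 0 < T) (Ω : Set (EulerSub.Sp n)) (ebar : EulerSub.SField n)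
        (v₀ : EulerSub.VField n) (u₀ : EulerSub.MField n) (q₀ : EulerSub.SField n),
      EulerSub.IsDatum T Ω ebar v₀ u₀ q₀ →
      ∀ Ω₀ : Set (EulerSub.Sp n), IsOpen Ω₀ → Bornology.IsBounded Ω₀ → Ω₀ ⊆ Ω →
      ∀ ε : ℝ, 0 < ε → ∀ α : ℝ, 0 < α →
      ∃ β : ℝ, 0 < β ∧
        ∀ v ∈ EulerSub.X0 T Ω ebar v₀ q₀,
          EulerSub.functI T ebar ε Ω₀ v < ((-α : ℝ) : EReal) →
          ∃ w : ℕ → EulerSub.VField n,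
            (∀ k, w k ∈ EulerSub.X0 T Ω ebar v₀ q₀) ∧
            EulerSub.TendstoCL2w T w v ∧
            EulerSub.functI T ebar ε Ω₀ v + (β : EReal) ≤
              Filter.liminf (fun k => EulerSub.functI T ebar ε Ω₀ (w k)) Filter.atTop) ∧
    -- the explicit gain for bounded `Ω` and bounded `ebar`;
    -- `C` depends only on bounds for the volume of `Ω` and for `|ebar|` (and on `n`)
    (∀ V M : ℝ, ∃ C : ℝ, 0 < C ∧
      ∀ (T : ℝ) (_ : 0 < T) (Ω : Set (EulerSub.Sp n)) (ebar : EulerSub.SField n)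
        (v₀ : EulerSub.VField n) (u₀ : EulerSub.MField n) (q₀ : EulerSub.SField n),
      EulerSub.IsDatum T Ω ebar v₀ u₀ q₀ →
      Bornology.IsBounded Ω → MeasureTheory.volume Ω ≤ ENNReal.ofReal V →
      (∀ t ∈ Set.Ioo 0 T, ∀ x ∈ closure Ω, |ebar t x| ≤ M) →
      ∀ Ω₀ : Set (EulerSub.Sp n), IsOpen Ω₀ → Bornology.IsBounded Ω₀ → Ω₀ ⊆ Ω →
      ∀ ε : ℝ, 0 < ε → ∀ α : ℝ, 0 < α →
        ∀ v ∈ EulerSub.X0 T Ω ebar v₀ q₀,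
          EulerSub.functI T ebar ε Ω₀ v < ((-α : ℝ) : EReal) →
          ∃ w : ℕ → EulerSub.VField n,
            (∀ k, w k ∈ EulerSub.X0 T Ω ebar v₀ q₀) ∧
            EulerSub.TendstoCL2w T w v ∧
            EulerSub.functI T ebar ε Ω₀ v + ((min (α / 2) (C * α ^ 2) : ℝ) : EReal) ≤
              Filter.liminf (fun k => EulerSub.functI T ebar ε Ω₀ (w k)) Filter.atTop) := by
  constructor
  · intro T _ Ω ebar v₀ u₀ q₀ hd Ω₀ hΩ₀ hb hΩ ε hε α hα
    -- Continuity of $\bar e$ up to the boundary of $\Omega$ is what bounds it here: the closure of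
    -- $\Omega_0$ may touch $\partial\Omega$, but the times stay away from $0$ and $T$.
    have hcomp : IsCompact (Set.Icc ε (T - ε) ×ˢ closure Ω₀) :=
      isCompact_Icc.prod hb.isCompact_closure
    have hsubset : Set.Icc ε (T - ε) ×ˢ closure Ω₀ ⊆ Set.Ioo 0 T ×ˢ closure Ω :=
      Set.prod_mono (fun t ht => ⟨by linarith [ht.1], by linarith [ht.2]⟩) (closure_mono hΩ)
    obtain ⟨M, hM⟩ := hcomp.exists_bound_of_continuousOn (hd.ebar_cont.mono hsubset)
    have hV : MeasureTheory.volume Ω₀ ≤ ENNReal.ofReal (max (MeasureTheory.volume Ω₀).toReal 1) :=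
      (ENNReal.le_ofReal_iff_toReal_le hb.measure_lt_top.ne (by positivity)).2 (le_max_left _ _)
    have hV0 : 0 < max (MeasureTheory.volume Ω₀).toReal 1 := by positivity
    have hM0 : 0 < max M 1 := by positivity
    refine ⟨min (α / 2) (EulerSub.gainConst n (max (MeasureTheory.volume Ω₀).toReal 1) (max M 1)
      * α ^ 2), lt_min (half_pos hα) (mul_pos (EulerSub.gainConst_pos hn hV0 hM0) (by positivity)),
      fun v hv hI => ?_⟩
    refine EulerSub.exists_perturbations_with_gain hn hd hΩ₀ hΩ hV0 hM0 hV hε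
      (fun t ht x hx => ?_) hα hv hI
    exact ((le_abs_self _).trans (hM (t, x) ⟨ht, subset_closure hx⟩)).trans (le_max_left _ _)
  · intro V M
    -- The given bounds may be zero or negative; replacing them by their maximum with $1$ keeps them
    -- valid and the constant positive.
    have hV0 : 0 < max V 1 := by positivity
    have hM0 : 0 < max M 1 := by positivity
    refine ⟨EulerSub.gainConst n (max V 1) (max M 1), EulerSub.gainConst_pos hn hV0 hM0, ?_⟩
    intro T _ Ω ebar v₀ u₀ q₀ hd _ hvol hM Ω₀ hΩ₀ _ hΩ ε hε α hα v hv hI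
    refine EulerSub.exists_perturbations_with_gain hn hd hΩ₀ hΩ hV0 hM0
      ((MeasureTheory.measure_mono hΩ).trans
        (hvol.trans (ENNReal.ofReal_le_ofReal (le_max_left _ _)))) hε (fun t ht x hx => ?_) hα hv hI
    exact ((le_abs_self _).trans (hM t ⟨by linarith [ht.1], by linarith [ht.2]⟩ x
      (subset_closure (hΩ hx)))).trans (le_max_left _ _)
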